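/- **Definitions.** A *category with covers* $(\mathcal C,\mathcal S)$ is a category $\mathcal C$ with a subcategory $\mathcal S$ of morphisms, the *covers*, such that: (a) $\mathcal C$ has a terminal object $\ast$ and every $X\to\ast$ is a cover; (b) pullbacks of covers along arbitrary morphisms exist, and covers are closed under base change; (c) if $f$ and $g\circ f$ are covers, so is $g$; (d) every cover is an effective epimorphism. A *descent category* $(\mathcal D,\mathcal S)$ is a category with all finite limits and a subcategory $\mathcal S$ of covers such that the identity of $\ast$ is a cover, covers are closed under base change, and (c) and (d) hold. A functor $F\colon\mathcal C\to\mathcal D$ from a category with covers to a descent category is *geometric* if it sends covers to covers and preserves pullbacks of covers; it *reflects covers* if $f$ is a cover whenever $F(f)$ is a cover. For a simplicial object $X_\bullet$ and a simplicial set $A$ write $X^A=\hom(A,X_\bullet)$ for the object (if it exists) that represents $U\mapsto \mathrm{Hom}_{s\mathrm{Set}}(A,\mathrm{Hom}(U,X_\bullet))$; likewise, $X^A\times_{Y^A}Y_n$ is understood as a single limit, which is required to exist. A morphism $f\colon X_\bullet\to Y_\bullet$ of simplicial objects is a *Kan fibration* if $X_n\to X^{\Lambda^n_k}\times_{Y^{\Lambda^n_k}}Y_n$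 is a cover for all $n\ge1$, $0\le k\le n$, and a *hypercover* if $X_m\to X^{\partial\Delta^m}\times_{Y^{\partial\Delta^m}}Y_m$ is a cover for all $m\ge0$. The full subcategory $\mathsf{Gpd}_\infty$ of *$\infty$-groupoids* consists of the $X_\bullet$ for which $X_\bullet\to\ast$ is a Kan fibration. The path space of $X_\bullet$ is $X^I_\bullet=\hom(\Delta^\bullet\times\Delta^1,X_\bullet)$, with the canonical morphisms $s\colon X\to X^I$ and $d_0,d_1\colon X^I\to X$ induced by $\Delta^1\to\Delta^0$ and by the two vertices of $\Delta^1$. A morphism $f\colon X\to Y$ in $\mathsf{Gpd}_\infty(\mathcal D)$, for a descent category $\mathcal D$, is a *weak equivalence* if $X\times_{f,Y,d_0}Y^I\xrightarrow{d_1}Y$ is a hypercover. An *incomplete category of fibrant objects (iCFO)* is a category with finite products and two wide subcategories, weak equivalences and fibrations (morphisms in both are *acyclic fibrations*), such that: isomorphisms are acyclic fibrations; weak equivalences satisfy 2 out of 3; if the pullback of a fibration exists, it is a fibration; the pullback of any acyclic fibration exists and is an acyclic fibration; every $X$ has a path object, i.e. a factorization $X\xrightarrow{s}P\xrightarrow{(d_0,d_1)}X\times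 X$ of the diagonal into a weak equivalence followed by a fibration; every $X\to\ast$ is a fibration. **Statement.** Let $F\colon(\mathcal C,\mathcal S_{\mathcal C})\to(\mathcal D,\mathcal S_{\mathcal D})$ be a geometric functor, from a category with covers to a descent category, that reflects covers. Then $F$ induces, levelwise, a functor $F_\bullet\colon\mathsf{Gpd}_\infty(\mathcal C)\to\mathsf{Gpd}_\infty(\mathcal D)$. Call a morphism $f$ of $\mathsf{Gpd}_\infty(\mathcal C)$ a weak equivalence if $F_\bullet(f)$ is a weak equivalence in $\mathsf{Gpd}_\infty(\mathcal D)$, and a fibration if it is a Kan fibration. With these classes $\mathsf{Gpd}_\infty(\mathcal C)$ is an iCFO. The path spaces $X^I_\bullet$ exist, are $\infty$-groupoids, and together with $s$, $d_0$, $d_1$ form functorial path objects for this structure. Moreover, the acyclic fibrations of $\mathsf{Gpd}_\infty(\mathcal C)$ are exactly the hypercovers. -/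

import Mathlib

open CategoryTheory Limits Opposite Simplicial MonoidalCategory CartesianMonoidalCategory

universe v v' u u'

namespace HigherGpd

/-! ### Categories with covers, descent categories, geometric functors -/

section Covers

variable {C : Type u} [Category.{v} C] {D : Type u'} [Category.{v'} D]

/-- A (subcanonical) category with covers. The covers form a subcategory: they are closed under
composition, and identities are covers because they are base changes of `⊤_ C ⟶ ⊤_ C`. Since
pullbacks of covers exist, `EffectiveEpi f` says that `f` is the coequalizer of its
kernel pair. -/
class IsCategoryWithCovers [HasTerminal C] (S : MorphismProperty C) : Prop where
  comp_mem : S.IsStableUnderComposition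
  terminal_mem (X : C) : S (terminal.from X)
  hasPullback {X Y Z : C} (f : X ⟶ Z) (g : Y ⟶ Z) : S f → HasPullback f g
  baseChange_mem : S.IsStableUnderBaseChange
  cancel {X Y Z : C} (f : X ⟶ Y) (g : Y ⟶ Z) : S f → S (f ≫ g) → S g
  effectiveEpi {X Y : C} (f : X ⟶ Y) : S f → EffectiveEpi f

/-- A (subcanonical) descent category; the existence of finite limits is the instance argument. -/
class IsDescentCategory [HasFiniteLimits D] (S : MorphismProperty D) : Prop where
  comp_mem : S.IsStableUnderComposition
  terminal_mem : S (𝟙 (⊤_ D))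
  baseChange_mem : S.IsStableUnderBaseChange
  cancel {X Y Z : D} (f : X ⟶ Y) (g : Y ⟶ Z) : S f → S (f ≫ g) → S g
  effectiveEpi {X Y : D} (f : X ⟶ Y) : S f → EffectiveEpi f

/-- A geometric functor preserves covers and pullbacks of covers. -/
structure IsGeometric (SC : MorphismProperty C) (SD : MorphismProperty D) (F : C ⥤ D) :
    Prop where
  map_cover {X Y : C} (f : X ⟶ Y) : SC f → SD (F.map f)
  map_isPullback {P X Y Z : C} {a : P ⟶ X} {b : P ⟶ Y} {f : X ⟶ Z} {g : Y ⟶ Z} :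
    IsPullback a b f g → SC f → IsPullback (F.map a) (F.map b) (F.map f) (F.map g)

/-- A functor reflects covers if every morphism that it sends to a cover is a cover. -/
def ReflectsCovers (SC : MorphismProperty C) (SD : MorphismProperty D) (F : C ⥤ D) : Prop :=
  ∀ ⦃X Y : C⦄ (f : X ⟶ Y), SD (F.map f) → SC f

end Covers

/-! ### Matching objects, Kan fibrations, hypercovers, `∞`-groupoids -/

section Simplicial

variable {C : Type u} [Category.{v} C]

/-- The functor of points of a simplicial object: `X` is sent to the presheaf of simplicial sets
`U ↦ X(U)`, with `X(U)ₙ = Hom(U, Xₙ)`. -/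
def points : SimplicialObject C ⥤ Cᵒᵖ ⥤ SSet.{v} where
  obj X :=
    { obj := fun U => X ⋙ coyoneda.obj U
      map := fun g => Functor.whiskerLeft X (coyoneda.map g) }
  map f := { app := fun U => Functor.whiskerRight f (coyoneda.obj U) }

/-- For a morphism of simplicial sets `i : A ⟶ B` and a morphism of simplicial objects
`f : X ⟶ Y`, the presheaf represented by `X^A ×_{Y^A} Y^B`: its value at `U` is the set of
commutative squares from `i` to `f(U) : X(U) ⟶ Y(U)`. -/
def matchingPresheaf {A B : SSet.{v}} (i : A ⟶ B) {X Y : SimplicialObject C} (f : X ⟶ Y) :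
    Cᵒᵖ ⥤ Type v where
  obj U := { p : (A ⟶ (points.obj X).obj U) × (B ⟶ (points.obj Y).obj U) //
    p.1 ≫ (points.map f).app U = i ≫ p.2 }
  map {U V} g := ↾fun p => ⟨(p.1.1 ≫ (points.obj X).map g, p.1.2 ≫ (points.obj Y).map g), by
    have h := p.2
    simp only [Category.assoc, NatTrans.naturality]
    rw [reassoc_of% h]⟩

/-- The tautological `n`-simplex of `X(Xₙ)`, namely `𝟙 Xₙ`. -/
noncomputable def tautological (X : SimplicialObject C) (n : ℕ) :
    (Δ[n] : SSet.{v}) ⟶ (points.obj X).obj (op (X _⦋n⦌)) :=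
  SSet.yonedaEquiv.symm (𝟙 (X _⦋n⦌) : X _⦋n⦌ ⟶ X _⦋n⦌)

/-- The element of `matchingPresheaf i f` over `Xₙ` that corresponds to the canonical morphism
`Xₙ ⟶ X^A ×_{Y^A} Yₙ`. -/
noncomputable def canonicalElement {A : SSet.{v}} {n : ℕ} (i : A ⟶ Δ[n])
    {X Y : SimplicialObject C} (f : X ⟶ Y) : (matchingPresheaf i f).obj (op (X _⦋n⦌)) :=
  ⟨(i ≫ tautological X n, tautological X n ≫ (points.map f).app (op (X _⦋n⦌))),
    Category.assoc _ _ _⟩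

/-- The limit `X^A ×_{Y^A} Yₙ` exists in `C` and the canonical morphism
`Xₙ ⟶ X^A ×_{Y^A} Yₙ` is in `S`. It is not required that `X^A` and `Y^A` exist separately. -/
def MatchingCondition (S : MorphismProperty C) {A : SSet.{v}} {n : ℕ} (i : A ⟶ Δ[n])
    {X Y : SimplicialObject C} (f : X ⟶ Y) : Prop :=
  ∃ (M : C) (r : (matchingPresheaf i f).RepresentableBy M),
    S (r.homEquiv.symm (canonicalElement i f))

/-- Kan fibrations between simplicial objects: `Kan(n + 1, k)` for all `n ≥ 0` and
`0 ≤ k ≤ n + 1`. -/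
def kanFibrations (S : MorphismProperty C) : MorphismProperty (SimplicialObject C) :=
  fun _ _ f => ∀ (n : ℕ) (k : Fin (n + 2)), MatchingCondition S (Λ[n + 1, k]).ι f

/-- Hypercovers between simplicial objects: `Acyc(m)` for all `m ≥ 0`. -/
def hypercovers (S : MorphismProperty C) : MorphismProperty (SimplicialObject C) :=
  fun _ _ f => ∀ m : ℕ, MatchingCondition S (∂Δ[m]).ι f

/-- The simplicial objects `X` for which `X ⟶ *` is a Kan fibration. -/
def isInftyGroupoid [HasTerminal C] (S : MorphismProperty C) :
    ObjectProperty (SimplicialObject C) :=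
  fun X => kanFibrations S (terminal.from X)

/-- The category of `∞`-groupoid objects, a full subcategory of the simplicial objects. -/
abbrev Gpd [HasTerminal C] (S : MorphismProperty C) := (isInftyGroupoid S).FullSubcategory

/-- Kan fibrations between `∞`-groupoids. -/
def gpdKanFibrations [HasTerminal C] (S : MorphismProperty C) : MorphismProperty (Gpd S) :=
  (kanFibrations S).inverseImage (isInftyGroupoid S).ι

/-- Hypercovers between `∞`-groupoids. -/
def gpdHypercovers [HasTerminal C] (S : MorphismProperty C) : MorphismProperty (Gpd S) :=
  (hypercovers S).inverseImage (isInftyGroupoid S).ι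

end Simplicial

/-! ### The path space `X^I = hom(Δ^• × Δ¹, X)` -/

section Path

/-- The cosimplicial simplicial set `n ↦ Δ[n] × Δ[1]`. -/
noncomputable def cylinder : SimplexCategory ⥤ SSet.{v} :=
  SSet.stdSimplex ⋙ tensorRight Δ[1]

/-- The functor that sends a simplicial set `Z` to the simplicial set
`n ↦ Hom(Δ[n] × Δ[1], Z)`. -/
noncomputable def pathSSet : SSet.{v} ⥤ SSet.{v} :=
  yoneda ⋙ (Functor.whiskeringLeft _ _ _).obj cylinder.op

/-- The map `Z ⟶ hom(Δ[•] × Δ[1], Z)` induced by `Δ[1] ⟶ Δ[0]`. -/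
noncomputable def constPath (Z : SSet.{v}) : Z ⟶ pathSSet.obj Z where
  app n := ↾fun z => fst (SSet.stdSimplex.obj n.unop) Δ[1] ≫ SSet.yonedaEquiv.symm z
  naturality n m g := by
    ext z
    change fst _ _ ≫ SSet.yonedaEquiv.symm (Z.map g z) =
      (SSet.stdSimplex.map g.unop ▷ Δ[1]) ≫ fst _ _ ≫ SSet.yonedaEquiv.symm z
    have h : SSet.stdSimplex.map g.unop ≫ SSet.yonedaEquiv.symm z =
        SSet.yonedaEquiv.symm (Z.map g z) := SSet.yonedaEquiv_symm_naturality_left _ _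
    rw [← h]
    rfl

/-- The map `hom(Δ[•] × Δ[1], Z) ⟶ Z` induced by the vertex `0` of `Δ[1]`. -/
noncomputable def evalZero (Z : SSet.{v}) : pathSSet.obj Z ⟶ Z where
  app n := ↾fun φ : SSet.stdSimplex.obj n.unop ⊗ Δ[1] ⟶ Z => SSet.yonedaEquiv (SSet.ι₀ ≫ φ)
  naturality n m g := by
    ext φ
    change SSet.yonedaEquiv (SSet.ι₀ ≫ (SSet.stdSimplex.map g.unop ▷ Δ[1]) ≫ φ) =
      Z.map g (SSet.yonedaEquiv (SSet.ι₀ ≫ φ))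
    exact (SSet.yonedaEquiv_naturality g.unop (SSet.ι₀ ≫ φ)).symm

/-- The map `hom(Δ[•] × Δ[1], Z) ⟶ Z` induced by the vertex `1` of `Δ[1]`. -/
noncomputable def evalOne (Z : SSet.{v}) : pathSSet.obj Z ⟶ Z where
  app n := ↾fun φ : SSet.stdSimplex.obj n.unop ⊗ Δ[1] ⟶ Z => SSet.yonedaEquiv (SSet.ι₁ ≫ φ)
  naturality n m g := by
    ext φ
    change SSet.yonedaEquiv (SSet.ι₁ ≫ (SSet.stdSimplex.map g.unop ▷ Δ[1]) ≫ φ) =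
      Z.map g (SSet.yonedaEquiv (SSet.ι₁ ≫ φ))
    exact (SSet.yonedaEquiv_naturality g.unop (SSet.ι₁ ≫ φ)).symm

variable {C : Type u} [Category.{v} C]

/-- `e` exhibits the simplicial object `P` as the path space `X^I` of `X`, that is, `Pₙ` as the
limit `hom(Δ[n] × Δ[1], X)` in `C`, compatibly with the simplicial structure; and `s`, `d₀`, `d₁`
are the canonical morphisms, induced by `Δ[1] ⟶ Δ[0]` and by the two vertices of `Δ[1]`. -/
structure IsPathSpace {X P : SimplicialObject C} (e : points.obj P ≅ points.obj X ⋙ pathSSet)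
    (s : X ⟶ P) (d₀ d₁ : P ⟶ X) : Prop where
  s_eq (U : Cᵒᵖ) :
    (points.map s).app U ≫ e.hom.app U = constPath ((points.obj X).obj U)
  d₀_eq (U : Cᵒᵖ) :
    (points.map d₀).app U = e.hom.app U ≫ evalZero ((points.obj X).obj U)
  d₁_eq (U : Cᵒᵖ) :
    (points.map d₁).app U = e.hom.app U ≫ evalOne ((points.obj X).obj U)

/-- The weak equivalences of the canonical structure of a category of fibrant objects on the
`∞`-groupoids of a descent category: `f : X ⟶ Y` is a weak equivalence if and only if
`X ×_Y Y^I ⟶ Y` (pull back along evaluation at `0`, then evaluate at `1`) is a hypercover.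
In a descent category, `Y^I` and the pullback exist and are unique up to isomorphism. -/
def gpdWeakEquivalences [HasTerminal C] (S : MorphismProperty C) : MorphismProperty (Gpd S) :=
  fun X Y f => ∃ (P : SimplicialObject C) (e : points.obj P ≅ points.obj Y.obj ⋙ pathSSet)
    (s : Y.obj ⟶ P) (d₀ d₁ : P ⟶ Y.obj) (Q : SimplicialObject C) (a : Q ⟶ X.obj) (b : Q ⟶ P),
    IsPathSpace e s d₀ d₁ ∧ IsPullback a b f.hom d₀ ∧ hypercovers S (b ≫ d₁)

/-- The functor `F_•` between the categories of `∞`-groupoids that is induced by a functor `F`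
which sends `∞`-groupoids to `∞`-groupoids. -/
def gpdMap [HasTerminal C] {D : Type u'} [Category.{v'} D] [HasTerminal D]
    {SC : MorphismProperty C} {SD : MorphismProperty D} (F : C ⥤ D)
    (h : ∀ X : Gpd SC,
      isInftyGroupoid SD (((SimplicialObject.whiskering C D).obj F).obj X.obj)) :
    Gpd SC ⥤ Gpd SD :=
  (isInftyGroupoid SD).lift
    ((isInftyGroupoid SC).ι ⋙ (SimplicialObject.whiskering C D).obj F) h

end Path

/-! ### Incomplete categories of fibrant objects -/

section ICFO

variable {E : Type u} [Category.{v} E] [HasFiniteProducts E]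

/-- `X ⟶ P ⟶ X ⨯ X` is a path object for `X`. -/
structure IsPathObject (W Fib : MorphismProperty E) {X P : E} (s : X ⟶ P) (d₀ d₁ : P ⟶ X) :
    Prop where
  weq : W s
  fib : Fib (prod.lift d₀ d₁)
  fac : s ≫ prod.lift d₀ d₁ = diag X

/-- Incomplete categories of fibrant objects, with weak equivalences `W` and fibrations `Fib`. -/
structure IsICFO (W Fib : MorphismProperty E) : Prop where
  weq_subcategory : W.IsMultiplicative
  fib_subcategory : Fib.IsMultiplicative
  iso_mem {X Y : E} (f : X ⟶ Y) : IsIso f → W f ∧ Fib f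
  two_out_of_three : W.HasTwoOutOfThreeProperty
  fib_baseChange : Fib.IsStableUnderBaseChange
  acyclic_hasPullback {X Y Z : E} (f : X ⟶ Z) (g : Y ⟶ Z) : W f → Fib f → HasPullback f g
  acyclic_baseChange : (W ⊓ Fib).IsStableUnderBaseChange
  exists_pathObject (X : E) :
    ∃ (P : E) (s : X ⟶ P) (d₀ d₁ : P ⟶ X), IsPathObject W Fib s d₀ d₁
  fibrant (X : E) : Fib (terminal.from X)

/-- A functorial choice of path objects. -/
structure FunctorialPathObject (W Fib : MorphismProperty E) where
  path : E ⥤ E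
  s : 𝟭 E ⟶ path
  d₀ : path ⟶ 𝟭 E
  d₁ : path ⟶ 𝟭 E
  isPathObject (X : E) : IsPathObject W Fib (s.app X) (d₀.app X) (d₁.app X)

end ICFO

end HigherGpd

open HigherGpd

/-!
The proof translates all notions into lifting conditions for the functors of points, which are
presheaves of simplicial sets. A morphism of presheaves is a relative cover (`RelCover`) if its base
changes to representable presheaves are representable by covers. For `i : A ⟶ B` and `f : X ⟶ Y`,
`LiftCover S i f` says that `X^B ⟶ X^A ×_{Y^A} Y^B` is a relative cover. It is stable under
composition and cobase change in `i` and under composition and base change in `f`, without any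
limits in the base category. Kan fibrations (`kan`) and hypercovers (`hyper`) are the cases of horns
and of boundaries; their matching objects exist automatically between `∞`-groupoids
(`kanFibrations_iff`, `hypercovers_iff`).

* Combinatorics: subcomplexes of the nerve of a finite partially ordered set `Q` are encoded by
  families of chains in `Q`. A family that is matched by adding or removing one vertex gives a
  sequence of horn fillings (`LiftCover.of_toggle`). This handles the inclusions of a vertex into a
  horn or a simplex, and the pushout products of horns and boundaries with the ends of the interval.
* Path spaces: by adjunction, the gap morphisms of `X^I` are governed by these pushout products.
  For a Kan fibration `f : X ⟶ Y` the morphism `X^I ⟶ X ×_Y Y^I` is a hypercover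
  (`hyper_path_end_gap`), and that from `X^I` to the paths in `Y` with lifts of both ends is a Kan
  fibration (`kan_path_gap`). In particular `X^I ⟶ X × X` is a Kan fibration, and both evaluations
  `X^I ⟶ X` are hypercovers if `X` is an `∞`-groupoid.
* Weak equivalences: hypercovers have right cancellation (`hyper.cancel`), since covers do.
  Comparing `X^I` with `X ×_Y Y^I` shows that the acyclic fibrations are the hypercovers
  (`kan.weak_iff`). Homotopic morphisms have mapping path spaces that are related by a span of
  hypercovers (`exists_span_of_homotopy`), which implies the two-out-of-three property
  (`weak.comp_iff`, `weak.of_comp`).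
* Representability: a Kan complex of presheaves is levelwise representable as soon as its
  `0`-simplices are (`isKanRep_of_kan`), because a simplex is obtained from a vertex by filling
  horns. So products of `∞`-groupoids exist, and a pullback of a Kan fibration that happens to exist
  is computed on functors of points (`isPullback_map_gpdPoints`). Path spaces and base changes of
  hypercovers exist because hypercovers are relative covers in each dimension (`hyper.levelRep`).
* The functor `F`: its collage is the category with objects those of `C` and of `D`, in which the
  morphisms from `Y` in `D` to `X` in `C` are the morphisms `Y ⟶ F X`. As `F` is geometric, the
  covers of `C` and of `D` together form a class of covers of the collage
  (`Collage.isCoverClass`). The functor of points of a simplicial object `X` of `C` extends to the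
  collage, and restricts to the functor of points of `F X` on `D`. Matching objects over the
  collage belong to `C`; as `F` preserves and reflects covers, each condition over the collage can
  be tested on `C` or on `D` (`hyper_left_iff`, `hyper_right_iff`). Thus `F` preserves
  `∞`-groupoids, and the weak equivalences pulled back from `D` are those of the same definition
  over `C` (`weak_map_iff`), although path spaces are limits that `F` need not be assumed to
  preserve.
-/

universe w w'

namespace HigherGpd

/-! ### Relatively representable covers of presheaves -/

section RelCover

variable {E : Type u} [Category.{v} E]

/-- The formal properties of a class of covers on which the homotopy theory of `∞`-groupoids
depends. Both categories with covers and descent categories satisfy them. -/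
structure IsCoverClass (S : MorphismProperty E) : Prop where
  iso_mem {X Y : E} (f : X ⟶ Y) : IsIso f → S f
  comp_mem {X Y Z : E} (f : X ⟶ Y) (g : Y ⟶ Z) : S f → S g → S (f ≫ g)
  cancel {X Y Z : E} (f : X ⟶ Y) (g : Y ⟶ Z) : S f → S (f ≫ g) → S g
  exists_isPullback {X Y Z : E} (f : X ⟶ Z) (g : Y ⟶ Z) :
    S f → ∃ (P : E) (a : P ⟶ X) (b : P ⟶ Y), IsPullback a b f g ∧ S b

/-- The element `p` over `V` is the universal lift of the element `q` over `U` along `φ`: the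
morphism `g : V ⟶ U` represents the fibre product of `U` and `P` over `Q`. -/
structure IsUniversalLift {P Q : Eᵒᵖ ⥤ Type w} (φ : P ⟶ Q) {U V : E} (q : Q.obj (op U))
    (g : V ⟶ U) (p : P.obj (op V)) : Prop where
  app_eq : φ.app _ p = Q.map g.op q
  existsUnique {T : E} (h : T ⟶ U) (p' : P.obj (op T)) :
    φ.app _ p' = Q.map h.op q → ∃! k : T ⟶ V, k ≫ g = h ∧ P.map k.op p = p'

/-- A morphism of presheaves is a relative cover if all its base changes to representable
presheaves are representable by a morphism in `S`. -/
def RelCover (S : MorphismProperty E) {P Q : Eᵒᵖ ⥤ Type w} (φ : P ⟶ Q) : Prop :=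
  ∀ ⦃U : E⦄ (q : Q.obj (op U)), ∃ (V : E) (g : V ⟶ U) (p : P.obj (op V)),
    S g ∧ IsUniversalLift φ q g p

/-- The element `p` of a presheaf is universal: it exhibits the presheaf as representable. -/
def IsUniversal {P : Eᵒᵖ ⥤ Type w} {M : E} (p : P.obj (op M)) : Prop :=
  ∀ ⦃T : E⦄ (p' : P.obj (op T)), ∃! k : T ⟶ M, P.map k.op p = p'

/-- A presheaf is representable if it has a universal element. The presheaf may take values in
another universe than the sets of morphisms. -/
def IsRep (P : Eᵒᵖ ⥤ Type w) : Prop := ∃ (M : E) (p : P.obj (op M)), IsUniversal p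

variable {S : MorphismProperty E} {P Q R P' Q' : Eᵒᵖ ⥤ Type w}

theorem RelCover.comp (hS : IsCoverClass S) {φ : P ⟶ Q} {ψ : Q ⟶ R} (hφ : RelCover S φ)
    (hψ : RelCover S ψ) : RelCover S (φ ≫ ψ) := by
  intro U r
  obtain ⟨V, g, q, hg, hq⟩ := hψ r
  obtain ⟨W, h, p, hh, hp⟩ := hφ q
  refine ⟨W, h ≫ g, p, hS.comp_mem _ _ hh hg, ?_, ?_⟩
  · simp [hp.app_eq, NatTrans.naturality_apply, hq.app_eq]
  · intro T k p' hp'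
    obtain ⟨l, ⟨hl, hl'⟩, hlu⟩ := hq.existsUnique k (φ.app _ p') (by simpa using hp')
    obtain ⟨m, ⟨hm, hm'⟩, hmu⟩ := hp.existsUnique l p' hl'.symm
    refine ⟨m, ⟨by rw [reassoc_of% hm, hl], hm'⟩,
      fun n ⟨hn, hn'⟩ => hmu n ⟨hlu _ ⟨by simpa, ?_⟩, hn'⟩⟩
    rw [← hn', NatTrans.naturality_apply, hp.app_eq]
    simp

/-- Relative covers are stable under base change. -/
theorem RelCover.of_cartesian {φ : P ⟶ Q} (hφ : RelCover S φ) {φ' : P' ⟶ Q'} (α : P' ⟶ P)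
    (β : Q' ⟶ Q) (comm : α ≫ φ = φ' ≫ β)
    (h : ∀ (U : Eᵒᵖ) (q : Q'.obj U) (p : P.obj U), φ.app U p = β.app U q →
      ∃! p' : P'.obj U, φ'.app U p' = q ∧ α.app U p' = p) : RelCover S φ' := by
  intro U q
  obtain ⟨V, g, p, hg, hp⟩ := hφ (β.app _ q)
  obtain ⟨p', ⟨h1, h2⟩, -⟩ := h _ (Q'.map g.op q) p (by
    rw [hp.app_eq, NatTrans.naturality_apply])
  refine ⟨V, g, p', hg, h1, fun {T} k p'' hp'' => ?_⟩
  have comm' (U) (x : P'.obj U) : φ.app U (α.app U x) = β.app U (φ'.app U x) :=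
    congr($(comm).app U x)
  obtain ⟨l, ⟨hl, hl'⟩, hlu⟩ := hp.existsUnique k (α.app _ p'') (by
    rw [comm', hp'', NatTrans.naturality_apply])
  refine ⟨l, ⟨hl, ?_⟩, fun m ⟨hm, hm'⟩ => hlu m ⟨hm, by rw [← hm', NatTrans.naturality_apply, h2]⟩⟩
  refine (h _ (Q'.map k.op q) (α.app _ p'') (by rw [comm', hp''])).unique ⟨?_, ?_⟩ ⟨hp'', rfl⟩
  · rw [NatTrans.naturality_apply, h1, ← hl]
    simp
  · rw [NatTrans.naturality_apply, h2, hl']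

/-- Isomorphisms of presheaves are relative covers. -/
theorem RelCover.of_bijective (hS : IsCoverClass S) {φ : P ⟶ Q}
    (h : ∀ U, Function.Bijective (φ.app U)) : RelCover S φ := by
  intro U q
  obtain ⟨p, hp⟩ := (h _).2 q
  refine ⟨U, 𝟙 U, p, hS.iso_mem _ inferInstance, by simpa using hp, fun k p' hp' => ?_⟩
  refine ⟨k, ⟨by simp, (h _).1 ?_⟩, fun m ⟨hm, _⟩ => by simpa using hm⟩
  rw [hp', ← hp, NatTrans.naturality_apply]

theorem IsUniversal.isIso {M N : E} {p : P.obj (op M)} {p' : P.obj (op N)} (h : IsUniversal p)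
    (h' : IsUniversal p') (k : N ⟶ M) (hk : P.map k.op p = p') : IsIso k := by
  obtain ⟨l, hl, -⟩ := h' p
  refine ⟨l, (h' p').unique ?_ ?_, (h p).unique ?_ ?_⟩ <;> simp [hk, hl]

theorem IsUniversalLift.isUniversal {φ : P ⟶ Q} {U V : E} {q : Q.obj (op U)} {g : V ⟶ U}
    {p : P.obj (op V)} (h : IsUniversalLift φ q g p) (hq : IsUniversal q) : IsUniversal p := by
  intro T p'
  obtain ⟨k, hk, hku⟩ := hq (φ.app _ p')
  obtain ⟨l, ⟨hl, hl'⟩, hlu⟩ := h.existsUnique k p' hk.symm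
  refine ⟨l, hl', fun m hm => hlu m ⟨hku _ ?_, hm⟩⟩
  dsimp only
  rw [← hm, NatTrans.naturality_apply, h.app_eq]
  simp

theorem RelCover.isRep {φ : P ⟶ Q} (h : RelCover S φ) (hQ : IsRep Q) : IsRep P := by
  obtain ⟨U, q, hq⟩ := hQ
  obtain ⟨V, g, p, -, hp⟩ := h q
  exact ⟨V, p, hp.isUniversal hq⟩

/-- A relative cover between representable presheaves is induced by a morphism in `S`. -/
theorem RelCover.mem (hS : IsCoverClass S) {φ : P ⟶ Q} (h : RelCover S φ) {M N : E}
    {p : P.obj (op M)} {q : Q.obj (op N)} (hp : IsUniversal p) (hq : IsUniversal q) (g : M ⟶ N)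
    (hg : φ.app _ p = Q.map g.op q) : S g := by
  obtain ⟨V, k, p', hk, hp'⟩ := h q
  obtain ⟨l, ⟨hl, hl'⟩, -⟩ := hp'.existsUnique g p hg
  have := (hp'.isUniversal hq).isIso hp l hl'
  rw [← hl]
  exact hS.comp_mem _ _ (hS.iso_mem _ this) hk

theorem RelCover.of_mem (hS : IsCoverClass S) {φ : P ⟶ Q} {M N : E}
    {p : P.obj (op M)} {q : Q.obj (op N)} (hp : IsUniversal p) (hq : IsUniversal q) (g : M ⟶ N)
    (hg : φ.app _ p = Q.map g.op q) (h : S g) : RelCover S φ := by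
  intro U q'
  obtain ⟨k, rfl, hku⟩ := hq q'
  obtain ⟨V, a, b, hab, hb⟩ := hS.exists_isPullback g k h
  refine ⟨V, b, P.map a.op p, hb, ?_, fun {T} m p' hp' => ?_⟩
  · rw [NatTrans.naturality_apply, hg, ← Functor.map_comp_apply, ← Functor.map_comp_apply,
      ← op_comp, ← op_comp, hab.w]
  · obtain ⟨l, rfl, hlu⟩ := hp p'
    have hl : l ≫ g = m ≫ k := (hq (Q.map (m ≫ k).op q)).unique (by
      rw [NatTrans.naturality_apply, hg] at hp'
      simpa using hp') rfl
    refine ⟨hab.lift l m hl, ⟨by simp, by simp [← Functor.map_comp_apply, ← op_comp]⟩, ?_⟩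
    rintro n ⟨hn, hn'⟩
    apply hab.hom_ext
    · rw [hab.lift_fst]
      exact hlu _ (by simpa using hn')
    · rw [hab.lift_snd, hn]

/-- Relative covers between representable presheaves inherit the right cancellation property of
covers. -/
theorem RelCover.cancel (hS : IsCoverClass S) {φ : P ⟶ Q} {ψ : Q ⟶ R} (hφ : RelCover S φ)
    (h : RelCover S (φ ≫ ψ)) (hQ : IsRep Q) (hR : IsRep R) : RelCover S ψ := by
  obtain ⟨M, p, hp⟩ := hφ.isRep hQ
  obtain ⟨N, q, hq⟩ := hQ
  obtain ⟨O, r, hr⟩ := hR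
  obtain ⟨k, hk, -⟩ := hq (φ.app _ p)
  obtain ⟨l, hl, -⟩ := hr (ψ.app _ q)
  refine RelCover.of_mem hS hq hr l hl.symm (hS.cancel k l (hφ.mem hS hp hq k hk.symm) ?_)
  refine h.mem hS hp hr _ ?_
  rw [NatTrans.comp_app, types_comp_apply, ← hk, NatTrans.naturality_apply, ← hl]
  simp

end RelCover

/-! ### Lifting conditions for morphisms of simplicial presheaves -/

section Lifting

variable {E : Type u} [Category.{v} E]

/-- The presheaf `U ↦ Hom(A, X(U))`. -/
abbrev homPresheaf (A : SSet.{w}) (X : Eᵒᵖ ⥤ SSet.{w}) : Eᵒᵖ ⥤ Type w :=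
  X ⋙ coyoneda.obj (op A)

/-- The presheaf of commutative squares from `i` to `f(U)`. -/
def squares {A B : SSet.{w}} (i : A ⟶ B) {X Y : Eᵒᵖ ⥤ SSet.{w}} (f : X ⟶ Y) :
    Eᵒᵖ ⥤ Type w where
  obj U := { p : (A ⟶ X.obj U) × (B ⟶ Y.obj U) // p.1 ≫ f.app U = i ≫ p.2 }
  map {U V} g := ↾fun p => ⟨(p.1.1 ≫ X.map g, p.1.2 ≫ Y.map g), by
    have h := p.2
    simp only [Category.assoc, NatTrans.naturality]
    rw [reassoc_of% h]⟩

/-- The canonical morphism from `Hom(B, X)` to the presheaf of squares from `i` to `f`, whose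
fibres are the sets of lifts. -/
def toSquares {A B : SSet.{w}} (i : A ⟶ B) {X Y : Eᵒᵖ ⥤ SSet.{w}} (f : X ⟶ Y) :
    homPresheaf B X ⟶ squares i f where
  app U := ↾fun l => ⟨(i ≫ l, l ≫ f.app U), Category.assoc _ _ _⟩
  naturality U V g := by
    ext l
    refine Subtype.ext (Prod.ext ?_ ?_)
    · exact (Category.assoc _ _ _).symm
    · change (l ≫ X.map g) ≫ f.app V = (l ≫ f.app U) ≫ Y.map g
      simp

/-- Lifts of `i` against `f` are representable by covers. -/
def LiftCover (S : MorphismProperty E) {A B : SSet.{w}} (i : A ⟶ B) {X Y : Eᵒᵖ ⥤ SSet.{w}}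
    (f : X ⟶ Y) : Prop :=
  RelCover S (toSquares i f)

variable {S : MorphismProperty E} {X Y Z X' Y' : Eᵒᵖ ⥤ SSet.{w}} {A B A' B' : SSet.{w}}

theorem squares_ext {i : A ⟶ B} {f : X ⟶ Y} {U : Eᵒᵖ} {p q : (squares i f).obj U}
    (h₁ : p.1.1 = q.1.1) (h₂ : p.1.2 = q.1.2) : p = q :=
  Subtype.ext (Prod.ext h₁ h₂)

theorem toSquares_app_eq_iff {i : A ⟶ B} {f : X ⟶ Y} {U : Eᵒᵖ} (l : B ⟶ X.obj U)
    (q : (squares i f).obj U) :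
    (toSquares i f).app U l = q ↔ i ≫ l = q.1.1 ∧ l ≫ f.app U = q.1.2 :=
  ⟨by rintro rfl; exact ⟨rfl, rfl⟩, fun h => squares_ext h.1 h.2⟩

/-- Precomposition with a morphism of simplicial sets. -/
def homPresheafMap (i : A ⟶ B) (X : Eᵒᵖ ⥤ SSet.{w}) : homPresheaf B X ⟶ homPresheaf A X :=
  Functor.whiskerLeft X (coyoneda.map i.op)

/-- Lifts against a composite `A ⟶ B ⟶ C`. -/
theorem LiftCover.comp_left (hS : IsCoverClass S) {C : SSet.{w}} {i : A ⟶ B} {j : B ⟶ C}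
    {f : X ⟶ Y} (hi : LiftCover S i f) (hj : LiftCover S j f) : LiftCover S (i ≫ j) f := by
  let ρ : squares j f ⟶ squares (i ≫ j) f :=
    { app := fun U => ↾fun p => ⟨(i ≫ p.1.1, p.1.2), by simp [p.2]⟩
      naturality := fun U V g => by
        ext p
        exact squares_ext (Category.assoc _ _ _).symm rfl }
  have hρ : RelCover S ρ := by
    refine RelCover.of_cartesian hi
      { app := fun U => ↾fun p => p.1.1
        naturality := fun U V g => rfl }
      { app := fun U => ↾fun p => ⟨(p.1.1, j ≫ p.1.2), by rw [p.2, Category.assoc]⟩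
        naturality := fun U V g => by
          ext p
          exact squares_ext rfl (Category.assoc _ _ _).symm } ?_ ?_
    · ext U p
      exact squares_ext rfl p.2
    · intro U q p hp
      obtain ⟨h1, h2⟩ := (toSquares_app_eq_iff p _).1 hp
      refine ⟨⟨(p, q.1.2), h2⟩, ⟨squares_ext h1 rfl, rfl⟩, ?_⟩
      rintro p' ⟨rfl, rfl⟩
      rfl
  have : toSquares (i ≫ j) f = toSquares j f ≫ ρ := by
    ext U l
    exact squares_ext (Category.assoc _ _ _) rfl
  rw [LiftCover, this]
  exact RelCover.comp hS hj hρ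

theorem LiftCover.of_isPushout {i : A ⟶ B} {i' : A' ⟶ B'} {a : A ⟶ A'} {b : B ⟶ B'}
    {f : X ⟶ Y} (hi : LiftCover S i f) (sq : IsPushout a i i' b) : LiftCover S i' f := by
  refine RelCover.of_cartesian hi (homPresheafMap b X)
    { app := fun U => ↾fun p => ⟨(a ≫ p.1.1, b ≫ p.1.2), by
        rw [Category.assoc, p.2, sq.w_assoc]⟩
      naturality := fun U V g => by
        ext p
        exact squares_ext (Category.assoc _ _ _).symm (Category.assoc _ _ _).symm } ?_ ?_
  · ext U l
    exact squares_ext (sq.w_assoc l).symm (Category.assoc _ _ _)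
  · intro U q p hp
    obtain ⟨h1, h2⟩ := (toSquares_app_eq_iff p _).1 hp
    refine ⟨sq.desc q.1.1 p h1.symm, ⟨squares_ext (sq.inl_desc _ _ _) ?_, sq.inr_desc _ _ _⟩, ?_⟩
    · apply sq.hom_ext
      · change i' ≫ sq.desc q.1.1 p h1.symm ≫ f.app U = i' ≫ q.1.2
        rw [sq.inl_desc_assoc, q.2]
      · change b ≫ sq.desc q.1.1 p h1.symm ≫ f.app U = b ≫ q.1.2
        rw [sq.inr_desc_assoc, h2]
        rfl
    · rintro l ⟨h3, h4⟩
      apply sq.hom_ext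
      · rw [sq.inl_desc]
        exact ((toSquares_app_eq_iff l _).1 h3).1
      · rw [sq.inr_desc]
        exact h4

theorem LiftCover.of_isIso_left (hS : IsCoverClass S) (i : A ⟶ B) [IsIso i] (f : X ⟶ Y) :
    LiftCover S i f := by
  refine RelCover.of_bijective hS fun U => ⟨fun l l' h => ?_, fun q => ⟨inv i ≫ q.1.1, ?_⟩⟩
  · exact (cancel_epi i).1 congr(($h).1.1)
  · refine (toSquares_app_eq_iff _ _).2 ⟨by simp, ?_⟩
    rw [Category.assoc, q.2, IsIso.inv_hom_id_assoc]

theorem LiftCover.of_isIso_right (hS : IsCoverClass S) (i : A ⟶ B) (f : X ⟶ Y) [IsIso f] :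
    LiftCover S i f := by
  refine RelCover.of_bijective hS fun U => ⟨fun l l' h => ?_, fun q => ⟨q.1.2 ≫ inv (f.app U), ?_⟩⟩
  · exact (cancel_mono (f.app U)).1 congr(($h).1.2)
  · refine (toSquares_app_eq_iff _ _).2 ⟨?_, by simp⟩
    rw [← Category.assoc, ← q.2]
    simp

theorem LiftCover.comp_right (hS : IsCoverClass S) {i : A ⟶ B} {f : X ⟶ Y} {g : Y ⟶ Z}
    (hf : LiftCover S i f) (hg : LiftCover S i g) : LiftCover S i (f ≫ g) := by
  let ρ : squares i f ⟶ squares i (f ≫ g) :=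
    { app := fun U => ↾fun p => ⟨(p.1.1, p.1.2 ≫ g.app U), by
        rw [NatTrans.comp_app, ← Category.assoc, p.2, Category.assoc]⟩
      naturality := fun U V k => by
        ext p
        refine squares_ext rfl ?_
        change (p.1.2 ≫ Y.map k) ≫ g.app V = (p.1.2 ≫ g.app U) ≫ Z.map k
        simp }
  have hρ : RelCover S ρ := by
    refine RelCover.of_cartesian hg
      { app := fun U => ↾fun p => p.1.2
        naturality := fun U V g => rfl }
      { app := fun U => ↾fun p => ⟨(p.1.1 ≫ f.app U, p.1.2), by
          exact (Category.assoc _ _ _).trans p.2⟩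
        naturality := fun U V k => by
          ext p
          refine squares_ext ?_ rfl
          change (p.1.1 ≫ X.map k) ≫ f.app V = (p.1.1 ≫ f.app U) ≫ Y.map k
          simp } ?_ ?_
    · ext U p
      exact squares_ext p.2.symm rfl
    · intro U q p hp
      obtain ⟨h1, h2⟩ := (toSquares_app_eq_iff p _).1 hp
      refine ⟨⟨(q.1.1, p), h1.symm⟩, ⟨squares_ext rfl h2, rfl⟩, ?_⟩
      rintro p' ⟨rfl, rfl⟩
      rfl
  have : toSquares i (f ≫ g) = toSquares i f ≫ ρ := by
    ext U l
    exact squares_ext rfl (Category.assoc _ _ _).symm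
  rw [LiftCover, this]
  exact RelCover.comp hS hf hρ

theorem LiftCover.of_isPullback {i : A ⟶ B} {f : X ⟶ Y} {f' : X' ⟶ Y'} {a : X' ⟶ X}
    {b : Y' ⟶ Y} (hf : LiftCover S i f) (sq : IsPullback a f' f b) : LiftCover S i f' := by
  have sq' (U) : IsPullback (a.app U) (f'.app U) (f.app U) (b.app U) :=
    sq.map ((evaluation _ _).obj U)
  refine RelCover.of_cartesian hf (Functor.whiskerRight a _)
    { app := fun U => ↾fun p => ⟨(p.1.1 ≫ a.app U, p.1.2 ≫ b.app U), by
        rw [Category.assoc, (sq' U).w, ← Category.assoc, p.2, Category.assoc]⟩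
      naturality := fun U V k => by
        ext p
        refine squares_ext ?_ ?_
        · change (p.1.1 ≫ X'.map k) ≫ a.app V = (p.1.1 ≫ a.app U) ≫ X.map k
          simp
        · change (p.1.2 ≫ Y'.map k) ≫ b.app V = (p.1.2 ≫ b.app U) ≫ Y.map k
          simp } ?_ ?_
  · ext U l
    refine squares_ext (Category.assoc _ _ _).symm ?_
    change (l ≫ a.app U) ≫ f.app U = (l ≫ f'.app U) ≫ b.app U
    rw [Category.assoc, (sq' U).w, Category.assoc]
  · intro U q p hp
    obtain ⟨h1, h2⟩ := (toSquares_app_eq_iff p _).1 hp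
    refine ⟨(sq' U).lift p q.1.2 h2, ⟨squares_ext ?_ ((sq' U).lift_snd _ _ _),
      (sq' U).lift_fst _ _ _⟩, ?_⟩
    · apply (sq' U).hom_ext
      · change (i ≫ (sq' U).lift p q.1.2 h2) ≫ a.app U = _
        rw [Category.assoc, (sq' U).lift_fst, h1]
        rfl
      · change (i ≫ (sq' U).lift p q.1.2 h2) ≫ f'.app U = _
        rw [Category.assoc, (sq' U).lift_snd, q.2]
    · rintro l ⟨h3, h4⟩
      apply (sq' U).hom_ext
      · rw [(sq' U).lift_fst]
        exact h4
      · rw [(sq' U).lift_snd]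
        exact ((toSquares_app_eq_iff l _).1 h3).2

end Lifting

end HigherGpd

namespace HigherGpd

/-! ### Attaching cells to subcomplexes of nerves of partially ordered sets -/

section Cells

variable {E : Type u} [Category.{v} E] {S : MorphismProperty E} {Y Z : Eᵒᵖ ⥤ SSet.{w}}
  {f : Y ⟶ Z}

/-- Attaching the simplex `x` to the subcomplex `A` is a pushout of the inclusion of the part of
the boundary of `x` that already lies in `A`. -/
theorem LiftCover.of_attach {X B : SSet.{w}} (A : X.Subcomplex) (x : B ⟶ X) [Mono x]
    (h : LiftCover S (A.preimage x).ι f) {A' : X.Subcomplex}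
    (hA : A ⊔ SSet.Subcomplex.range x = A') :
    LiftCover S (SSet.Subcomplex.homOfLE (le_sup_left.trans hA.le : A ≤ A')) f := by
  have sq : SSet.Subcomplex.BicartSq (A ⊓ SSet.Subcomplex.range x) A (SSet.Subcomplex.range x) A' :=
    ⟨hA, rfl⟩
  let t : ((A.preimage x : B.Subcomplex) : SSet) ⟶
      ((A ⊓ SSet.Subcomplex.range x : X.Subcomplex) : SSet) :=
    SSet.Subcomplex.lift ((A.preimage x).ι ≫ x) (by
      rintro n - ⟨b, rfl⟩
      exact ⟨b.2, ⟨b.1, rfl⟩⟩)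
  have hx (n) : Function.Injective (x.app n) := by
    rw [← mono_iff_injective]
    infer_instance
  have : IsIso t := by
    refine (NatTrans.isIso_iff_isIso_app _).2 fun n => (isIso_iff_bijective _).2 ⟨?_, ?_⟩
    · intro a b hab
      exact Subtype.ext (hx n congr(($hab).1))
    · rintro ⟨-, hy, b, rfl⟩
      exact ⟨⟨b, hy⟩, rfl⟩
  have sq' : IsPushout t (A.preimage x).ι (SSet.Subcomplex.homOfLE inf_le_right)
      (SSet.Subcomplex.toRange x) := IsPushout.of_horiz_isIso ⟨rfl⟩
  exact (h.of_isPushout sq').of_isPushout sq.isPushout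

variable {Q : Type*} [PartialOrder Q]

/-- An identification of the simplicial set `X` with the nerve of `Q`. -/
structure NerveIso (X : SSet.{w}) (Q : Type*) [PartialOrder Q] where
  /-- The simplices are the monotone maps. -/
  equiv (n : SimplexCategoryᵒᵖ) : X.obj n ≃ (Fin (n.unop.len + 1) →o Q)
  map_equiv {n m : SimplexCategoryᵒᵖ} (g : n ⟶ m) (x : X.obj n) :
    equiv m (X.map g x) = (equiv n x).comp g.unop.toOrderHom

variable {X : SSet.{w}} (e : NerveIso X Q)

namespace NerveIso

/-- The simplex spanned by a finite chain. -/
noncomputable def simplex {m : ℕ} (σ : Fin (m + 1) ↪o Q) : (Δ[m] : SSet.{w}) ⟶ X :=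
  SSet.yonedaEquiv.symm ((e.equiv (op ⦋m⦌)).symm σ.toOrderHom)

theorem equiv_simplex_app {m : ℕ} (σ : Fin (m + 1) ↪o Q) {n : SimplexCategoryᵒᵖ}
    (c : (Δ[m] : SSet.{w}).obj n) :
    e.equiv n ((e.simplex σ).app n c) =
      σ.toOrderHom.comp (SSet.stdSimplex.objEquiv c).toOrderHom := by
  change e.equiv n (X.map _ _) = _
  rw [e.map_equiv, Equiv.apply_symm_apply]
  rfl

instance mono_simplex {m : ℕ} (σ : Fin (m + 1) ↪o Q) : Mono (e.simplex σ) := by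
  have (n : SimplexCategoryᵒᵖ) : Mono ((e.simplex σ).app n) := by
    rw [mono_iff_injective]
    intro c d h
    have h' := congr(e.equiv n $h)
    rw [equiv_simplex_app, equiv_simplex_app] at h'
    apply SSet.stdSimplex.objEquiv.injective
    ext i : 3
    exact σ.injective congr($h' i)
  exact NatTrans.mono_of_mono_app _

variable [DecidableEq Q]

/-- The set of vertices of a simplex. -/
def vertices {n : SimplexCategoryᵒᵖ} (x : X.obj n) : Finset Q := Finset.univ.image (e.equiv n x)

/-- The subcomplex of the simplices whose set of vertices belongs to a given family. -/
def ofFamily (𝓕 : LowerSet (Finset Q)) : X.Subcomplex where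
  obj n := {x | e.vertices x ∈ 𝓕}
  map {n m} g x hx := 𝓕.lower (by
    simp only [vertices, map_equiv]
    intro q
    simp only [Finset.mem_image]
    rintro ⟨i, -, rfl⟩
    exact ⟨_, Finset.mem_univ _, rfl⟩) hx

theorem mem_ofFamily {𝓕 : LowerSet (Finset Q)} {n : SimplexCategoryᵒᵖ} (x : X.obj n) :
    x ∈ (e.ofFamily 𝓕).obj n ↔ e.vertices x ∈ 𝓕 := Iff.rfl

theorem ofFamily_mono {𝓕 𝓖 : LowerSet (Finset Q)} (h : 𝓕 ≤ 𝓖) :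
    e.ofFamily 𝓕 ≤ e.ofFamily 𝓖 := fun _ _ hx => h hx

theorem ofFamily_sup (𝓕 𝓖 : LowerSet (Finset Q)) :
    e.ofFamily (𝓕 ⊔ 𝓖) = e.ofFamily 𝓕 ⊔ e.ofFamily 𝓖 := rfl

theorem isChain_vertices {n : SimplexCategoryᵒᵖ} (x : X.obj n) :
    IsChain (· ≤ ·) (e.vertices x : Set Q) := by
  simp only [vertices, Finset.coe_image, Finset.coe_univ, Set.image_univ]
  exact (e.equiv n x).monotone.isChain_range

theorem vertices_nonempty {n : SimplexCategoryᵒᵖ} (x : X.obj n) : (e.vertices x).Nonempty :=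
  Finset.univ_nonempty.image _

theorem vertices_simplex_app {m : ℕ} (σ : Fin (m + 1) ↪o Q) {n : SimplexCategoryᵒᵖ}
    (c : (Δ[m] : SSet.{w}).obj n) : e.vertices ((e.simplex σ).app n c) =
      (Finset.univ.image (SSet.stdSimplex.objEquiv c).toOrderHom).image σ := by
  rw [vertices, equiv_simplex_app, Finset.image_image]
  rfl

theorem range_simplex {m : ℕ} (σ : Fin (m + 1) ↪o Q) :
    SSet.Subcomplex.range (e.simplex σ) = e.ofFamily (LowerSet.Iic (Finset.univ.image σ)) := by
  ext n x
  rw [mem_ofFamily, LowerSet.mem_Iic_iff]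
  constructor
  · rintro ⟨c, rfl⟩
    rw [vertices_simplex_app]
    exact Finset.image_subset_image (Finset.subset_univ _)
  · intro h
    have h' (i) : ∃ j, σ j = e.equiv n x i := by
      simpa using h (Finset.mem_image_of_mem _ (Finset.mem_univ i))
    choose c hc using h'
    refine ⟨SSet.stdSimplex.objEquiv.symm (SimplexCategory.Hom.mk ⟨c, fun i j hij => ?_⟩), ?_⟩
    · rw [← σ.le_iff_le, hc, hc]
      exact (e.equiv n x).monotone hij
    · apply (e.equiv n).injective
      rw [equiv_simplex_app]
      ext i
      exact hc i

/-- A nonempty finite chain is the set of vertices of a nondegenerate simplex. -/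
theorem exists_orderEmbedding {s : Finset Q} (hs : IsChain (· ≤ ·) (s : Set Q)) {m : ℕ}
    (hm : s.card = m + 1) : ∃ σ : Fin (m + 1) ↪o Q, Finset.univ.image σ = s := by
  classical
  let : LinearOrder s :=
    { (inferInstance : PartialOrder s) with
      le_total := fun a b => hs.total a.2 b.2
      toDecidableLE := Classical.decRel _ }
  let σ := Fintype.orderIsoFinOfCardEq s (by simpa using hm)
  refine ⟨σ.toOrderEmbedding.trans (OrderEmbedding.subtype _), ?_⟩
  ext q
  simp only [Finset.mem_image, Finset.mem_univ, true_and]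
  constructor
  · rintro ⟨i, rfl⟩
    exact (σ i).2
  · intro hq
    exact ⟨σ.symm ⟨q, hq⟩, by simp⟩

/-- The part of a simplex that lies in `𝓕` is the horn at its vertex `k`, if the faces that do not
lie in `𝓕` are the simplex itself and its face opposite to `k`. -/
theorem preimage_ofFamily_eq_horn (𝓕 : LowerSet (Finset Q)) {m : ℕ} (σ : Fin (m + 1) ↪o Q)
    (k : Fin (m + 1))
    (h : ∀ t ⊆ Finset.univ.image σ, t ∈ 𝓕 ↔ insert (σ k) t ≠ Finset.univ.image σ) :
    (e.ofFamily 𝓕).preimage (e.simplex σ) = Λ[m, k] := by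
  ext n c
  change (e.simplex σ).app n c ∈ (e.ofFamily 𝓕).obj n ↔ _
  rw [mem_ofFamily, vertices_simplex_app, h _ (Finset.image_subset_image (Finset.subset_univ _)),
    ← Finset.image_insert, SSet.mem_horn_iff, not_iff_not, ← Finset.coe_inj]
  simp only [Finset.coe_image, Finset.coe_insert, Finset.coe_univ, Set.image_univ]
  rw [← Set.image_univ (f := σ), σ.injective.image_injective.eq_iff, Set.union_comm,
    ← Set.insert_eq]
  rfl

theorem preimage_ofFamily_eq_boundary (𝓕 : LowerSet (Finset Q)) {m : ℕ} (σ : Fin (m + 1) ↪o Q)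
    (h : ∀ t ⊆ Finset.univ.image σ, t ∈ 𝓕 ↔ t ≠ Finset.univ.image σ) :
    (e.ofFamily 𝓕).preimage (e.simplex σ) = ∂Δ[m] := by
  ext n c
  change (e.simplex σ).app n c ∈ (e.ofFamily 𝓕).obj n ↔
    ¬ Function.Surjective (SSet.stdSimplex.asOrderHom c)
  rw [mem_ofFamily, vertices_simplex_app, h _ (Finset.image_subset_image (Finset.subset_univ _)),
    not_iff_not, ← Finset.coe_inj, ← Set.range_eq_univ]
  simp only [Finset.coe_image, Finset.coe_univ, Set.image_univ]
  rw [← Set.image_univ (f := σ), σ.injective.image_injective.eq_iff]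
  rfl

end NerveIso

theorem LiftCover.homOfLE_refl (hS : IsCoverClass S) {A A' : X.Subcomplex} (h : A ≤ A')
    (h' : A' ≤ A) : LiftCover S (SSet.Subcomplex.homOfLE h) f := by
  obtain rfl := le_antisymm h h'
  exact LiftCover.of_isIso_left hS (𝟙 _) _

open NerveIso

variable [DecidableEq Q]

/-- A matching of the sets in `𝓖` which are not in `𝓕` by adding and removing a vertex `q`
exhibits the inclusion as a sequence of horn fillings: the pairs are attached in order of
increasing size. -/
theorem LiftCover.of_toggle [Finite Q] (hS : IsCoverClass S) (q : Q) (N : ℕ)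
    (hf : ∀ (m : ℕ) (k : Fin (m + 2)), m + 1 ≤ N → LiftCover S (Λ[m + 1, k].ι) f)
    {𝓕 𝓖 : LowerSet (Finset Q)} (hle : 𝓕 ≤ 𝓖) (h𝓕 : ∅ ∈ 𝓕)
    (hchain : ∀ s ∈ 𝓖, s ∉ 𝓕 → IsChain (· ≤ ·) (s : Set Q))
    (hcard : ∀ s ∈ 𝓖, s ∉ 𝓕 → s.card ≤ N + 1)
    (hinsert : ∀ s ∈ 𝓖, s ∉ 𝓕 → insert q s ∈ 𝓖)
    (herase : ∀ s ∈ 𝓖, s ∉ 𝓕 → s.erase q ∉ 𝓕) :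
    LiftCover S (SSet.Subcomplex.homOfLE (e.ofFamily_mono hle)) f := by
  induction hd : ((𝓖 : Set (Finset Q)) \ 𝓕).ncard using Nat.strong_induction_on
    generalizing 𝓕 with
  | _ d ih =>
  by_cases hne : ∃ s, s ∈ 𝓖 ∧ s ∉ 𝓕
  swap
  · push Not at hne
    exact LiftCover.homOfLE_refl hS _ (e.ofFamily_mono hne)
  obtain ⟨t, ⟨ht, ht'⟩, hmin⟩ :=
    Set.exists_min_image ((𝓖 : Set (Finset Q)) \ 𝓕) Finset.card (Set.toFinite _) hne
  -- `t` is minimal, so it does not contain `q`: otherwise `t.erase q` would be smaller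
  have hqt : q ∉ t := fun hq => by
    have := hmin (t.erase q) ⟨𝓖.lower (Finset.erase_subset _ _) ht, herase t ht ht'⟩
    have := Finset.card_erase_lt_of_mem hq
    omega
  -- among the faces of `insert q t` only that simplex and its face `t` do not lie in `𝓕`
  have hproper (r) (hr : r ⊆ insert q t) (hr' : r ∉ 𝓕) : insert q r = insert q t := by
    have hr'' : r ∈ 𝓖 := 𝓖.lower hr (hinsert t ht ht')
    have h1 : r.erase q ⊆ t := by
      rw [Finset.subset_insert_iff] at hr
      exact hr
    have h2 := Finset.eq_of_subset_of_card_le h1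
      (hmin _ ⟨𝓖.lower (Finset.erase_subset _ _) hr'', herase r hr'' hr'⟩)
    rw [← h2]
    ext; simp; tauto
  have hs : insert q t ∉ 𝓕 := fun h => ht' (𝓕.lower (Finset.subset_insert _ _) h)
  have hcard' : (insert q t).card = t.card + 1 := Finset.card_insert_of_notMem hqt
  -- `t` is not empty, so that the horn to be filled has positive dimension
  obtain ⟨m, hm⟩ : ∃ m, t.card = m + 1 := by
    refine Nat.exists_eq_succ_of_ne_zero fun h => ht' ?_
    rw [Finset.card_eq_zero.1 h]
    exact h𝓕
  have hsN := hcard _ (hinsert t ht ht') hs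
  obtain ⟨σ, hσ⟩ := exists_orderEmbedding (hchain _ (hinsert t ht ht') hs)
    (hcard'.trans congr($hm + 1))
  obtain ⟨k, hk⟩ : ∃ k, σ k = q := by
    have : q ∈ Finset.univ.image σ := by rw [hσ]; exact Finset.mem_insert_self _ _
    simpa using this
  let 𝓕' := 𝓕 ⊔ LowerSet.Iic (insert q t)
  have hle' : 𝓕' ≤ 𝓖 := sup_le hle (LowerSet.Iic_le.2 (hinsert t ht ht'))
  have hmem (r) : r ∈ 𝓕' ↔ r ∈ 𝓕 ∨ r ⊆ insert q t := by
    simp only [𝓕', LowerSet.mem_sup_iff, LowerSet.mem_Iic_iff]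
  have hcell : LiftCover S (SSet.Subcomplex.homOfLE (e.ofFamily_mono
      (le_sup_left : 𝓕 ≤ 𝓕'))) f := by
    refine LiftCover.of_attach _ (e.simplex σ) ?_ ?_
    · rw [preimage_ofFamily_eq_horn _ _ _ k]
      · exact hf m k (by omega)
      · intro r hr
        rw [hσ, hk] at *
        constructor
        · intro h1 h2
          by_cases hqr : q ∈ r
          · rw [Finset.insert_eq_of_mem hqr] at h2
            exact hs (h2 ▸ h1)
          · refine ht' ?_
            have : r = t := by
              rw [← Finset.erase_insert hqr, h2, Finset.erase_insert hqt]
            exact this ▸ h1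
        · intro h1
          by_contra h2
          exact h1 (hproper r hr h2)
    · rw [range_simplex, hσ, ← ofFamily_sup]
  have hrest : LiftCover S (SSet.Subcomplex.homOfLE (e.ofFamily_mono hle')) f := by
    refine ih _ ?_ hle' ((hmem _).2 (.inl h𝓕))
      (fun s h h' => hchain s h (mt (fun x => (hmem _).2 (.inl x)) h'))
      (fun s h h' => hcard s h (mt (fun x => (hmem _).2 (.inl x)) h'))
      (fun s h h' => hinsert s h (mt (fun x => (hmem _).2 (.inl x)) h')) ?_ rfl
    · rw [← hd]
      refine Set.ncard_lt_ncard ⟨fun s hs => ⟨hs.1, mt (fun x => (hmem _).2 (.inl x)) hs.2⟩,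
        fun h => ?_⟩
      exact (h (a := t) ⟨ht, ht'⟩).2 ((hmem _).2 (.inr (Finset.subset_insert _ _)))
    · intro s h h'
      rw [hmem] at h' ⊢
      push Not at h'
      rintro (h1 | h1)
      · exact herase s h h'.1 h1
      · refine h'.2 ?_
        intro x hx
        by_cases hxq : x = q
        · simp [hxq]
        · exact h1 (Finset.mem_erase.2 ⟨hxq, hx⟩)
  exact hcell.comp_left hS hrest

/-- Every inclusion of subcomplexes is obtained by attaching simplices along their boundaries, in
order of increasing dimension. -/
theorem LiftCover.of_boundary [Finite Q] (hS : IsCoverClass S) (N : ℕ)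
    (hf : ∀ (m : ℕ), m ≤ N → LiftCover S (∂Δ[m].ι) f)
    {𝓕 𝓖 : LowerSet (Finset Q)} (hle : 𝓕 ≤ 𝓖) (h𝓕 : ∅ ∈ 𝓕)
    (hchain : ∀ s ∈ 𝓖, s ∉ 𝓕 → IsChain (· ≤ ·) (s : Set Q))
    (hcard : ∀ s ∈ 𝓖, s ∉ 𝓕 → s.card ≤ N + 1) :
    LiftCover S (SSet.Subcomplex.homOfLE (e.ofFamily_mono hle)) f := by
  induction hd : ((𝓖 : Set (Finset Q)) \ 𝓕).ncard using Nat.strong_induction_on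
    generalizing 𝓕 with
  | _ d ih =>
  by_cases hne : ∃ s, s ∈ 𝓖 ∧ s ∉ 𝓕
  swap
  · push Not at hne
    exact LiftCover.homOfLE_refl hS _ (e.ofFamily_mono hne)
  obtain ⟨t, ⟨ht, ht'⟩, hmin⟩ :=
    Set.exists_min_image ((𝓖 : Set (Finset Q)) \ 𝓕) Finset.card (Set.toFinite _) hne
  have hproper (r) (hr : r ⊆ t) (hr' : r ∉ 𝓕) : r = t :=
    Finset.eq_of_subset_of_card_le hr (hmin _ ⟨𝓖.lower hr ht, hr'⟩)
  obtain ⟨m, hm⟩ : ∃ m, t.card = m + 1 := by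
    refine Nat.exists_eq_succ_of_ne_zero fun h => ht' ?_
    rw [Finset.card_eq_zero.1 h]
    exact h𝓕
  have hsN := hcard _ ht ht'
  obtain ⟨σ, hσ⟩ := exists_orderEmbedding (hchain _ ht ht') hm
  let 𝓕' := 𝓕 ⊔ LowerSet.Iic t
  have hle' : 𝓕' ≤ 𝓖 := sup_le hle (LowerSet.Iic_le.2 ht)
  have hmem (r) : r ∈ 𝓕' ↔ r ∈ 𝓕 ∨ r ⊆ t := by
    simp only [𝓕', LowerSet.mem_sup_iff, LowerSet.mem_Iic_iff]
  have hcell : LiftCover S (SSet.Subcomplex.homOfLE (e.ofFamily_mono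
      (le_sup_left : 𝓕 ≤ 𝓕'))) f := by
    refine LiftCover.of_attach _ (e.simplex σ) ?_ ?_
    · rw [preimage_ofFamily_eq_boundary]
      · exact hf m (by omega)
      · intro r hr
        rw [hσ] at *
        exact ⟨fun h1 h2 => ht' (h2 ▸ h1), fun h1 => by_contra fun h2 => h1 (hproper r hr h2)⟩
    · rw [range_simplex, hσ, ← ofFamily_sup]
  have hrest : LiftCover S (SSet.Subcomplex.homOfLE (e.ofFamily_mono hle')) f := by
    refine ih _ ?_ hle' ((hmem _).2 (.inl h𝓕))
      (fun s h h' => hchain s h (mt (fun x => (hmem _).2 (.inl x)) h'))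
      (fun s h h' => hcard s h (mt (fun x => (hmem _).2 (.inl x)) h')) rfl
    rw [← hd]
    refine Set.ncard_lt_ncard ⟨fun s hs => ⟨hs.1, mt (fun x => (hmem _).2 (.inl x)) hs.2⟩,
        fun h => ?_⟩
    exact (h (a := t) ⟨ht, ht'⟩).2 ((hmem _).2 (.inr subset_rfl))
  exact hcell.comp_left hS hrest

end Cells

end HigherGpd

namespace HigherGpd

/-! ### Horns, boundaries and prisms -/

section Shapes

variable {E : Type u} [Category.{v} E] {S : MorphismProperty E} {Y Z : Eᵒᵖ ⥤ SSet.{w}}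
  {f : Y ⟶ Z}

open NerveIso

/-- The standard simplex as the nerve of a finite ordinal. -/
def stdNerveIso (n : ℕ) : NerveIso (Δ[n] : SSet.{w}) (Fin (n + 1)) where
  equiv _ := SSet.stdSimplex.objEquiv.trans SimplexCategory.homEquivOrderHom
  map_equiv _ _ := rfl

/-- The prism `Δ[n] ⊗ Δ[1]` as the nerve of a product of two ordinals. -/
def prismNerveIso (n : ℕ) : NerveIso (Δ[n] ⊗ Δ[1] : SSet.{w}) (Fin (n + 1) × Fin 2) where
  equiv m :=
    { toFun := fun x => ((stdNerveIso n).equiv m x.1).prod ((stdNerveIso 1).equiv m x.2)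
      invFun := fun g => (((stdNerveIso n).equiv m).symm (OrderHom.fst.comp g),
        ((stdNerveIso 1).equiv m).symm (OrderHom.snd.comp g))
      left_inv := fun x => by
        refine Prod.ext ?_ ?_
        · exact (((stdNerveIso n).equiv m).symm_apply_eq (y := x.1)).2 (OrderHom.ext _ _ rfl)
        · exact (((stdNerveIso 1).equiv m).symm_apply_eq (y := x.2)).2 (OrderHom.ext _ _ rfl)
      right_inv := fun g => rfl }
  map_equiv _ _ := rfl

/-- The sets of vertices of the simplices of the horn `Λ[n, k]`. -/
def hornFamily (n : ℕ) (k : Fin (n + 1)) : LowerSet (Finset (Fin (n + 1))) where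
  carrier := {s | ∃ i, i ≠ k ∧ i ∉ s}
  lower' := fun _ _ h ⟨i, hi, hi'⟩ => ⟨i, hi, fun h' => hi' (h h')⟩

/-- The sets of vertices of the simplices of the boundary `∂Δ[n]`. -/
def boundaryFamily (n : ℕ) : LowerSet (Finset (Fin (n + 1))) where
  carrier := {s | ∃ i, i ∉ s}
  lower' := fun _ _ h ⟨i, hi⟩ => ⟨i, fun h' => hi (h h')⟩

/-- The finite chains of a partially ordered set. -/
def chainFamily (Q : Type*) [PartialOrder Q] : LowerSet (Finset Q) where
  carrier := {s | IsChain (· ≤ ·) (s : Set Q)}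
  lower' := fun _ _ h h' => h'.mono (Finset.coe_subset.2 h)

/-- The sets of vertices of the simplices of a pushout product in a prism. -/
def unionFamily {n : ℕ} (𝓐 : LowerSet (Finset (Fin (n + 1)))) (𝓑 : LowerSet (Finset (Fin 2))) :
    LowerSet (Finset (Fin (n + 1) × Fin 2)) where
  carrier := {s | s.image Prod.snd ∈ 𝓑 ∨ s.image Prod.fst ∈ 𝓐}
  lower' := fun _ _ h h' => h'.imp (𝓑.lower (Finset.image_subset_image h))
    (𝓐.lower (Finset.image_subset_image h))

theorem ofFamily_horn (n : ℕ) (k : Fin (n + 1)) :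
    (stdNerveIso.{w} n).ofFamily (hornFamily n k) = Λ[n, k] := by
  ext m c
  refine Iff.trans ?_ (SSet.mem_horn_iff_notMem_range (d := m.unop.len) c k).symm
  change (∃ i, i ≠ k ∧ i ∉ Finset.univ.image _) ↔ _
  simp only [Finset.mem_image, Finset.mem_univ, true_and, Set.mem_range, exists_prop]
  rfl

theorem ofFamily_boundary (n : ℕ) :
    (stdNerveIso.{w} n).ofFamily (boundaryFamily n) = ∂Δ[n] := by
  ext m c
  refine Iff.trans ?_ (SSet.mem_boundary_iff_notMem_range (d := m.unop.len) c).symm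
  change (∃ i, i ∉ Finset.univ.image _) ↔ _
  simp only [Finset.mem_image, Finset.mem_univ, true_and, Set.mem_range]
  rfl

theorem ofFamily_union {n : ℕ} (𝓐 : LowerSet (Finset (Fin (n + 1))))
    (𝓑 : LowerSet (Finset (Fin 2))) : (prismNerveIso.{w} n).ofFamily (unionFamily 𝓐 𝓑) =
      SSet.Subcomplex.unionProd ((stdNerveIso n).ofFamily 𝓐) ((stdNerveIso 1).ofFamily 𝓑) := by
  ext m c
  refine Iff.trans ?_ (SSet.Subcomplex.mem_unionProd_iff _ _ c).symm
  change (Finset.image Prod.snd (Finset.univ.image _) ∈ 𝓑 ∨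
    Finset.image Prod.fst (Finset.univ.image _) ∈ 𝓐) ↔
    (Finset.univ.image _ ∈ 𝓑) ∨ (Finset.univ.image _ ∈ 𝓐)
  rw [Finset.image_image, Finset.image_image]
  rfl

section

variable {Q : Type*} [PartialOrder Q] [DecidableEq Q] {X : SSet.{w}} (e : NerveIso X Q)

theorem ofFamily_eq_top {𝓕 : LowerSet (Finset Q)} (h : chainFamily Q ≤ 𝓕) :
    e.ofFamily 𝓕 = ⊤ := by
  ext m x
  exact ⟨fun _ => trivial, fun _ => h (e.isChain_vertices x)⟩

theorem ofFamily_eq_bot : e.ofFamily (LowerSet.Iic ∅) = ⊥ := by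
  ext m x
  refine ⟨fun h => ?_, fun h => h.elim⟩
  obtain ⟨i, hi⟩ := e.vertices_nonempty x
  exact absurd (h hi) (Finset.notMem_empty _)

/-- The inclusion of a subcomplex, from its inclusion into a family of all the chains. -/
theorem LiftCover.ι_of_ofFamily (hS : IsCoverClass S) {𝓕 𝓖 : LowerSet (Finset Q)}
    (hle : 𝓕 ≤ 𝓖) (h𝓖 : chainFamily Q ≤ 𝓖)
    (h : LiftCover S (SSet.Subcomplex.homOfLE (e.ofFamily_mono hle)) f) :
    LiftCover S (e.ofFamily 𝓕).ι f := by
  have : IsIso (e.ofFamily 𝓖).ι := by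
    rw [ofFamily_eq_top e h𝓖]
    exact inferInstanceAs (IsIso (SSet.Subcomplex.topIso X).hom)
  exact h.comp_left hS (LiftCover.of_isIso_left hS (e.ofFamily 𝓖).ι f)

/-- A subcomplex which is a cone with apex `q` is obtained from `q` by filling horns. -/
theorem LiftCover.exists_of_cone [Finite Q] (hS : IsCoverClass S) (q : Q) (N : ℕ)
    (hf : ∀ (m : ℕ) (k : Fin (m + 2)), m + 1 ≤ N → LiftCover S (Λ[m + 1, k].ι) f)
    (𝓖 : LowerSet (Finset Q)) (hchain : 𝓖 ≤ chainFamily Q) (hcard : ∀ s ∈ 𝓖, s.card ≤ N + 1)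
    (hq : {q} ∈ 𝓖) (hinsert : ∀ s ∈ 𝓖, insert q s ∈ 𝓖) :
    ∃ j : (Δ[0] : SSet.{w}) ⟶ (e.ofFamily 𝓖 : SSet), LiftCover S j f := by
  obtain ⟨σ, hσ⟩ := exists_orderEmbedding (m := 0) (hchain hq) (Finset.card_singleton q)
  have hr := e.range_simplex σ
  rw [hσ] at hr
  have hle : LowerSet.Iic {q} ≤ 𝓖 := LowerSet.Iic_le.2 hq
  have h1 : LiftCover S (SSet.Subcomplex.homOfLE (e.ofFamily_mono hle)) f := by
    refine LiftCover.of_toggle e hS q N hf hle (Finset.empty_subset _) (fun s h _ => hchain h)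
      (fun s h _ => hcard s h) (fun s h _ => hinsert s h) ?_
    intro s h h' h''
    refine h' fun x hx => ?_
    by_cases hxq : x = q
    · exact Finset.mem_singleton.2 hxq
    · exact h'' (Finset.mem_erase.2 ⟨hxq, hx⟩)
  refine ⟨SSet.Subcomplex.toRange (e.simplex σ) ≫ SSet.Subcomplex.homOfLE hr.le ≫
    SSet.Subcomplex.homOfLE (e.ofFamily_mono hle), ?_⟩
  exact (LiftCover.of_isIso_left hS _ _).comp_left hS
    ((LiftCover.homOfLE_refl hS _ hr.ge).comp_left hS h1)

end

/-- A vertex of a horn `Λ[n + 1, k]` generates it by filling horns of dimension at most `n`. -/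
theorem LiftCover.exists_vertex_horn (hS : IsCoverClass S) (n : ℕ) (k : Fin (n + 2))
    (hf : ∀ (m : ℕ) (k : Fin (m + 2)), m + 1 ≤ n → LiftCover S (Λ[m + 1, k].ι) f) :
    ∃ j : (Δ[0] : SSet.{w}) ⟶ (Λ[n + 1, k] : SSet), LiftCover S j f := by
  rw [← ofFamily_horn]
  refine LiftCover.exists_of_cone _ hS k n hf _ (fun s _ => fun a _ b _ _ => le_total a b) ?_ ?_ ?_
  · rintro s ⟨i, -, hi⟩
    have := Finset.card_lt_univ_of_notMem hi
    rw [Fintype.card_fin] at this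
    omega
  · obtain ⟨i, hi⟩ := exists_ne k
    exact ⟨i, hi, by simpa using hi⟩
  · rintro s ⟨i, hi, hi'⟩
    exact ⟨i, hi, by simp [hi, hi']⟩

/-- A vertex of a simplex generates it by filling horns. -/
theorem LiftCover.exists_vertex_simplex (hS : IsCoverClass S) (n : ℕ)
    (hf : ∀ (m : ℕ) (k : Fin (m + 2)), LiftCover S (Λ[m + 1, k].ι) f) :
    ∃ j : (Δ[0] : SSet.{w}) ⟶ Δ[n], LiftCover S j f := by
  obtain ⟨j, hj⟩ := LiftCover.exists_of_cone (stdNerveIso.{w} n) hS 0 n (fun m k _ => hf m k)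
    (chainFamily _) le_rfl (fun s _ => by simpa using Finset.card_le_univ s)
    (fun a _ b _ _ => le_total a b) (fun s _ => fun a _ b _ _ => le_total a b)
  have : IsIso ((stdNerveIso.{w} n).ofFamily (chainFamily _)).ι := by
    rw [ofFamily_eq_top _ le_rfl]
    exact inferInstanceAs (IsIso (SSet.Subcomplex.topIso _).hom)
  exact ⟨_, hj.comp_left hS (LiftCover.of_isIso_left hS (ofFamily _ _).ι f)⟩

/-- The boundary of a simplex is built from lower-dimensional cells. The subcomplex `⊥` is initial,
so that lifts against this inclusion are points of `X^{∂Δ[n]}` over `Y^{∂Δ[n]}`. -/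
theorem LiftCover.bot_boundary (hS : IsCoverClass S) (n : ℕ)
    (hf : ∀ m : ℕ, m < n → LiftCover S (∂Δ[m].ι) f) :
    LiftCover S (SSet.Subcomplex.homOfLE (bot_le : ⊥ ≤ (∂Δ[n] : (Δ[n] : SSet.{w}).Subcomplex)))
      f := by
  cases n with
  | zero =>
    exact LiftCover.homOfLE_refl hS _ (SSet.boundary_zero.le)
  | succ n =>
  have := LiftCover.of_boundary (stdNerveIso.{w} (n + 1)) hS n (fun m hm => hf m (by omega))
    (𝓕 := LowerSet.Iic ∅) (𝓖 := boundaryFamily (n + 1))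
    (LowerSet.Iic_le.2 ⟨0, by simp⟩) (Finset.empty_subset _)
    (fun s _ _ => fun a _ b _ _ => le_total a b) (by
      rintro s ⟨i, hi⟩ -
      have := Finset.card_lt_univ_of_notMem hi
      rw [Fintype.card_fin] at this
      omega)
  convert this using 2
  · rw [ofFamily_eq_bot]
  · rw [ofFamily_boundary]
  · rw [ofFamily_eq_bot]
  · rw [ofFamily_boundary]

theorem LiftCover.bot_simplex (hS : IsCoverClass S) (n : ℕ)
    (hf : ∀ m : ℕ, LiftCover S (∂Δ[m].ι) f) :
    LiftCover S ((⊥ : (Δ[n] : SSet.{w}).Subcomplex).ι) f :=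
  (LiftCover.bot_boundary hS n fun m _ => hf m).comp_left hS (hf n)

/-- Hypercovers lift against all inclusions of subcomplexes of the nerve of a finite poset. -/
theorem LiftCover.ofFamily_of_boundary {Q : Type*} [PartialOrder Q] [DecidableEq Q] [Finite Q]
    {X : SSet.{w}} (e : NerveIso X Q) (hS : IsCoverClass S)
    (hf : ∀ m : ℕ, LiftCover S (∂Δ[m].ι) f) (𝓕 : LowerSet (Finset Q)) (h𝓕 : ∅ ∈ 𝓕) :
    LiftCover S (e.ofFamily 𝓕).ι f := by
  have := Fintype.ofFinite Q
  refine LiftCover.ι_of_ofFamily e hS le_sup_left (le_sup_right : chainFamily Q ≤ 𝓕 ⊔ _)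
    (LiftCover.of_boundary e hS (Fintype.card Q) (fun m _ => hf m) le_sup_left h𝓕 ?_ ?_)
  · intro s hs hs'
    exact hs.resolve_left hs'
  · intro s _ _
    exact (Finset.card_le_univ s).trans (Nat.le_succ _)

/-- Hypercovers are Kan fibrations. -/
theorem LiftCover.horn_of_boundary (hS : IsCoverClass S) (n : ℕ) (k : Fin (n + 2))
    (hf : ∀ m : ℕ, LiftCover S (∂Δ[m].ι) f) :
    LiftCover S (Λ[n + 1, k] : SSet.Subcomplex.{w} _).ι f := by
  rw [← ofFamily_horn]
  refine LiftCover.ofFamily_of_boundary _ hS hf _ ?_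
  obtain ⟨i, hi⟩ := exists_ne k
  exact ⟨i, hi, by simp⟩

theorem LiftCover.boundary_prism_of_boundary (hS : IsCoverClass S) (n : ℕ)
    (hf : ∀ m : ℕ, LiftCover S (∂Δ[m].ι) f) :
    LiftCover S (SSet.Subcomplex.unionProd.{w} ∂Δ[n] ∂Δ[1]).ι f := by
  rw [← ofFamily_boundary, ← ofFamily_boundary, ← ofFamily_union]
  exact LiftCover.ofFamily_of_boundary _ hS hf _ (.inl ⟨0, by simp⟩)

section

variable {n : ℕ} {s : Finset (Fin (n + 1) × Fin 2)} {j : Fin (n + 1)}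

theorem mem_chainFamily {Q : Type*} [PartialOrder Q] {s : Finset Q} :
    s ∈ chainFamily Q ↔ IsChain (· ≤ ·) (s : Set Q) := Iff.rfl

/-- A chain in a prism remains a chain after adding a vertex `(j, 0)` if its vertices at level
`1` are beyond `j`. -/
theorem insert_zero_mem_chainFamily (hs : s ∈ chainFamily (Fin (n + 1) × Fin 2))
    (h : ∀ x ∈ s, x.2 = 1 → j ≤ x.1) : insert (j, 0) s ∈ chainFamily (Fin (n + 1) × Fin 2) := by
  rw [mem_chainFamily, Finset.coe_insert]
  refine hs.insert fun x hx _ => ?_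
  obtain ⟨a, b⟩ := x
  simp only [Prod.mk_le_mk]
  have := h _ hx
  fin_cases b
  · simpa using le_total j a
  · left
    exact ⟨this rfl, by simp⟩

/-- A chain in a prism remains a chain after adding a vertex `(j, 1)` if its vertices at level
`0` are not beyond `j`. -/
theorem insert_one_mem_chainFamily (hs : s ∈ chainFamily (Fin (n + 1) × Fin 2))
    (h : ∀ x ∈ s, x.2 = 0 → x.1 ≤ j) : insert (j, 1) s ∈ chainFamily (Fin (n + 1) × Fin 2) := by
  rw [mem_chainFamily, Finset.coe_insert]
  refine hs.insert fun x hx _ => ?_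
  obtain ⟨a, b⟩ := x
  simp only [Prod.mk_le_mk]
  have := h _ hx
  fin_cases b
  · right
    exact ⟨this rfl, by simp⟩
  · simpa using le_total j a

theorem mem_union_horn_boundary {k : Fin (n + 1)} :
    s ∈ unionFamily (hornFamily n k) (boundaryFamily 1) ↔
      (∃ i : Fin 2, ∀ x ∈ s, x.2 ≠ i) ∨ ∃ i, i ≠ k ∧ ∀ x ∈ s, x.1 ≠ i := by
  change ((∃ i, i ∉ s.image Prod.snd) ∨ ∃ i, i ≠ k ∧ i ∉ s.image Prod.fst) ↔ _
  simp only [Finset.mem_image, not_exists, not_and, ne_eq]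

theorem mem_union_boundary_horn {k : Fin 2} :
    s ∈ unionFamily (boundaryFamily n) (hornFamily 1 k) ↔
      (∃ i : Fin 2, i ≠ k ∧ ∀ x ∈ s, x.2 ≠ i) ∨ ∃ i, ∀ x ∈ s, x.1 ≠ i := by
  change ((∃ i, i ≠ k ∧ i ∉ s.image Prod.snd) ∨ ∃ i, i ∉ s.image Prod.fst) ↔ _
  simp only [Finset.mem_image, not_exists, not_and, ne_eq]

/-- Chains in the prism whose vertices at level `1` satisfy `p`. -/
def upperFamily (p : Fin (n + 1) → Prop) : LowerSet (Finset (Fin (n + 1) × Fin 2)) where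
  carrier := {s | s ∈ chainFamily _ ∧ ∀ x ∈ s, x.2 = 1 → p x.1}
  lower' := fun _ _ h h' => ⟨(chainFamily _).lower h h'.1, fun x hx => h'.2 x (h hx)⟩

/-- Chains in the prism whose vertices at level `0` satisfy `p`. -/
def lowerFamily (p : Fin (n + 1) → Prop) : LowerSet (Finset (Fin (n + 1) × Fin 2)) where
  carrier := {s | s ∈ chainFamily _ ∧ ∀ x ∈ s, x.2 = 0 → p x.1}
  lower' := fun _ _ h h' => ⟨(chainFamily _).lower h h'.1, fun x hx => h'.2 x (h hx)⟩

theorem mem_upperFamily {p : Fin (n + 1) → Prop} :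
    s ∈ upperFamily p ↔ s ∈ chainFamily _ ∧ ∀ x ∈ s, x.2 = 1 → p x.1 := Iff.rfl

theorem mem_lowerFamily {p : Fin (n + 1) → Prop} :
    s ∈ lowerFamily p ↔ s ∈ chainFamily _ ∧ ∀ x ∈ s, x.2 = 0 → p x.1 := Iff.rfl

end

/-- One step of the filtrations of a prism: the families `𝓕 ⊔ 𝓐 ≤ 𝓕 ⊔ 𝓑` are matched by the
vertex `q`. -/
theorem LiftCover.prism_step (hS : IsCoverClass S) {n : ℕ} (q : Fin (n + 1) × Fin 2)
    (hf : ∀ (m : ℕ) (k : Fin (m + 2)), LiftCover S (Λ[m + 1, k].ι) f)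
    {𝓕 𝓐 𝓑 : LowerSet (Finset (Fin (n + 1) × Fin 2))} (h𝓕 : ∅ ∈ 𝓕) (hle : 𝓐 ≤ 𝓑)
    (hchain : 𝓑 ≤ chainFamily _)
    (hinsert : ∀ s ∈ 𝓑, s ∉ 𝓕 → s ∉ 𝓐 → insert q s ∈ 𝓑)
    (herase : ∀ s ∈ 𝓑, s ∉ 𝓕 → s ∉ 𝓐 → s.erase q ∉ 𝓕 ∧ s.erase q ∉ 𝓐) :
    LiftCover S (SSet.Subcomplex.homOfLE
      ((prismNerveIso.{w} n).ofFamily_mono (sup_le_sup_left hle 𝓕))) f := by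
  have hmem (s) (h : s ∈ 𝓕 ⊔ 𝓑) (h' : s ∉ 𝓕 ⊔ 𝓐) : s ∈ 𝓑 ∧ s ∉ 𝓕 ∧ s ∉ 𝓐 := by
    rw [LowerSet.mem_sup_iff] at h h'
    push Not at h'
    exact ⟨h.resolve_left h'.1, h'⟩
  refine LiftCover.of_toggle _ hS q (Fintype.card (Fin (n + 1) × Fin 2)) (fun m k _ => hf m k)
    (sup_le_sup_left hle 𝓕) (.inl h𝓕) ?_ ?_ ?_ ?_
  · intro s h h'
    exact hchain (hmem s h h').1
  · intro s _ _
    exact (Finset.card_le_univ s).trans (Nat.le_succ _)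
  · intro s h h'
    obtain ⟨h1, h2, h3⟩ := hmem s h h'
    exact .inr (hinsert s h1 h2 h3)
  · intro s h h'
    obtain ⟨h1, h2, h3⟩ := hmem s h h'
    rw [LowerSet.mem_sup_iff]
    push Not
    exact herase s h1 h2 h3

/-- The pushout product of a boundary with the vertex `0` of `Δ[1]` is obtained by filling
horns: the chains are sorted by their first vertex `(j, 1)` at level `1`, and matched by adding
or removing `(j, 0)`. -/
theorem LiftCover.boundary_prism_zero (hS : IsCoverClass S) (n : ℕ)
    (hf : ∀ (m : ℕ) (k : Fin (m + 2)), LiftCover S (Λ[m + 1, k].ι) f) :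
    LiftCover S (SSet.Subcomplex.unionProd.{w} ∂Δ[n] Λ[1, 0]).ι f := by
  rw [← ofFamily_boundary, ← ofFamily_horn, ← ofFamily_union]
  set 𝓕 := unionFamily (boundaryFamily n) (hornFamily 1 0)
  have h𝓕 : ∅ ∈ 𝓕 := .inr ⟨0, by simp⟩
  suffices H : ∀ j : ℕ, LiftCover S (SSet.Subcomplex.homOfLE ((prismNerveIso.{w} n).ofFamily_mono
      (le_sup_left : 𝓕 ≤ 𝓕 ⊔ upperFamily fun i => n + 1 ≤ i + j))) f from
    LiftCover.ι_of_ofFamily _ hS (𝓖 := 𝓕 ⊔ upperFamily fun i => n + 1 ≤ i + (n + 1)) le_sup_left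
      (le_sup_of_le_right fun s hs => ⟨hs, fun x _ _ => by omega⟩) (H (n + 1))
  intro j
  induction j with
  | zero =>
    refine LiftCover.homOfLE_refl hS _ (NerveIso.ofFamily_mono _ (sup_le le_rfl ?_))
    rintro s ⟨-, hs⟩
    refine mem_union_boundary_horn.2 (.inl ⟨1, by simp, fun x hx hx' => ?_⟩)
    have := hs x hx hx'
    omega
  | succ j ih =>
    by_cases hj : j ≤ n
    swap
    · refine ih.comp_left hS (j := SSet.Subcomplex.homOfLE (NerveIso.ofFamily_mono _
        (sup_le_sup_left (fun s hs => ⟨hs.1, fun x hx hx' => by have := hs.2 x hx hx'; omega⟩) _)))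
        (LiftCover.homOfLE_refl hS _ (NerveIso.ofFamily_mono _ (sup_le_sup_left ?_ _)))
      exact fun s hs => ⟨hs.1, fun x _ _ => by omega⟩
    obtain ⟨i, hi⟩ : ∃ i : Fin (n + 1), (i : ℕ) + j = n := ⟨⟨n - j, by omega⟩, by simp; omega⟩
    refine ih.comp_left hS (LiftCover.prism_step hS (i, 0) hf h𝓕
      (𝓐 := upperFamily fun x => n + 1 ≤ x + j) (𝓑 := upperFamily fun x => n + 1 ≤ x + (j + 1))
      (fun s hs => ⟨hs.1, fun x hx hx' => by have := hs.2 x hx hx'; omega⟩) (fun s hs => hs.1)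
      ?_ ?_)
    · intro s hs _ _
      refine ⟨insert_zero_mem_chainFamily hs.1 fun x hx hx' => ?_, ?_⟩
      · have := hs.2 x hx hx'
        rw [Fin.le_def]
        omega
      · intro x hx hx'
        rw [Finset.mem_insert] at hx
        obtain rfl | hx := hx
        · simp at hx'
        · exact hs.2 x hx hx'
    · intro s hs hs' hs''
      have hi1 : (i, 1) ∈ s := by
        by_contra h
        refine hs'' ⟨hs.1, fun x hx hx' => ?_⟩
        have := hs.2 x hx hx'
        have : x.1 ≠ i := fun hxi => h (by rw [← hxi, ← hx']; exact hx)
        omega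
      rw [mem_union_boundary_horn] at hs' ⊢
      push Not at hs' ⊢
      refine ⟨⟨fun l hl => ⟨(i, 1), by simp [hi1], ?_⟩, fun l => ?_⟩, fun h => ?_⟩
      · change (1 : Fin 2) = l
        omega
      · obtain ⟨x, hx, rfl⟩ := hs'.2 l
        by_cases hxi : x = (i, 0)
        · exact ⟨(i, 1), by simp [hi1], by rw [hxi]⟩
        · exact ⟨x, by simp [hx, hxi], rfl⟩
      · have := h.2 (i, 1) (by simp [hi1]) rfl
        simp only at this
        omega

/-- The pushout product of a boundary with the vertex `1` of `Δ[1]` is obtained by filling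
horns: the chains are sorted by their last vertex `(j, 0)` at level `0`, and matched by adding
or removing `(j, 1)`. -/
theorem LiftCover.boundary_prism_one (hS : IsCoverClass S) (n : ℕ)
    (hf : ∀ (m : ℕ) (k : Fin (m + 2)), LiftCover S (Λ[m + 1, k].ι) f) :
    LiftCover S (SSet.Subcomplex.unionProd.{w} ∂Δ[n] Λ[1, 1]).ι f := by
  rw [← ofFamily_boundary, ← ofFamily_horn, ← ofFamily_union]
  set 𝓕 := unionFamily (boundaryFamily n) (hornFamily 1 1)
  have h𝓕 : ∅ ∈ 𝓕 := .inr ⟨0, by simp⟩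
  suffices H : ∀ j : ℕ, LiftCover S (SSet.Subcomplex.homOfLE ((prismNerveIso.{w} n).ofFamily_mono
      (le_sup_left : 𝓕 ≤ 𝓕 ⊔ lowerFamily fun i => i < j))) f from
    LiftCover.ι_of_ofFamily _ hS (𝓖 := 𝓕 ⊔ lowerFamily fun i => (i : ℕ) < n + 1) le_sup_left
      (le_sup_of_le_right fun s hs => ⟨hs, fun x _ _ => by omega⟩) (H (n + 1))
  intro j
  induction j with
  | zero =>
    refine LiftCover.homOfLE_refl hS _ (NerveIso.ofFamily_mono _ (sup_le le_rfl ?_))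
    rintro s ⟨-, hs⟩
    refine mem_union_boundary_horn.2 (.inl ⟨0, by simp, fun x hx hx' => ?_⟩)
    have := hs x hx hx'
    omega
  | succ j ih =>
    by_cases hj : j ≤ n
    swap
    · refine ih.comp_left hS (j := SSet.Subcomplex.homOfLE (NerveIso.ofFamily_mono _
        (sup_le_sup_left (fun s hs => ⟨hs.1, fun x hx hx' => by have := hs.2 x hx hx'; omega⟩) _)))
        (LiftCover.homOfLE_refl hS _ (NerveIso.ofFamily_mono _ (sup_le_sup_left ?_ _)))
      exact fun s hs => ⟨hs.1, fun x _ _ => by omega⟩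
    obtain ⟨i, rfl⟩ : ∃ i : Fin (n + 1), (i : ℕ) = j := ⟨⟨j, by omega⟩, rfl⟩
    refine ih.comp_left hS (LiftCover.prism_step hS (i, 1) hf h𝓕
      (𝓐 := lowerFamily fun x => (x : ℕ) < i) (𝓑 := lowerFamily fun x => (x : ℕ) < i + 1)
      (fun s hs => ⟨hs.1, fun x hx hx' => by have := hs.2 x hx hx'; omega⟩) (fun s hs => hs.1)
      ?_ ?_)
    · intro s hs _ _
      refine ⟨insert_one_mem_chainFamily hs.1 fun x hx hx' => ?_, ?_⟩
      · have := hs.2 x hx hx'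
        rw [Fin.le_def]
        omega
      · intro x hx hx'
        rw [Finset.mem_insert] at hx
        obtain rfl | hx := hx
        · simp at hx'
        · exact hs.2 x hx hx'
    · intro s hs hs' hs''
      have hi1 : (i, 0) ∈ s := by
        by_contra h
        refine hs'' ⟨hs.1, fun x hx hx' => ?_⟩
        have := hs.2 x hx hx'
        have : x.1 ≠ i := fun hxi => h (by rw [← hxi, ← hx']; exact hx)
        omega
      rw [mem_union_boundary_horn] at hs' ⊢
      push Not at hs' ⊢
      refine ⟨⟨fun l hl => ⟨(i, 0), by simp [hi1], ?_⟩, fun l => ?_⟩, fun h => ?_⟩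
      · change (0 : Fin 2) = l
        omega
      · obtain ⟨x, hx, rfl⟩ := hs'.2 l
        by_cases hxi : x = (i, 1)
        · exact ⟨(i, 0), by simp [hi1], by rw [hxi]⟩
        · exact ⟨x, by simp [hx, hxi], rfl⟩
      · have := h.2 (i, 0) (by simp [hi1]) rfl
        simp only at this
        omega

/-- The pushout product of a horn `Λ[n, k]` with the boundary of `Δ[1]` is obtained by filling
horns. If `k ≠ 0`, the chains all of whose vertices at level `1` are beyond `k` are matched by
`(k, 0)`, and then the other ones are matched by `(k, 1)`. If `k = 0`, the two levels are
exchanged. -/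
theorem LiftCover.horn_prism (hS : IsCoverClass S) (n : ℕ) (k : Fin (n + 2))
    (hf : ∀ (m : ℕ) (k : Fin (m + 2)), LiftCover S (Λ[m + 1, k].ι) f) :
    LiftCover S (SSet.Subcomplex.unionProd.{w} Λ[n + 1, k] ∂Δ[1]).ι f := by
  rw [← ofFamily_boundary, ← ofFamily_horn, ← ofFamily_union]
  set 𝓕 := unionFamily (hornFamily (n + 1) k) (boundaryFamily 1)
  have h𝓕 : ∅ ∈ 𝓕 := .inl ⟨0, by simp⟩
  by_cases hk : k = 0
  · have hk' : Fin.last (n + 1) ≠ k := by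
      rw [hk]
      exact Fin.last_pos.ne'
    have h1 := LiftCover.prism_step hS (k, 1) hf h𝓕 (𝓐 := lowerFamily fun _ => False)
      (𝓑 := lowerFamily fun i => i ≤ k) (fun s hs => ⟨hs.1, fun x hx hx' => (hs.2 x hx hx').elim⟩)
      (fun s hs => hs.1) ?_ ?_
    have h2 := LiftCover.prism_step hS (k, 0) hf h𝓕 (𝓐 := lowerFamily fun i => i ≤ k)
      (𝓑 := chainFamily _) (fun s hs => hs.1) le_rfl ?_ ?_
    · have h0 : LiftCover S (SSet.Subcomplex.homOfLE ((prismNerveIso.{w} (n + 1)).ofFamily_mono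
          (le_sup_left : 𝓕 ≤ 𝓕 ⊔ lowerFamily fun _ => False))) f := by
        refine LiftCover.homOfLE_refl hS _ (NerveIso.ofFamily_mono _ (sup_le le_rfl ?_))
        rintro s ⟨-, hs⟩
        exact mem_union_horn_boundary.2 (.inl ⟨0, fun x hx hx' => hs x hx hx'⟩)
      exact LiftCover.ι_of_ofFamily _ hS le_sup_left le_sup_right
        ((h0.comp_left hS h1).comp_left hS h2)
    · intro s hs _ hs''
      rw [mem_lowerFamily] at hs''
      push Not at hs''
      obtain ⟨⟨y, l⟩, hy, rfl, hyk⟩ := hs'' hs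
      refine insert_zero_mem_chainFamily hs fun x hx hx' => ?_
      obtain h | h := hs.total hx hy
      · rw [Prod.le_def, hx'] at h
        exact absurd h.2 (by simp)
      · exact hyk.le.trans h.1
    · intro s hs hs' hs''
      rw [mem_lowerFamily] at hs''
      push Not at hs''
      obtain ⟨⟨y, l⟩, hy, rfl, hyk⟩ := hs'' hs
      have hy' : (y, 0) ∈ s.erase (k, 0) :=
        Finset.mem_erase.2 ⟨fun h => hyk.ne' congr(($h).1), hy⟩
      rw [mem_union_horn_boundary] at hs' ⊢
      push Not at hs' ⊢
      refine ⟨⟨fun l => ?_, fun l hl => ?_⟩, fun h => ?_⟩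
      · obtain rfl | hl : l = 0 ∨ l ≠ 0 := em _
        · exact ⟨_, hy', rfl⟩
        · obtain ⟨x, hx, rfl⟩ := hs'.1 l
          exact ⟨x, Finset.mem_erase.2 ⟨fun h => hl congr(($h).2), hx⟩, rfl⟩
      · obtain ⟨x, hx, rfl⟩ := hs'.2 l hl
        exact ⟨x, Finset.mem_erase.2 ⟨fun h => hl congr(($h).1), hx⟩, rfl⟩
      · exact absurd (h.2 _ hy' rfl) (not_le.2 hyk)
    · intro s hs _ _
      refine ⟨insert_one_mem_chainFamily hs.1 hs.2, fun x hx hx' => ?_⟩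
      rw [Finset.mem_insert] at hx
      obtain rfl | hx := hx
      · simp at hx'
      · exact hs.2 x hx hx'
    · intro s hs hs' hs''
      rw [mem_union_horn_boundary] at hs' ⊢
      push Not at hs' ⊢
      have h0 : ∃ x ∈ s.erase (k, 1), x.2 = 0 := by
        obtain ⟨x, hx, hx'⟩ := hs'.1 0
        refine ⟨x, Finset.mem_erase.2 ⟨fun h => ?_, hx⟩, hx'⟩
        rw [h] at hx'
        simp at hx'
      refine ⟨⟨fun l => ?_, fun l hl => ?_⟩, fun h => ?_⟩
      · obtain rfl | hl : l = 0 ∨ l ≠ 0 := em _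
        · exact h0
        · obtain ⟨x, hx, hxl⟩ := hs'.2 _ hk'
          refine ⟨x, Finset.mem_erase.2 ⟨fun h => hk' (hxl.symm.trans congr(($h).1)), hx⟩, ?_⟩
          by_contra h
          have := hs.2 x hx (by omega)
          rw [hxl] at this
          exact hk' (le_antisymm this (Fin.le_last _))
      · obtain ⟨x, hx, rfl⟩ := hs'.2 l hl
        exact ⟨x, Finset.mem_erase.2 ⟨fun h => hl congr(($h).1), hx⟩, rfl⟩
      · obtain ⟨x, hx, hx'⟩ := h0
        exact h.2 x hx hx'
  · have hk' : 0 ≠ k := fun h => hk h.symm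
    have h1 := LiftCover.prism_step hS (k, 0) hf h𝓕 (𝓐 := upperFamily fun _ => False)
      (𝓑 := upperFamily fun i => k ≤ i) (fun s hs => ⟨hs.1, fun x hx hx' => (hs.2 x hx hx').elim⟩)
      (fun s hs => hs.1) ?_ ?_
    have h2 := LiftCover.prism_step hS (k, 1) hf h𝓕 (𝓐 := upperFamily fun i => k ≤ i)
      (𝓑 := chainFamily _) (fun s hs => hs.1) le_rfl ?_ ?_
    · have h0 : LiftCover S (SSet.Subcomplex.homOfLE ((prismNerveIso.{w} (n + 1)).ofFamily_mono
          (le_sup_left : 𝓕 ≤ 𝓕 ⊔ upperFamily fun _ => False))) f := by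
        refine LiftCover.homOfLE_refl hS _ (NerveIso.ofFamily_mono _ (sup_le le_rfl ?_))
        rintro s ⟨-, hs⟩
        exact mem_union_horn_boundary.2 (.inl ⟨1, fun x hx hx' => hs x hx hx'⟩)
      exact LiftCover.ι_of_ofFamily _ hS le_sup_left le_sup_right
        ((h0.comp_left hS h1).comp_left hS h2)
    · intro s hs _ hs''
      rw [mem_upperFamily] at hs''
      push Not at hs''
      obtain ⟨⟨y, l⟩, hy, rfl, hyk⟩ := hs'' hs
      refine insert_one_mem_chainFamily hs fun x hx hx' => ?_
      obtain h | h := hs.total hx hy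
      · exact h.1.trans hyk.le
      · rw [Prod.le_def, hx'] at h
        exact absurd h.2 (by simp)
    · intro s hs hs' hs''
      rw [mem_upperFamily] at hs''
      push Not at hs''
      obtain ⟨⟨y, l⟩, hy, rfl, hyk⟩ := hs'' hs
      have hy' : (y, 1) ∈ s.erase (k, 1) :=
        Finset.mem_erase.2 ⟨fun h => hyk.ne congr(($h).1), hy⟩
      rw [mem_union_horn_boundary] at hs' ⊢
      push Not at hs' ⊢
      refine ⟨⟨fun l => ?_, fun l hl => ?_⟩, fun h => ?_⟩
      · obtain rfl | hl : l = 1 ∨ l ≠ 1 := em _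
        · exact ⟨_, hy', rfl⟩
        · obtain ⟨x, hx, rfl⟩ := hs'.1 l
          exact ⟨x, Finset.mem_erase.2 ⟨fun h => hl congr(($h).2), hx⟩, rfl⟩
      · obtain ⟨x, hx, rfl⟩ := hs'.2 l hl
        exact ⟨x, Finset.mem_erase.2 ⟨fun h => hl congr(($h).1), hx⟩, rfl⟩
      · exact absurd (h.2 _ hy' rfl) (not_le.2 hyk)
    · intro s hs _ _
      refine ⟨insert_zero_mem_chainFamily hs.1 hs.2, fun x hx hx' => ?_⟩
      rw [Finset.mem_insert] at hx
      obtain rfl | hx := hx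
      · simp at hx'
      · exact hs.2 x hx hx'
    · intro s hs hs' hs''
      rw [mem_union_horn_boundary] at hs' ⊢
      push Not at hs' ⊢
      have h0 : ∃ x ∈ s.erase (k, 0), x.2 = 1 := by
        obtain ⟨x, hx, hx'⟩ := hs'.1 1
        refine ⟨x, Finset.mem_erase.2 ⟨fun h => ?_, hx⟩, hx'⟩
        rw [h] at hx'
        simp at hx'
      refine ⟨⟨fun l => ?_, fun l hl => ?_⟩, fun h => ?_⟩
      · obtain rfl | hl : l = 1 ∨ l ≠ 1 := em _
        · exact h0
        · obtain ⟨x, hx, hxl⟩ := hs'.2 _ hk'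
          refine ⟨x, Finset.mem_erase.2 ⟨fun h => hk' (hxl.symm.trans congr(($h).1)), hx⟩, ?_⟩
          by_contra h
          have := hs.2 x hx (by omega)
          rw [hxl] at this
          exact hk' (le_antisymm this (Fin.zero_le _)).symm
      · obtain ⟨x, hx, rfl⟩ := hs'.2 l hl
        exact ⟨x, Finset.mem_erase.2 ⟨fun h => hl congr(($h).1), hx⟩, rfl⟩
      · obtain ⟨x, hx, hx'⟩ := h0
        exact h.2 x hx hx'

end Shapes

end HigherGpd

namespace HigherGpd

/-! ### Path spaces and pushout products -/

section PathHom

/-- The inclusion of `A` as an end of the cylinder `A ⊗ Δ[1]`. -/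
noncomputable def cylinderEnd (ε : Fin 2) (A : SSet.{w}) : A ⟶ A ⊗ Δ[1] :=
  CartesianMonoidalCategory.lift (𝟙 A) (SSet.const (SSet.stdSimplex.obj₀Equiv.symm ε))

/-- Evaluation of paths at an end of the interval. -/
noncomputable def evalEnd (ε : Fin 2) (Z : SSet.{w}) : pathSSet.obj Z ⟶ Z where
  app n := ↾fun φ : SSet.stdSimplex.obj n.unop ⊗ Δ[1] ⟶ Z => SSet.yonedaEquiv (cylinderEnd ε _ ≫ φ)
  naturality n m g := by
    ext φ
    change SSet.yonedaEquiv (cylinderEnd ε _ ≫ (SSet.stdSimplex.map g.unop ▷ Δ[1]) ≫ φ) =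
      Z.map g (SSet.yonedaEquiv (cylinderEnd ε _ ≫ φ))
    exact (SSet.yonedaEquiv_naturality g.unop (cylinderEnd ε _ ≫ φ)).symm

/-- A simplex of a path space, as a morphism from a prism. -/
def asPrism {Z : SSet.{w}} {n : SimplexCategoryᵒᵖ} (x : (pathSSet.obj Z).obj n) :
    SSet.stdSimplex.obj n.unop ⊗ Δ[1] ⟶ Z := x

/-- The path space is right adjoint to the cylinder. -/
noncomputable def pathHomEquiv (A Z : SSet.{w}) : (A ⟶ pathSSet.obj Z) ≃ (A ⊗ Δ[1] ⟶ Z) where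
  toFun φ :=
    { app := fun n => ↾fun x => (asPrism (φ.app n x.1)).app n
        (SSet.stdSimplex.objEquiv.symm (𝟙 n.unop), x.2)
      naturality := fun n m g => by
        ext ⟨a, t⟩
        have h1 : asPrism (φ.app m (A.map g a)) = (SSet.stdSimplex.map g.unop ▷ Δ[1]) ≫
            asPrism (φ.app n a) :=
          NatTrans.naturality_apply φ g a
        have h2 := NatTrans.naturality_apply (asPrism (φ.app n a)) g
          ((SSet.stdSimplex.objEquiv.symm (𝟙 n.unop), t) :
            (SSet.stdSimplex.obj n.unop).obj n × (Δ[1] : SSet.{w}).obj n)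
        change (asPrism (φ.app m (A.map g a))).app m
          (SSet.stdSimplex.objEquiv.symm (𝟙 m.unop), Δ[1].map g t) = Z.map g _
        rw [h1]
        refine Eq.trans ?_ h2
        refine congrArg ((asPrism (φ.app n a)).app m) (Prod.ext ?_ rfl)
        exact (congrArg SSet.stdSimplex.objEquiv.symm
          ((Category.id_comp g.unop).trans (Category.comp_id g.unop).symm) :) }
  invFun ψ :=
    { app := fun n => ↾fun a => (SSet.yonedaEquiv.symm a ▷ Δ[1]) ≫ ψ
      naturality := fun n m g => by
        ext a
        change (SSet.yonedaEquiv.symm (A.map g a) ▷ Δ[1]) ≫ ψ =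
          (SSet.stdSimplex.map g.unop ▷ Δ[1]) ≫ (SSet.yonedaEquiv.symm a ▷ Δ[1]) ≫ ψ
        rw [← MonoidalCategory.comp_whiskerRight_assoc]
        congr 2
        exact (SSet.yonedaEquiv_symm_naturality_left _ _).symm }
  left_inv φ := by
    ext n a
    refine SSet.hom_ext fun m => ?_
    ext ⟨c, t⟩
    obtain ⟨g, rfl⟩ := SSet.stdSimplex.objEquiv.symm.surjective c
    have h1 : asPrism (φ.app m (A.map g.op a)) = (SSet.stdSimplex.map g ▷ Δ[1]) ≫
        asPrism (φ.app n a) :=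
      NatTrans.naturality_apply φ g.op a
    change (asPrism (φ.app m (A.map g.op a))).app m _ = _
    rw [h1]
    refine congrArg ((asPrism (φ.app n a)).app m) (Prod.ext ?_ rfl)
    exact congrArg SSet.stdSimplex.objEquiv.symm (Category.id_comp g)
  right_inv ψ := by
    refine SSet.hom_ext fun n => ?_
    ext ⟨a, t⟩
    change ψ.app n ((SSet.yonedaEquiv.symm a).app n
      (SSet.stdSimplex.objEquiv.symm (𝟙 n.unop)), t) = _
    refine congrArg (ψ.app n) (Prod.ext ?_ rfl)
    change A.map (𝟙 _) a = a
    simp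

variable {A B Z W : SSet.{w}}

theorem pathHomEquiv_comp_left (i : A ⟶ B) (φ : B ⟶ pathSSet.obj Z) :
    pathHomEquiv A Z (i ≫ φ) = (i ▷ _) ≫ pathHomEquiv B Z φ := rfl

theorem pathHomEquiv_comp_right (φ : A ⟶ pathSSet.obj Z) (g : Z ⟶ W) :
    pathHomEquiv A W (φ ≫ pathSSet.map g) = pathHomEquiv A Z φ ≫ g := rfl

theorem comp_evalEnd (ε : Fin 2) (φ : A ⟶ pathSSet.obj Z) :
    φ ≫ evalEnd ε Z = cylinderEnd ε A ≫ pathHomEquiv A Z φ := by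
  refine SSet.hom_ext fun n => ?_
  ext a
  change (asPrism (φ.app n a)).app n _ =
    (asPrism (φ.app n a)).app n _
  congr 1

/-- A constant homotopy factors through the projection of the cylinder. -/
theorem pathHomEquiv_constPath (φ : A ⟶ Z) :
    pathHomEquiv A Z (φ ≫ constPath Z) = fst _ _ ≫ φ := by
  refine SSet.hom_ext fun n => ?_
  ext ⟨a, t⟩
  change Z.map (𝟙 _) (φ.app n a) = φ.app n a
  simp

theorem constPath_naturality (g : Z ⟶ W) :
    constPath Z ≫ pathSSet.map g = g ≫ constPath W := by
  apply (pathHomEquiv _ _).injective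
  rw [pathHomEquiv_comp_right, pathHomEquiv_constPath, ← Category.id_comp (constPath Z),
    pathHomEquiv_constPath]
  rfl

theorem constPath_evalEnd (ε : Fin 2) (Z : SSet.{w}) : constPath Z ≫ evalEnd ε Z = 𝟙 Z := by
  rw [comp_evalEnd, ← Category.id_comp (constPath Z), pathHomEquiv_constPath]
  rfl

end PathHom

section UnionProd

variable {A Z : SSet.{w}} (T : A.Subcomplex)

/-- The vertices of a simplex of the interval. -/
def level {n : SimplexCategoryᵒᵖ} (t : (Δ[1] : SSet.{w}).obj n) (i : Fin (n.unop.len + 1)) :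
    Fin 2 :=
  SSet.stdSimplex.asOrderHom t i

/-- The horn `Λ[1, ε]` is the vertex `ε` of the interval. -/
theorem mem_horn_one {ε : Fin 2} {n : SimplexCategoryᵒᵖ} (t : (Δ[1] : SSet.{w}).obj n) :
    t ∈ (Λ[1, ε] : SSet.Subcomplex.{w} _).obj n ↔
      t = ((SSet.const (X := Δ[1]) (SSet.stdSimplex.obj₀Equiv.symm ε) : Δ[1] ⟶ Δ[1])).app n t := by
  refine (SSet.mem_horn_iff_notMem_range (d := n.unop.len) t ε).trans ⟨?_, fun h => ?_⟩
  · rintro ⟨j, hj, hj'⟩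
    refine SSet.stdSimplex.ext (d := n.unop.len) _ _ fun i => ?_
    have : level t i ≠ j := fun h => hj' ⟨i, h⟩
    change level t i = ε
    omega
  · refine ⟨ε + 1, by fin_cases ε <;> simp, ?_⟩
    rintro ⟨i, hi⟩
    have : level t i = ε := by rw [h]; rfl
    replace hi : level t i = ε + 1 := hi
    rw [this] at hi
    fin_cases ε <;> simp at hi

/-- The boundary of the interval consists of its two vertices. -/
theorem mem_boundary_one {n : SimplexCategoryᵒᵖ} (t : (Δ[1] : SSet.{w}).obj n) :
    t ∈ (∂Δ[1] : SSet.Subcomplex.{w} _).obj n ↔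
      ∃ ε : Fin 2, t = ((SSet.const (X := Δ[1]) (SSet.stdSimplex.obj₀Equiv.symm ε) :
        Δ[1] ⟶ Δ[1])).app n t := by
  simp only [← mem_horn_one, Fin.exists_fin_two]
  refine (SSet.mem_boundary_iff_notMem_range (d := n.unop.len) t).trans ?_
  refine Iff.trans ?_ (or_congr (SSet.mem_horn_iff_notMem_range (d := n.unop.len) t 0)
    (SSet.mem_horn_iff_notMem_range (d := n.unop.len) t 1)).symm
  simp [Fin.exists_fin_two, or_comm]

/-- The end of the cylinder on `A`, as a part of a pushout product. -/
noncomputable def unionProdEnd (K : (Δ[1] : SSet.{w}).Subcomplex) (ε : Fin 2) (h : Λ[1, ε] ≤ K) :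
    A ⟶ (T.unionProd K : SSet) :=
  SSet.Subcomplex.lift (cylinderEnd ε A) (by
    rintro n - ⟨a, rfl⟩
    exact (SSet.Subcomplex.mem_unionProd_iff _ _ _).2 (.inl (h _ ((mem_horn_one _).2 rfl))))

theorem horn_one_le_boundary (ε : Fin 2) : (Λ[1, ε] : SSet.Subcomplex.{w} _) ≤ ∂Δ[1] :=
  fun _ t ht => (mem_boundary_one t).2 ⟨ε, (mem_horn_one t).1 ht⟩

variable {T}

theorem unionProd_horn_hom_ext {ε : Fin 2} {l l' : (T.unionProd Λ[1, ε] : SSet) ⟶ Z}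
    (h₁ : SSet.Subcomplex.unionProd.ι₂ _ _ ≫ l = SSet.Subcomplex.unionProd.ι₂ _ _ ≫ l')
    (h₂ : unionProdEnd T _ ε le_rfl ≫ l = unionProdEnd T _ ε le_rfl ≫ l') : l = l' := by
  refine SSet.hom_ext fun n => ?_
  ext ⟨⟨x, t⟩, h⟩
  obtain h' | h' := (SSet.Subcomplex.mem_unionProd_iff _ _ _).1 h
  · have e : (⟨(x, t), h⟩ : (T.unionProd Λ[1, ε] : SSet).obj n) =
        (unionProdEnd T _ ε le_rfl).app n x :=
      Subtype.ext (Prod.ext rfl ((mem_horn_one t).1 h'))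
    rw [e]
    exact congr(($h₂).app n x)
  · exact congr(($h₁).app n (⟨x, h'⟩, t))

theorem unionProd_boundary_hom_ext {l l' : (T.unionProd ∂Δ[1] : SSet) ⟶ Z}
    (h₁ : SSet.Subcomplex.unionProd.ι₂ _ _ ≫ l = SSet.Subcomplex.unionProd.ι₂ _ _ ≫ l')
    (h₂ : ∀ ε, unionProdEnd T _ ε (horn_one_le_boundary ε) ≫ l =
      unionProdEnd T _ ε (horn_one_le_boundary ε) ≫ l') : l = l' := by
  refine SSet.hom_ext fun n => ?_
  ext ⟨⟨x, t⟩, h⟩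
  obtain h' | h' := (SSet.Subcomplex.mem_unionProd_iff _ _ _).1 h
  · obtain ⟨ε, hε⟩ := (mem_boundary_one t).1 h'
    have e : (⟨(x, t), h⟩ : (T.unionProd ∂Δ[1] : SSet).obj n) =
        (unionProdEnd T _ ε (horn_one_le_boundary ε)).app n x := Subtype.ext (Prod.ext rfl hε)
    rw [e]
    exact congr(($(h₂ ε)).app n x)
  · exact congr(($h₁).app n (⟨x, h'⟩, t))

/-- A homotopy on `T` and an extension of one of its ends to `A` define a map on the pushout
product. -/
theorem exists_unionProd_horn_desc {ε : Fin 2} (a : (T : SSet) ⊗ Δ[1] ⟶ Z) (b : A ⟶ Z)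
    (h : T.ι ≫ b = cylinderEnd ε _ ≫ a) : ∃ l : (T.unionProd Λ[1, ε] : SSet) ⟶ Z,
      SSet.Subcomplex.unionProd.ι₂ _ _ ≫ l = a ∧ unionProdEnd T _ ε le_rfl ≫ l = b := by
  let l := (SSet.Subcomplex.unionProd.isPushout T (Λ[1, ε] : SSet.Subcomplex.{w} _)).desc
    (fst _ _ ≫ b) a (by
      refine SSet.hom_ext fun n => ?_
      ext ⟨x, t⟩
      refine congr(($h).app n x).trans (congrArg (a.app n) (Prod.ext rfl ?_))
      exact ((mem_horn_one t.1).1 t.2).symm)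
  refine ⟨l, IsPushout.inr_desc _ _ _ _, ?_⟩
  refine SSet.hom_ext fun n => ?_
  ext x
  exact congr(($((SSet.Subcomplex.unionProd.isPushout T (Λ[1, ε] : SSet.Subcomplex.{w} _)).inl_desc
    (fst _ _ ≫ b) a _)).app n (x, ⟨((cylinderEnd ε A).app n x).2, (mem_horn_one _).2 rfl⟩))

/-- A homotopy on `T` and extensions of its two ends to `A` define a map on the pushout product. -/
theorem exists_unionProd_boundary_desc (a : (T : SSet) ⊗ Δ[1] ⟶ Z) (b : Fin 2 → (A ⟶ Z))
    (h : ∀ ε, T.ι ≫ b ε = cylinderEnd ε _ ≫ a) : ∃ l : (T.unionProd ∂Δ[1] : SSet) ⟶ Z,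
      SSet.Subcomplex.unionProd.ι₂ _ _ ≫ l = a ∧
        ∀ ε, unionProdEnd T _ ε (horn_one_le_boundary ε) ≫ l = b ε := by
  classical
  have hval {n : SimplexCategoryᵒᵖ} (t : (∂Δ[1] : SSet).obj n) {ε : Fin 2}
      (hε : t.1 = ((SSet.const (X := Δ[1]) (SSet.stdSimplex.obj₀Equiv.symm ε) :
        Δ[1] ⟶ Δ[1])).app n t.1) : level t.1 0 = ε := by
    rw [hε]
    rfl
  let b' : A ⊗ (∂Δ[1] : SSet) ⟶ Z :=
    { app := fun n => ↾fun x => (b (level x.2.1 0)).app n x.1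
      naturality := fun n m g => by
        ext ⟨x, t⟩
        obtain ⟨ε, hε⟩ := (mem_boundary_one t.1).1 t.2
        have h1 := hval t hε
        have h2 := hval ((∂Δ[1] : SSet).map g t) (ε := ε) (by
          refine (congrArg (Δ[1].map g) hε).trans ?_
          rfl)
        change (b (level ((∂Δ[1] : SSet).map g t).1 0)).app m (A.map g x) =
          Z.map g ((b (level t.1 0)).app n x)
        rw [h1, h2, NatTrans.naturality_apply] }
  let l := (SSet.Subcomplex.unionProd.isPushout T (∂Δ[1] : SSet.Subcomplex.{w} _)).desc
    b' a (by
      refine SSet.hom_ext fun n => ?_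
      ext ⟨x, t⟩
      obtain ⟨ε, hε⟩ := (mem_boundary_one t.1).1 t.2
      have h1 := hval t hε
      change (b (level t.1 0)).app n x.1 = a.app n (x, t.1)
      rw [h1]
      refine congr(($(h ε)).app n x).trans (congrArg (a.app n) (Prod.ext rfl ?_))
      exact hε.symm)
  refine ⟨l, IsPushout.inr_desc _ _ _ _, fun ε => ?_⟩
  refine SSet.hom_ext fun n => ?_
  ext x
  exact congr(($((SSet.Subcomplex.unionProd.isPushout T (∂Δ[1] : SSet.Subcomplex.{w} _)).inl_desc
    b' a _)).app n (x, ⟨((cylinderEnd ε A).app n x).2, (mem_boundary_one _).2 ⟨ε, rfl⟩⟩))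

end UnionProd

end HigherGpd

namespace HigherGpd

/-! ### Path presheaves -/

section PathPresheaf

variable {E : Type u} [Category.{v} E]

/-- The path space of a simplicial presheaf. -/
noncomputable def pathPresheaf : (Eᵒᵖ ⥤ SSet.{w}) ⥤ (Eᵒᵖ ⥤ SSet.{w}) :=
  (Functor.whiskeringRight _ _ _).obj pathSSet

/-- Evaluation of paths at one of the two ends of the interval. -/
noncomputable def pathEnd (ε : Fin 2) (X : Eᵒᵖ ⥤ SSet.{w}) : pathPresheaf.obj X ⟶ X where
  app U := evalEnd ε (X.obj U)
  naturality _ _ _ := rfl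

/-- The constant paths. -/
noncomputable def pathConst (X : Eᵒᵖ ⥤ SSet.{w}) : X ⟶ pathPresheaf.obj X where
  app U := constPath (X.obj U)
  naturality _ _ _ := (constPath_naturality _).symm

theorem map_pathEnd (ε : Fin 2) {X Y : Eᵒᵖ ⥤ SSet.{w}} (f : X ⟶ Y) :
    pathPresheaf.map f ≫ pathEnd ε Y = pathEnd ε X ≫ f :=
  rfl

theorem pathConst_map {X Y : Eᵒᵖ ⥤ SSet.{w}} (f : X ⟶ Y) :
    pathConst X ≫ pathPresheaf.map f = f ≫ pathConst Y := by
  ext U : 2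
  exact constPath_naturality _

theorem pathConst_pathEnd (ε : Fin 2) (X : Eᵒᵖ ⥤ SSet.{w}) :
    pathConst X ≫ pathEnd ε X = 𝟙 X := by
  ext U : 2
  exact constPath_evalEnd ε _

/-- The subcomplex `K` of the interval consists of the ends in `s`. -/
structure IsEnds (K : (Δ[1] : SSet.{w}).Subcomplex) (s : Set (Fin 2)) : Prop where
  le (ε : Fin 2) (hε : ε ∈ s) : Λ[1, ε] ≤ K
  hom_ext {A Z : SSet.{w}} (T : A.Subcomplex) (l l' : (T.unionProd K : SSet) ⟶ Z)
    (h₁ : SSet.Subcomplex.unionProd.ι₂ _ _ ≫ l = SSet.Subcomplex.unionProd.ι₂ _ _ ≫ l')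
    (h₂ : ∀ ε (hε : ε ∈ s), unionProdEnd T _ ε (le ε hε) ≫ l =
      unionProdEnd T _ ε (le ε hε) ≫ l') : l = l'
  exists_desc {A Z : SSet.{w}} (T : A.Subcomplex) (a : (T : SSet) ⊗ Δ[1] ⟶ Z)
    (b : ∀ ε ∈ s, (A ⟶ Z)) (h : ∀ ε hε, T.ι ≫ b ε hε = cylinderEnd ε _ ≫ a) :
    ∃ l : (T.unionProd K : SSet) ⟶ Z, SSet.Subcomplex.unionProd.ι₂ _ _ ≫ l = a ∧
      ∀ ε hε, unionProdEnd T _ ε (le ε hε) ≫ l = b ε hε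

theorem isEnds_horn (ε : Fin 2) : IsEnds.{w} Λ[1, ε] {ε} where
  le := by rintro _ rfl; exact le_rfl
  hom_ext T l l' h₁ h₂ := unionProd_horn_hom_ext h₁ (h₂ ε rfl)
  exists_desc T a b h := by
    obtain ⟨l, h₁, h₂⟩ := exists_unionProd_horn_desc a (b ε rfl) (h ε rfl)
    exact ⟨l, h₁, by rintro _ rfl; exact h₂⟩

theorem isEnds_boundary : IsEnds.{w} ∂Δ[1] Set.univ where
  le ε _ := horn_one_le_boundary ε
  hom_ext T l l' h₁ h₂ := unionProd_boundary_hom_ext h₁ fun ε => h₂ ε trivial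
  exists_desc T a b h := by
    obtain ⟨l, h₁, h₂⟩ := exists_unionProd_boundary_desc a (fun ε => b ε trivial)
      fun ε => h ε trivial
    exact ⟨l, h₁, fun ε _ => h₂ ε⟩

variable {S : MorphismProperty E} {X Y G : Eᵒᵖ ⥤ SSet.{w}}

/-- Lifts of `T ⟶ A` against the gap morphism from `X^I` to the presheaf `G` of paths in `Y` with
lifts of the ends in `s` to `X` correspond to lifts of a pushout product against `X ⟶ Y`. -/
theorem LiftCover.path_gap {K : (Δ[1] : SSet.{w}).Subcomplex} {s : Set (Fin 2)} (hK : IsEnds K s)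
    {A : SSet.{w}} {T : A.Subcomplex} {f : X ⟶ Y} (h : LiftCover S (T.unionProd K).ι f)
    (γ : X ⋙ pathSSet ⟶ G) (p : ∀ ε ∈ s, (G ⟶ X)) (q : G ⟶ Y ⋙ pathSSet)
    (hpq : ∀ ε hε, p ε hε ≫ f = q ≫ pathEnd ε Y)
    (hp : ∀ ε hε, γ ≫ p ε hε = pathEnd ε X) (hq : γ ≫ q = Functor.whiskerRight f pathSSet)
    (hext : ∀ (U : Eᵒᵖ) (l l' : A ⟶ G.obj U), (∀ ε hε, l ≫ (p ε hε).app U = l' ≫ (p ε hε).app U) →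
      l ≫ q.app U = l' ≫ q.app U → l = l') : LiftCover S T.ι γ := by
  have hpq' (ε hε U) : (p ε hε).app U ≫ f.app U = q.app U ≫ evalEnd ε (Y.obj U) :=
    congr(($(hpq ε hε)).app U)
  have hp' (ε hε U) : γ.app U ≫ (p ε hε).app U = evalEnd ε (X.obj U) :=
    congr(($(hp ε hε)).app U)
  have hq' (U) : γ.app U ≫ q.app U = pathSSet.map (f.app U) := congr(($hq).app U)
  have hdesc (U) (c : (squares T.ι γ).obj U) :=
    hK.exists_desc T (pathHomEquiv _ _ c.1.1) (fun ε hε => c.1.2 ≫ (p ε hε).app U) (by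
      intro ε hε
      rw [← comp_evalEnd, ← hp' ε hε]
      exact (congr($(c.2) ≫ (p ε hε).app U)).symm)
  choose d hd₁ hd₂ using hdesc
  -- by adjunction, `Hom(A, X^I) ⟶ squares T.ι γ` is a base change of
  -- `Hom(A × Δ[1], X) ⟶ squares (T.unionProd K).ι f`
  refine RelCover.of_cartesian h
    { app := fun U => ↾fun l => pathHomEquiv A (X.obj U) l
      naturality := fun _ _ _ => rfl }
    { app := fun U => ↾fun c => ⟨(d U c, pathHomEquiv _ _ (c.1.2 ≫ q.app U)), ?_⟩
      naturality := fun U V g => ?_ } ?_ ?_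
  · apply hK.hom_ext
    · rw [reassoc_of% hd₁]
      change _ = (T.ι ▷ _) ≫ pathHomEquiv _ _ (c.1.2 ≫ q.app U)
      rw [← pathHomEquiv_comp_left, ← pathHomEquiv_comp_right, ← hq']
      exact congr(pathHomEquiv _ _ ($(c.2) ≫ q.app U))
    · intro ε hε
      refine (congr($(hd₂ U c ε hε) ≫ f.app U)).trans ?_
      refine (Category.assoc _ _ _).trans ((congr(c.1.2 ≫ $(hpq' ε hε U))).trans ?_)
      change _ = cylinderEnd ε _ ≫ pathHomEquiv _ _ (c.1.2 ≫ q.app U)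
      rw [← comp_evalEnd]
      exact (Category.assoc _ _ _).symm
  · ext c
    refine squares_ext ?_ ?_
    · apply hK.hom_ext
      · exact (hd₁ _ _).trans (congr($(hd₁ U c) ≫ X.map g)).symm
      · intro ε hε
        refine (hd₂ _ _ _ hε).trans (Eq.trans ?_ (congr($(hd₂ U c ε hε) ≫ X.map g)).symm)
        change (c.1.2 ≫ G.map g) ≫ _ = _
        simp
    · change pathHomEquiv _ _ ((c.1.2 ≫ G.map g) ≫ q.app V) = pathHomEquiv _ _ (c.1.2 ≫ q.app U) ≫ _
      rw [← pathHomEquiv_comp_right, Category.assoc, Category.assoc]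
      congr 2
      exact q.naturality g
  · ext U l
    refine squares_ext ?_ ?_
    · apply hK.hom_ext
      · exact (pathHomEquiv_comp_left _ _).symm.trans (hd₁ U ((toSquares T.ι γ).app U l)).symm
      · intro ε hε
        refine Eq.trans ?_ (hd₂ U ((toSquares T.ι γ).app U l) ε hε).symm
        change cylinderEnd ε _ ≫ pathHomEquiv _ _ l = (l ≫ γ.app U) ≫ (p ε hε).app U
        rw [← comp_evalEnd, Category.assoc, hp']
    · change pathHomEquiv _ _ l ≫ f.app U = pathHomEquiv _ _ ((l ≫ γ.app U) ≫ q.app U)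
      rw [← pathHomEquiv_comp_right, Category.assoc, hq']
  · intro U c l hl
    obtain ⟨h1, h2⟩ := (toSquares_app_eq_iff l _).1 hl
    refine ⟨(pathHomEquiv _ _).symm l, ⟨(toSquares_app_eq_iff _ _).2 ⟨?_, ?_⟩,
      (pathHomEquiv _ _).apply_symm_apply l⟩, ?_⟩
    · apply (pathHomEquiv _ _).injective
      rw [pathHomEquiv_comp_left, Equiv.apply_symm_apply, ← hd₁ U c]
      exact congr(SSet.Subcomplex.unionProd.ι₂ _ _ ≫ $h1)
    · apply hext
      · intro ε hε
        rw [Category.assoc, hp', comp_evalEnd, Equiv.apply_symm_apply, ← hd₂ U c ε hε]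
        exact congr(unionProdEnd T _ ε (hK.le ε hε) ≫ $h1)
      · rw [Category.assoc, hq']
        apply (pathHomEquiv _ _).injective
        rw [pathHomEquiv_comp_right, Equiv.apply_symm_apply]
        exact h2
    · rintro l' ⟨-, rfl⟩
      exact ((pathHomEquiv _ _).symm_apply_apply l').symm

/-- Kan fibrations of simplicial presheaves. -/
def kan (S : MorphismProperty E) : MorphismProperty (Eᵒᵖ ⥤ SSet.{w}) :=
  fun _ _ f => ∀ (n : ℕ) (k : Fin (n + 2)), LiftCover S (Λ[n + 1, k] : SSet.Subcomplex.{w} _).ι f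

/-- Hypercovers of simplicial presheaves. -/
def hyper (S : MorphismProperty E) : MorphismProperty (Eᵒᵖ ⥤ SSet.{w}) :=
  fun _ _ f => ∀ n : ℕ, LiftCover S (∂Δ[n] : SSet.Subcomplex.{w} _).ι f

theorem hyper_le_kan (hS : IsCoverClass S) :
    (hyper S : MorphismProperty (Eᵒᵖ ⥤ SSet.{w})) ≤ kan S :=
  fun _ _ _ h n k => LiftCover.horn_of_boundary hS n k h

theorem kan_isMultiplicative (hS : IsCoverClass S) :
    (kan S : MorphismProperty (Eᵒᵖ ⥤ SSet.{w})).IsMultiplicative where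
  id_mem _ _ _ := LiftCover.of_isIso_right hS _ _
  comp_mem _ _ hf hg n k := (hf n k).comp_right hS (hg n k)

theorem hyper_isMultiplicative (hS : IsCoverClass S) :
    (hyper S : MorphismProperty (Eᵒᵖ ⥤ SSet.{w})).IsMultiplicative where
  id_mem _ _ := LiftCover.of_isIso_right hS _ _
  comp_mem _ _ hf hg n := (hf n).comp_right hS (hg n)

theorem kan_isStableUnderBaseChange :
    (kan S : MorphismProperty (Eᵒᵖ ⥤ SSet.{w})).IsStableUnderBaseChange where
  of_isPullback sq h n k := (h n k).of_isPullback sq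

theorem hyper_isStableUnderBaseChange :
    (hyper S : MorphismProperty (Eᵒᵖ ⥤ SSet.{w})).IsStableUnderBaseChange where
  of_isPullback sq h n := (h n).of_isPullback sq

/-- The gap morphism from `X^I` to `X ×_Y Y^I` is a hypercover if `X ⟶ Y` is a Kan fibration. -/
theorem hyper_path_end_gap (hS : IsCoverClass S) {f : X ⟶ Y} (hf : kan S f) (ε : Fin 2)
    {p : G ⟶ X} {q : G ⟶ pathPresheaf.obj Y} (sq : IsPullback p q f (pathEnd ε Y))
    (γ : pathPresheaf.obj X ⟶ G) (hp : γ ≫ p = pathEnd ε X)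
    (hq : γ ≫ q = pathPresheaf.map f) : hyper S γ := by
  intro n
  refine LiftCover.path_gap (isEnds_horn ε) (f := f) ?_ γ (fun _ _ => p) q ?_ ?_ hq ?_
  · obtain rfl | rfl : ε = 0 ∨ ε = 1 := by omega
    · exact LiftCover.boundary_prism_zero hS n fun m k => hf m k
    · exact LiftCover.boundary_prism_one hS n fun m k => hf m k
  · rintro _ rfl
    exact sq.w
  · rintro _ rfl
    exact hp
  · intro U l l' h1 h2
    exact (sq.map ((evaluation _ _).obj U)).hom_ext (h1 ε rfl) h2

/-- A map to the presheaf `G` of paths in `Y` with lifts of both ends to `X` is determined by the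
path and the two lifts. -/
theorem pair_hom_ext {p : G ⟶ X ⊗ X} {q : G ⟶ pathPresheaf.obj Y} {f : X ⟶ Y}
    (sq : IsPullback p q (f ⊗ₘ f) (lift (pathEnd 0 Y) (pathEnd 1 Y)))
    {A : SSet.{w}} (U : Eᵒᵖ) (l l' : A ⟶ G.obj U)
    (h₀ : l ≫ (p ≫ fst _ _).app U = l' ≫ (p ≫ fst _ _).app U)
    (h₁ : l ≫ (p ≫ snd _ _).app U = l' ≫ (p ≫ snd _ _).app U)
    (h : l ≫ q.app U = l' ≫ q.app U) : l = l' := by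
  refine (sq.map ((evaluation _ _).obj U)).hom_ext ?_ h
  apply CartesianMonoidalCategory.hom_ext (X := X.obj U) (Y := X.obj U)
  · exact (Category.assoc _ _ _).trans (h₀.trans (Category.assoc _ _ _).symm)
  · exact (Category.assoc _ _ _).trans (h₁.trans (Category.assoc _ _ _).symm)

/-- Lifts of `T ⟶ A` against the gap morphism from `X^I` to the presheaf of paths in `Y` with lifts
of both ends are lifts of the pushout product with `∂Δ[1] ⟶ Δ[1]` against `X ⟶ Y`. -/
theorem path_boundary_gap {A : SSet.{w}} {T : A.Subcomplex} {f : X ⟶ Y}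
    (h : LiftCover S (T.unionProd ∂Δ[1]).ι f)
    {p : G ⟶ X ⊗ X} {q : G ⟶ pathPresheaf.obj Y}
    (sq : IsPullback p q (f ⊗ₘ f) (lift (pathEnd 0 Y) (pathEnd 1 Y)))
    (γ : pathPresheaf.obj X ⟶ G)
    (hp : γ ≫ p = lift (pathEnd 0 X) (pathEnd 1 X))
    (hq : γ ≫ q = pathPresheaf.map f) : LiftCover S T.ι γ := by
  refine LiftCover.path_gap isEnds_boundary h γ
    (fun ε _ => if ε = 0 then p ≫ fst _ _ else p ≫ snd _ _) q ?_ ?_ hq ?_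
  · intro ε _
    obtain rfl | rfl : ε = 0 ∨ ε = 1 := by omega
    · have := congr($(sq.w) ≫ fst _ _)
      exact show (p ≫ fst _ _) ≫ f = q ≫ pathEnd 0 Y by simpa using this
    · have := congr($(sq.w) ≫ snd _ _)
      exact show (p ≫ snd _ _) ≫ f = q ≫ pathEnd 1 Y by simpa using this
  · intro ε _
    obtain rfl | rfl : ε = 0 ∨ ε = 1 := by omega
    · have := congr($hp ≫ fst _ _)
      exact show γ ≫ p ≫ fst _ _ = pathEnd 0 X by simpa using this
    · have := congr($hp ≫ snd _ _)
      exact show γ ≫ p ≫ snd _ _ = pathEnd 1 X by simpa using this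
  · intro U l l' h1 h2
    exact pair_hom_ext sq U l l' (by simpa using h1 0 trivial) (by simpa using h1 1 trivial) h2

/-- The gap morphism from `X^I` to the presheaf of paths in `Y` with lifts of both ends is a Kan
fibration if `X ⟶ Y` is one. -/
theorem kan_path_gap (hS : IsCoverClass S) {f : X ⟶ Y} (hf : kan S f)
    {p : G ⟶ X ⊗ X} {q : G ⟶ pathPresheaf.obj Y}
    (sq : IsPullback p q (f ⊗ₘ f) (lift (pathEnd 0 Y) (pathEnd 1 Y)))
    (γ : pathPresheaf.obj X ⟶ G)
    (hp : γ ≫ p = lift (pathEnd 0 X) (pathEnd 1 X))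
    (hq : γ ≫ q = pathPresheaf.map f) : kan S γ :=
  fun n k => path_boundary_gap (LiftCover.horn_prism hS n k fun m k => hf m k) sq γ hp hq

/-- The gap morphism from `X^I` to the presheaf of paths in `Y` with lifts of both ends is a
hypercover if `X ⟶ Y` is one. -/
theorem hyper_path_gap (hS : IsCoverClass S) {f : X ⟶ Y} (hf : hyper S f)
    {p : G ⟶ X ⊗ X} {q : G ⟶ pathPresheaf.obj Y}
    (sq : IsPullback p q (f ⊗ₘ f) (lift (pathEnd 0 Y) (pathEnd 1 Y)))
    (γ : pathPresheaf.obj X ⟶ G)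
    (hp : γ ≫ p = lift (pathEnd 0 X) (pathEnd 1 X))
    (hq : γ ≫ q = pathPresheaf.map f) : hyper S γ :=
  fun n => path_boundary_gap (LiftCover.boundary_prism_of_boundary hS n hf) sq γ hp hq

end PathPresheaf

end HigherGpd

namespace HigherGpd

/-! ### Cancellation of hypercovers -/

section Cancel

variable {E : Type u} [Category.{v} E] {S : MorphismProperty E} {X Y Z : Eᵒᵖ ⥤ SSet.{w}}

/-- The simplicial presheaf `X` is levelwise representable. -/
def LevelRep (X : Eᵒᵖ ⥤ SSet.{w}) : Prop := ∀ n : ℕ, IsRep (homPresheaf Δ[n] X)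

/-- Postcomposition with a morphism of simplicial presheaves. -/
abbrev homPresheafPost (A : SSet.{w}) (f : X ⟶ Y) : homPresheaf A X ⟶ homPresheaf A Y :=
  Functor.whiskerRight f (coyoneda.obj (op A))

/-- If `A` is attached to the initial object, lifts against `f` are the fibres of `Hom(A, f)`. -/
theorem LiftCover.relCover_post {A I : SSet.{w}} (hI : IsInitial I) {i : I ⟶ A} {f : X ⟶ Y}
    (h : LiftCover S i f) : RelCover S (homPresheafPost A f) := by
  refine RelCover.of_cartesian h (𝟙 _)
    { app := fun U => ↾fun y => ⟨(hI.to _, y), hI.hom_ext _ _⟩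
      naturality := fun _ _ _ => by
        ext y
        exact squares_ext (hI.hom_ext _ _) rfl } ?_ ?_
  · ext U l
    exact squares_ext (hI.hom_ext _ _) rfl
  · intro _ y l hl
    exact ⟨l, ⟨((toSquares_app_eq_iff _ _).1 hl).2, rfl⟩, fun l' h' => h'.2⟩

/-- The presheaf of squares from `i : A ⟶ B` to `f` is a base change of `Hom(A, f)`. -/
theorem RelCover.squares_snd {A B : SSet.{w}} (i : A ⟶ B) {f : X ⟶ Y}
    (h : RelCover S (homPresheafPost A f)) :
    RelCover S (P := squares i f) (Q := homPresheaf B Y)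
      { app := fun _ => ↾fun p => p.1.2, naturality := fun _ _ _ => rfl } := by
  refine RelCover.of_cartesian h
    { app := fun _ => ↾fun p => p.1.1, naturality := fun _ _ _ => rfl } (homPresheafMap i Y) ?_ ?_
  · ext _ p
    exact p.2
  · intro _ q p hp
    refine ⟨⟨(p, q), hp⟩, ⟨rfl, rfl⟩, ?_⟩
    rintro p' ⟨rfl, rfl⟩
    rfl

/-- Hypercovers consist of covers in each dimension. -/
theorem hyper.relCover_post (hS : IsCoverClass S) {f : X ⟶ Y} (hf : hyper S f) (n : ℕ) :
    RelCover S (homPresheafPost Δ[n] f) :=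
  (LiftCover.bot_simplex hS n hf).relCover_post SSet.Subcomplex.isInitialBot

theorem hyper.levelRep (hS : IsCoverClass S) {f : X ⟶ Y} (hf : hyper S f) (hY : LevelRep Y) :
    LevelRep X :=
  fun n => (hf.relCover_post hS n).isRep (hY n)

/-- The presheaf of squares from a boundary to `f` is representable if `f` is a hypercover in
lower dimensions. -/
theorem isRep_squares_boundary (hS : IsCoverClass S) {f : X ⟶ Y} {n : ℕ}
    (hf : ∀ m < n, LiftCover S (∂Δ[m] : SSet.Subcomplex.{w} _).ι f)
    (hY : IsRep (homPresheaf Δ[n] Y)) :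
    IsRep (squares (∂Δ[n] : SSet.Subcomplex.{w} _).ι f) :=
  (((LiftCover.bot_boundary hS n hf).relCover_post
    SSet.Subcomplex.isInitialBot).squares_snd _).isRep hY

/-- Hypercovers inherit the right cancellation property of covers. -/
theorem hyper.cancel (hS : IsCoverClass S) {u : X ⟶ Y} {v : Y ⟶ Z} (hu : hyper S u)
    (huv : hyper S (u ≫ v)) (hY : LevelRep Y) (hZ : LevelRep Z) : hyper S v := by
  intro n
  induction n using Nat.strong_induction_on with
  | _ n ih =>
  -- `ρ` is a base change of `X^{∂Δ[n]} ⟶ Y^{∂Δ[n]}`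
  let ρ : squares (∂Δ[n] : SSet.Subcomplex.{w} _).ι (u ≫ v) ⟶
      squares (∂Δ[n] : SSet.Subcomplex.{w} _).ι v :=
    { app := fun U => ↾fun p => ⟨(p.1.1 ≫ u.app U, p.1.2), (Category.assoc _ _ _).trans p.2⟩
      naturality := fun U V k => by
        ext p
        refine squares_ext ?_ rfl
        change (p.1.1 ≫ X.map k) ≫ u.app V = (p.1.1 ≫ u.app U) ≫ Y.map k
        simp }
  have hρ : RelCover S ρ := by
    refine RelCover.of_cartesian ((LiftCover.bot_boundary hS n fun m _ => hu m).relCover_post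
        SSet.Subcomplex.isInitialBot)
      { app := fun U => ↾fun p => p.1.1, naturality := fun _ _ _ => rfl }
      { app := fun U => ↾fun p => p.1.1, naturality := fun _ _ _ => rfl } rfl ?_
    intro U q p hp
    change p ≫ u.app U = q.1.1 at hp
    refine ⟨⟨(p, q.1.2), ?_⟩, ⟨squares_ext hp rfl, rfl⟩, ?_⟩
    · exact (Category.assoc _ _ _).symm.trans ((congr($hp ≫ v.app U)).trans q.2)
    · rintro p' ⟨h, rfl⟩
      exact squares_ext rfl congr(($h).1.2)
  have hcomp : homPresheafPost Δ[n] u ≫ toSquares (∂Δ[n] : SSet.Subcomplex.{w} _).ι v =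
      toSquares (∂Δ[n] : SSet.Subcomplex.{w} _).ι (u ≫ v) ≫ ρ := by
    ext U l
    exact squares_ext (Category.assoc _ _ _).symm (Category.assoc _ _ _)
  refine RelCover.cancel hS (hu.relCover_post hS n) ?_ (hY n)
    (isRep_squares_boundary hS ih (hZ n))
  rw [hcomp]
  exact RelCover.comp hS (huv n) hρ

end Cancel

/-! ### Weak equivalences of simplicial presheaves -/

section Weak

variable {E : Type u} [Category.{v} E] {S : MorphismProperty E} {X Y Z : Eᵒᵖ ⥤ SSet.{w}}

noncomputable instance : PreservesLimitsOfSize.{0, 0} pathSSet.{w} :=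
  inferInstanceAs (PreservesLimitsOfSize.{0, 0}
    (yoneda ⋙ (Functor.whiskeringLeft _ _ _).obj cylinder.op))

noncomputable instance :
    PreservesFiniteLimits (pathPresheaf : (Eᵒᵖ ⥤ SSet.{w}) ⥤ (Eᵒᵖ ⥤ SSet.{w})) :=
  inferInstanceAs (PreservesFiniteLimits ((Functor.whiskeringRight _ _ _).obj pathSSet))

/-- The mapping path space `X ×_Y Y^I`. -/
noncomputable abbrev mapPath (f : X ⟶ Y) : Eᵒᵖ ⥤ SSet.{w} :=
  pullback f (pathEnd 0 Y)

/-- The projection `X ×_Y Y^I ⟶ X`. -/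
noncomputable abbrev mapPathFst (f : X ⟶ Y) : mapPath f ⟶ X := pullback.fst _ _

/-- The projection `X ×_Y Y^I ⟶ Y^I`. -/
noncomputable abbrev mapPathSnd (f : X ⟶ Y) : mapPath f ⟶ pathPresheaf.obj Y := pullback.snd _ _

/-- Evaluation `X ×_Y Y^I ⟶ Y` at the end `1`. -/
noncomputable abbrev mapPathEnd (f : X ⟶ Y) : mapPath f ⟶ Y :=
  mapPathSnd f ≫ pathEnd 1 Y

/-- The weak equivalences of simplicial presheaves. -/
def weak (S : MorphismProperty E) : MorphismProperty (Eᵒᵖ ⥤ SSet.{w}) :=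
  fun _ _ f => hyper S (mapPathEnd f)

/-- A simplicial presheaf that is a levelwise representable Kan complex. -/
structure IsKanRep (S : MorphismProperty E) (X : Eᵒᵖ ⥤ SSet.{w}) : Prop where
  levelRep : LevelRep X
  kan_toUnit : kan S (toUnit X)

instance isIso_pathEnd_unit (ε : Fin 2) :
    IsIso (pathEnd ε (𝟙_ (Eᵒᵖ ⥤ SSet.{w}))) := by
  refine ⟨pathConst _, ?_, toUnit_unique _ _⟩
  ext U n x
  exact toUnit_unique (C := SSet.{w}) _ _

/-- The evaluations `X^I ⟶ X` are hypercovers: they are gap morphisms of the fibration from `X` to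
the terminal object. -/
theorem IsKanRep.hyper_eval (hS : IsCoverClass S) (hX : IsKanRep S X) (ε : Fin 2) :
    hyper S (pathEnd ε X) :=
  hyper_path_end_gap hS hX.kan_toUnit ε (p := 𝟙 X)
    (q := toUnit X ≫ inv (pathEnd ε (𝟙_ _)))
    (IsPullback.of_horiz_isIso ⟨by simp⟩) _ (by simp)
    (by
      rw [← cancel_mono (pathEnd ε (𝟙_ _))]
      exact toUnit_unique _ _)

/-- The evaluation `X^I ⟶ X × X` is a Kan fibration: it is a gap morphism of the fibration from `X`
to the terminal object. -/
theorem IsKanRep.kan_lift_eval (hS : IsCoverClass S) (hX : IsKanRep S X) :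
    kan S (lift (pathEnd 0 X) (pathEnd 1 X)) := by
  have : IsIso (lift (pathEnd 0 (𝟙_ (Eᵒᵖ ⥤ SSet.{w})))
      (pathEnd 1 (𝟙_ (Eᵒᵖ ⥤ SSet.{w})))) := by
    refine ⟨fst _ _ ≫ inv (pathEnd 0 _), by simp, ?_⟩
    apply CartesianMonoidalCategory.hom_ext <;> exact toUnit_unique _ _
  refine kan_path_gap hS hX.kan_toUnit (p := 𝟙 _)
    (q := (toUnit X ⊗ₘ toUnit X) ≫ inv (lift (pathEnd 0 (𝟙_ (Eᵒᵖ ⥤ SSet.{w})))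
      (pathEnd 1 (𝟙_ (Eᵒᵖ ⥤ SSet.{w}))))) (IsPullback.of_horiz_isIso
      ⟨by apply CartesianMonoidalCategory.hom_ext <;> exact toUnit_unique _ _⟩) _ (by simp) ?_
  rw [← cancel_mono (pathEnd 0 (𝟙_ _))]
  exact toUnit_unique _ _

/-- The source of a fibration with fibrant target is fibrant. -/
theorem IsKanRep.of_kan (hS : IsCoverClass S) {f : X ⟶ Y} (hf : kan S f) (hX : LevelRep X)
    (hY : IsKanRep S Y) : IsKanRep S X :=
  ⟨hX, by
    rw [← toUnit_unique (f ≫ toUnit Y) (toUnit X)]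
    exact (kan_isMultiplicative hS).comp_mem _ _ hf hY.kan_toUnit⟩

theorem hyper_mapPathFst (hS : IsCoverClass S) (f : X ⟶ Y) (hY : IsKanRep S Y) :
    hyper S (mapPathFst f) :=
  hyper_isStableUnderBaseChange.of_isPullback (IsPullback.of_hasPullback f _).flip
    (hY.hyper_eval hS 0)

theorem IsKanRep.mapPath (hS : IsCoverClass S) {f : X ⟶ Y} (hX : IsKanRep S X)
    (hY : IsKanRep S Y) : IsKanRep S (mapPath f) :=
  hX.of_kan hS (hyper_le_kan hS _ (hyper_mapPathFst hS f hY))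
    ((hyper_mapPathFst hS f hY).levelRep hS hX.levelRep)

/-- The acyclic fibrations are the hypercovers: from `X^I` one reaches both `X` and `X ×_Y Y^I` by
a hypercover. -/
theorem kan.weak_iff (hS : IsCoverClass S) {f : X ⟶ Y} (hf : kan S f) (hX : IsKanRep S X)
    (hY : IsKanRep S Y) : weak S f ↔ hyper S f := by
  let γ : pathPresheaf.obj X ⟶ mapPath f :=
    pullback.lift (pathEnd 0 X) (pathPresheaf.map f) (map_pathEnd 0 f).symm
  have hγ : hyper S γ := hyper_path_end_gap hS hf 0 (IsPullback.of_hasPullback _ _) γ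
    (pullback.lift_fst _ _ _) (pullback.lift_snd _ _ _)
  have hcomp : γ ≫ mapPathEnd f = pathEnd 1 X ≫ f := by
    rw [pullback.lift_snd_assoc]
    exact map_pathEnd 1 f
  have := hyper_isMultiplicative hS
  constructor
  · intro h
    refine (hX.hyper_eval hS 1).cancel hS ?_ hX.levelRep hY.levelRep
    rw [← hcomp]
    exact MorphismProperty.comp_mem _ _ _ hγ h
  · intro h
    refine hγ.cancel hS ?_ (hX.mapPath hS hY).levelRep hY.levelRep
    rw [hcomp]
    exact MorphismProperty.comp_mem _ _ _ (hX.hyper_eval hS 1) h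

/-- Given `u : V ⟶ Z` and its mapping path space `T`, a pair of the base point and the end point
of a path exhibits `T` as pulled back from `Z^I ⟶ Z × Z`. -/
theorem isPullback_lift_eval {V T : Eᵒᵖ ⥤ SSet.{w}} {u : V ⟶ Z} {a : T ⟶ V}
    {b : T ⟶ pathPresheaf.obj Z} (sq : IsPullback a b u (pathEnd 0 Z)) :
    IsPullback (lift a (b ≫ pathEnd 1 Z)) b (u ⊗ₘ 𝟙 Z)
      (lift (pathEnd 0 Z) (pathEnd 1 Z)) := by
  refine ⟨⟨by apply CartesianMonoidalCategory.hom_ext <;> simp [sq.w]⟩,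
    ⟨PullbackCone.IsLimit.mk _ (fun s => sq.lift (s.fst ≫ fst _ _) s.snd ?_) ?_ ?_ ?_⟩⟩
  · simpa using congr($(s.condition) ≫ fst _ _)
  · intro s
    apply CartesianMonoidalCategory.hom_ext
    · simp
    · simpa using congr($(s.condition) ≫ snd _ _).symm
  · simp
  · intro s m h1 h2
    apply sq.hom_ext
    · simp [← h1]
    · simpa using h2

/-- Homotopy invariance of mapping path spaces: along a homotopy `h : V ⟶ Z^I`, the mapping path
spaces of the two ends are related by a span of hypercovers over `Z`. -/
theorem exists_span_of_homotopy (hS : IsCoverClass S) (hZ : IsKanRep S Z)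
    {V T₀ T₁ : Eᵒᵖ ⥤ SSet.{w}} (h : V ⟶ pathPresheaf.obj Z)
    {a₀ : T₀ ⟶ V} {b₀ : T₀ ⟶ pathPresheaf.obj Z}
    (sq₀ : IsPullback a₀ b₀ (h ≫ pathEnd 0 Z) (pathEnd 0 Z))
    {a₁ : T₁ ⟶ V} {b₁ : T₁ ⟶ pathPresheaf.obj Z}
    (sq₁ : IsPullback a₁ b₁ (h ≫ pathEnd 1 Z) (pathEnd 0 Z)) :
    ∃ (R : Eᵒᵖ ⥤ SSet.{w}) (r₀ : R ⟶ T₀) (r₁ : R ⟶ T₁), hyper S r₀ ∧ hyper S r₁ ∧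
      r₀ ≫ b₀ ≫ pathEnd 1 Z = r₁ ≫ b₁ ≫ pathEnd 1 Z := by
  -- the path in `Z × Z` which is `h` in the first and constant in the second coordinate
  let k : V ⊗ Z ⟶ pathPresheaf.obj (Z ⊗ Z) :=
    (h ⊗ₘ pathConst Z) ≫ inv (CartesianMonoidalCategory.prodComparison pathPresheaf Z Z)
  have hk (ε : Fin 2) : k ≫ pathEnd ε (Z ⊗ Z) =
      (h ≫ pathEnd ε Z) ⊗ₘ 𝟙 Z := by
    have h1 : pathEnd ε (Z ⊗ Z) ≫ fst _ _ = pathPresheaf.map (fst _ _) ≫ _ :=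
      (map_pathEnd ε _).symm
    have h2 : pathEnd ε (Z ⊗ Z) ≫ snd _ _ = pathPresheaf.map (snd _ _) ≫ _ :=
      (map_pathEnd ε _).symm
    apply CartesianMonoidalCategory.hom_ext
    · rw [Category.assoc, h1]
      simp [k]
    · rw [Category.assoc, h2]
      simp [k, pathConst_pathEnd]
  let p : pathPresheaf.obj Z ⟶ Z ⊗ Z := lift (pathEnd 0 Z) (pathEnd 1 Z)
  have hp : kan S p := hZ.kan_lift_eval hS
  have key (ε : Fin 2) {T : Eᵒᵖ ⥤ SSet.{w}} {a : T ⟶ V} {b : T ⟶ pathPresheaf.obj Z}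
      (sq : IsPullback a b (h ≫ pathEnd ε Z) (pathEnd 0 Z)) :
      ∃ r : pullback k (pathPresheaf.map p) ⟶ T, hyper S r ∧
        r ≫ b ≫ pathEnd 1 Z = pullback.fst _ _ ≫ snd _ _ := by
    have sq' := isPullback_lift_eval sq
    rw [← hk] at sq'
    let G := IsPullback.of_hasPullback (pathEnd ε (Z ⊗ Z)) p
    obtain ⟨t, ht₁, ht₂⟩ : ∃ t : T ⟶ pullback (pathEnd ε (Z ⊗ Z)) p,
        t ≫ pullback.fst _ _ = lift a (b ≫ pathEnd 1 Z) ≫ k ∧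
        t ≫ pullback.snd _ _ = b :=
      ⟨G.lift _ b (by rw [Category.assoc]; exact sq'.w), G.lift_fst _ _ _, G.lift_snd _ _ _⟩
    have sqt : IsPullback t (lift a (b ≫ pathEnd 1 Z)) (pullback.fst _ _) k := by
      refine IsPullback.of_right (h₁₂ := pullback.snd (pathEnd ε (Z ⊗ Z)) p)
        (v₁₃ := p) (h₂₂ := pathEnd ε (Z ⊗ Z)) ?_ ht₁ G.flip
      rw [ht₂]
      exact sq'.flip
    let γ : pathPresheaf.obj (pathPresheaf.obj Z) ⟶ pullback (pathEnd ε (Z ⊗ Z)) p :=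
      pullback.lift (pathPresheaf.map p) (pathEnd ε _) (map_pathEnd ε p)
    have hγ : hyper S γ := hyper_path_end_gap hS hp ε G.flip γ
      (pullback.lift_snd _ _ _) (pullback.lift_fst _ _ _)
    have hγ' : γ ≫ pullback.fst _ _ = pathPresheaf.map p := pullback.lift_fst _ _ _
    let r : pullback k (pathPresheaf.map p) ⟶ T := sqt.lift (pullback.snd _ _ ≫ γ)
      (pullback.fst _ _) (by rw [Category.assoc, hγ', pullback.condition])
    have sqr : IsPullback (pullback.snd k (pathPresheaf.map p)) r γ t := by
      refine IsPullback.of_bot (v₂₁ := lift a (b ≫ pathEnd 1 Z))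
        (v₂₂ := pullback.fst (pathEnd ε (Z ⊗ Z)) p) (h₃₁ := k) ?_
        (sqt.lift_fst _ _ _).symm sqt
      rw [hγ', sqt.lift_snd]
      exact (IsPullback.of_hasPullback _ _).flip
    refine ⟨r, hyper_isStableUnderBaseChange.of_isPullback sqr hγ, ?_⟩
    have := congr($(sqt.lift_snd (pullback.snd _ _ ≫ γ) (pullback.fst k (pathPresheaf.map p))
      (by rw [Category.assoc, hγ', pullback.condition])) ≫ snd _ _)
    simpa using this
  obtain ⟨r₀, hr₀, e₀⟩ := key 0 sq₀
  obtain ⟨r₁, hr₁, e₁⟩ := key 1 sq₁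
  exact ⟨_, r₀, r₁, hr₀, hr₁, e₀.trans e₁.symm⟩

/-- Two out of three, if the first morphism is a weak equivalence. -/
theorem weak.comp_iff (hS : IsCoverClass S) {f : X ⟶ Y} {g : Y ⟶ Z} (hf : weak S f)
    (hX : IsKanRep S X) (hY : IsKanRep S Y) (hZ : IsKanRep S Z) :
    weak S (f ≫ g) ↔ weak S g := by
  let h : mapPath f ⟶ pathPresheaf.obj Z := mapPathSnd f ≫ pathPresheaf.map g
  have h₀ : h ≫ pathEnd 0 Z = mapPathFst f ≫ f ≫ g := by
    have : pathPresheaf.map g ≫ pathEnd 0 Z = _ := map_pathEnd 0 g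
    rw [Category.assoc, this, ← reassoc_of% pullback.condition]
  have h₁ : h ≫ pathEnd 1 Z = mapPathEnd f ≫ g := by
    have : pathPresheaf.map g ≫ pathEnd 1 Z = _ := map_pathEnd 1 g
    rw [Category.assoc, this, Category.assoc]
  have sq₀ := (IsPullback.of_hasPullback (mapPathFst f) (mapPathFst (f ≫ g))).flip.paste_horiz
    (IsPullback.of_hasPullback (f ≫ g) (pathEnd 0 Z)).flip
  have sq₁ := (IsPullback.of_hasPullback (mapPathEnd f) (mapPathFst g)).flip.paste_horiz
    (IsPullback.of_hasPullback g (pathEnd 0 Z)).flip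
  rw [← h₀] at sq₀
  rw [← h₁] at sq₁
  obtain ⟨R, r₀, r₁, hr₀, hr₁, hr⟩ := exists_span_of_homotopy hS hZ h sq₀.flip sq₁.flip
  have := hyper_isMultiplicative hS
  have := hyper_isStableUnderBaseChange (S := S)
  have h0 : hyper S (r₀ ≫ pullback.snd (mapPathFst f) (mapPathFst (f ≫ g))) :=
    MorphismProperty.comp_mem _ _ _ hr₀ (MorphismProperty.of_isPullback
      (IsPullback.of_hasPullback (mapPathFst f) (mapPathFst (f ≫ g)))
      (hyper_mapPathFst hS f hY))
  have h1 : hyper S (r₁ ≫ pullback.snd (mapPathEnd f) (mapPathFst g)) :=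
    MorphismProperty.comp_mem _ _ _ hr₁ (MorphismProperty.of_isPullback
      (IsPullback.of_hasPullback (mapPathEnd f) (mapPathFst g)) hf)
  have hr' : (r₀ ≫ pullback.snd (mapPathFst f) (mapPathFst (f ≫ g))) ≫ mapPathEnd (f ≫ g) =
      (r₁ ≫ pullback.snd (mapPathEnd f) (mapPathFst g)) ≫ mapPathEnd g := by
    simpa using hr
  constructor
  · intro hfg
    refine h1.cancel hS ?_ (hY.mapPath hS hZ).levelRep hZ.levelRep
    rw [← hr']
    exact MorphismProperty.comp_mem _ _ _ h0 hfg
  · intro hg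
    refine h0.cancel hS ?_ (hX.mapPath hS hZ).levelRep hZ.levelRep
    rw [hr']
    exact MorphismProperty.comp_mem _ _ _ h1 hg

/-- Two out of three, if the second morphism is a hypercover. -/
theorem weak.of_comp_hyper (hS : IsCoverClass S) {f : X ⟶ Y} {g : Y ⟶ Z} (hg : hyper S g)
    (hfg : weak S (f ≫ g)) : weak S f := by
  -- `G` consists of paths in `Z` with lifts of both ends to `Y`, and `G'` of such paths with a
  -- lift of the initial point to `X`
  let G := pullback (g ⊗ₘ g) (lift (pathEnd 0 Z) (pathEnd 1 Z))
  have sqG : IsPullback (pullback.fst _ _) (pullback.snd _ _) (g ⊗ₘ g)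
    (lift (pathEnd 0 Z) (pathEnd 1 Z)) := IsPullback.of_hasPullback _ _
  let γ : pathPresheaf.obj Y ⟶ G :=
    sqG.lift (lift (pathEnd 0 Y) (pathEnd 1 Y)) (pathPresheaf.map g) (by
      have h0 : pathPresheaf.map g ≫ pathEnd 0 Z = _ := map_pathEnd 0 g
      have h1 : pathPresheaf.map g ≫ pathEnd 1 Z = _ := map_pathEnd 1 g
      apply CartesianMonoidalCategory.hom_ext
      · simpa using h0.symm
      · simpa using h1.symm)
  have hγ : hyper S γ := hyper_path_gap hS hg sqG γ (sqG.lift_fst _ _ _) (sqG.lift_snd _ _ _)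
  let G' := pullback (mapPathEnd (f ≫ g)) g
  have hG' : hyper S (pullback.snd (mapPathEnd (f ≫ g)) g) :=
    hyper_isStableUnderBaseChange.of_isPullback (IsPullback.of_hasPullback _ _) hfg
  have hc : mapPathFst (f ≫ g) ≫ f ≫ g = mapPathSnd (f ≫ g) ≫ pathEnd 0 Z :=
    pullback.condition
  have hc' : pullback.fst (mapPathEnd (f ≫ g)) g ≫ mapPathSnd (f ≫ g) ≫ pathEnd 1 Z =
    pullback.snd _ _ ≫ g := by simpa using pullback.condition (f := mapPathEnd (f ≫ g)) (g := g)
  let t : G' ⟶ G := sqG.lift (lift (pullback.fst _ _ ≫ mapPathFst (f ≫ g) ≫ f) (pullback.snd _ _))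
    (pullback.fst _ _ ≫ mapPathSnd (f ≫ g)) (by
      apply CartesianMonoidalCategory.hom_ext
      · simp [hc]
      · simp [hc'])
  let r : mapPath f ⟶ G' := pullback.lift
    (pullback.lift (mapPathFst f) (mapPathSnd f ≫ pathPresheaf.map g) (by
      have h0 : pathPresheaf.map g ≫ pathEnd 0 Z = _ := map_pathEnd 0 g
      rw [Category.assoc, h0, ← reassoc_of% pullback.condition (f := f)]))
    (mapPathEnd f) (by
      have h1 : pathPresheaf.map g ≫ pathEnd 1 Z = _ := map_pathEnd 1 g
      rw [pullback.lift_snd_assoc, Category.assoc, h1, Category.assoc])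
  have hr : r ≫ pullback.snd _ _ = mapPathEnd f := pullback.lift_snd _ _ _
  have hr' : r ≫ pullback.fst _ _ ≫ mapPathFst (f ≫ g) = mapPathFst f := by
    rw [pullback.lift_fst_assoc, pullback.lift_fst]
  have hr'' : r ≫ pullback.fst _ _ ≫ mapPathSnd (f ≫ g) = mapPathSnd f ≫ pathPresheaf.map g := by
    rw [pullback.lift_fst_assoc, pullback.lift_snd]
  have sq : IsPullback (mapPathSnd f) r γ t := by
    refine ⟨⟨?_⟩, ⟨PullbackCone.IsLimit.mk _ (fun s => pullback.lift
      (s.snd ≫ pullback.fst _ _ ≫ mapPathFst (f ≫ g)) s.fst ?_) ?_ ?_ ?_⟩⟩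
    · apply sqG.hom_ext
      · rw [Category.assoc, Category.assoc, sqG.lift_fst, sqG.lift_fst]
        apply CartesianMonoidalCategory.hom_ext
        · simp only [Category.assoc, lift_fst]
          rw [reassoc_of% hr', pullback.condition (f := f)]
        · simp only [Category.assoc, lift_snd]
          exact hr.symm
      · rw [Category.assoc, Category.assoc, sqG.lift_snd, sqG.lift_snd]
        exact hr''.symm
    · have := congr($(s.condition) ≫ pullback.fst _ _ ≫ fst _ _)
      rw [Category.assoc, Category.assoc, reassoc_of% sqG.lift_fst, reassoc_of% sqG.lift_fst,
        lift_fst, lift_fst] at this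
      simpa using this.symm
    · intro s
      exact pullback.lift_snd _ _ _
    · intro s
      apply pullback.hom_ext
      · apply pullback.hom_ext
        · rw [Category.assoc, Category.assoc, hr', pullback.lift_fst, Category.assoc]
        · rw [Category.assoc, Category.assoc, hr'', pullback.lift_snd_assoc]
          have := congr($(s.condition) ≫ pullback.snd _ _)
          rw [Category.assoc, Category.assoc, sqG.lift_snd, sqG.lift_snd] at this
          simpa using this
      · rw [Category.assoc, hr, pullback.lift_snd_assoc]
        have := congr($(s.condition) ≫ pullback.fst _ _ ≫ snd _ _)
        rw [Category.assoc, Category.assoc, reassoc_of% sqG.lift_fst, reassoc_of% sqG.lift_fst,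
          lift_snd, lift_snd] at this
        exact this
    · intro s m h1 h2
      apply pullback.hom_ext
      · rw [pullback.lift_fst, ← h2, Category.assoc, hr']
      · rw [pullback.lift_snd, h1]
  have := hyper_isMultiplicative hS
  rw [weak, ← hr]
  exact MorphismProperty.comp_mem _ _ _ (hyper_isStableUnderBaseChange.of_isPullback sq hγ) hG'

theorem hyper.weak (hS : IsCoverClass S) {f : X ⟶ Y} (hf : hyper S f) (hX : IsKanRep S X)
    (hY : IsKanRep S Y) : weak S f :=
  (kan.weak_iff hS (hyper_le_kan hS _ hf) hX hY).2 hf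

/-- Two out of three, if the second morphism is a weak equivalence: it factors as a section of a
hypercover, followed by a hypercover. -/
theorem weak.of_comp (hS : IsCoverClass S) {f : X ⟶ Y} {g : Y ⟶ Z} (hg : HigherGpd.weak S g)
    (hfg : HigherGpd.weak S (f ≫ g)) (hX : IsKanRep S X) (hY : IsKanRep S Y)
    (hZ : IsKanRep S Z) : HigherGpd.weak S f := by
  let s : Y ⟶ mapPath g := pullback.lift (𝟙 Y) (g ≫ pathConst Z)
    (by rw [Category.assoc, pathConst_pathEnd, Category.id_comp, Category.comp_id])
  have h1 : s ≫ mapPathFst g = 𝟙 Y := pullback.lift_fst _ _ _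
  have h2 : s ≫ mapPathEnd g = g := by
    rw [pullback.lift_snd_assoc, Category.assoc, pathConst_pathEnd, Category.comp_id]
  have hP := hY.mapPath hS hZ (f := g)
  have hfs : HigherGpd.weak S (f ≫ s) := weak.of_comp_hyper hS (g := mapPathEnd g) hg (by
    rwa [Category.assoc, h2])
  have := (weak.comp_iff hS hfs hX hP hY).2 ((hyper_mapPathFst hS g hZ).weak hS hP hY)
  rwa [Category.assoc, h1, Category.comp_id] at this

end Weak

end HigherGpd

namespace HigherGpd

/-! ### Representability of matching objects -/

section Representability

variable {E : Type u} [Category.{v} E] {S : MorphismProperty E} {X Y Z : Eᵒᵖ ⥤ SSet.{w}}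

theorem IsRep.of_iso {P Q : Eᵒᵖ ⥤ Type w} (hP : IsRep P) (e : P ≅ Q) : IsRep Q := by
  obtain ⟨M, p, hp⟩ := hP
  refine ⟨M, e.hom.app _ p, fun T q => ?_⟩
  obtain ⟨k, hk, hu⟩ := hp (e.inv.app _ q)
  have h1 (U) (x : P.obj U) : e.inv.app U (e.hom.app U x) = x := congr($(e.hom_inv_id).app U x)
  have h2 (U) (x : Q.obj U) : e.hom.app U (e.inv.app U x) = x := congr($(e.inv_hom_id).app U x)
  refine ⟨k, ?_, fun l hl => hu l ?_⟩
  · change Q.map k.op _ = q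
    rw [← NatTrans.naturality_apply, hk, h2]
  · change P.map l.op p = _
    rw [← hl, NatTrans.naturality_apply, h1]

theorem LevelRep.of_iso (hX : LevelRep X) (e : X ≅ Y) : LevelRep Y :=
  fun n => (hX n).of_iso (Functor.isoWhiskerRight e _)

theorem IsKanRep.of_iso (hS : IsCoverClass S) (hX : IsKanRep S X) (e : X ≅ Y) : IsKanRep S Y :=
  hX.of_kan hS (fun _ _ => LiftCover.of_isIso_right hS _ e.inv) (hX.levelRep.of_iso e)

/-- Over the terminal object, lifts of `i : A ⟶ B` are the fibres of `Hom(B, X) ⟶ Hom(A, X)`. -/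
theorem LiftCover.relCover_pre {A B : SSet.{w}} {i : A ⟶ B}
    (h : LiftCover S i (toUnit X)) : RelCover S (homPresheafMap i X) := by
  refine RelCover.of_cartesian h (𝟙 _)
    { app := fun U => ↾fun x => ⟨(x, toUnit (C := SSet.{w}) B), toUnit_unique (C := SSet.{w}) _ _⟩
      naturality := fun _ _ _ => by
        ext x
        exact squares_ext rfl (toUnit_unique (C := SSet.{w}) _ _) } ?_ ?_
  · ext U l
    exact squares_ext rfl (toUnit_unique (C := SSet.{w}) _ _)
  · intro _ y l hl
    exact ⟨l, ⟨((toSquares_app_eq_iff _ _).1 hl).1, rfl⟩, fun l' h' => h'.2⟩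

/-- The presheaf of squares from `i : A ⟶ B` to `f : X ⟶ Y` is a base change of
`Hom(B, Y) ⟶ Hom(A, Y)`. -/
theorem RelCover.squares_fst {A B : SSet.{w}} (i : A ⟶ B) {f : X ⟶ Y}
    (h : RelCover S (homPresheafMap i Y)) :
    RelCover S (P := squares i f) (Q := homPresheaf A X)
      { app := fun _ => ↾fun p => p.1.1, naturality := fun _ _ _ => rfl } := by
  refine RelCover.of_cartesian h
    { app := fun _ => ↾fun p => p.1.2, naturality := fun _ _ _ => rfl } (homPresheafPost A f) ?_ ?_
  · ext _ p
    exact p.2.symm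
  · rintro _ q p hp
    refine ⟨⟨(q, p), hp.symm⟩, ⟨rfl, rfl⟩, ?_⟩
    rintro p' ⟨rfl, rfl⟩
    rfl

/-- The object `X^{Λ[n + 1, k]}` exists for an `∞`-groupoid: the horn is obtained from a vertex by
filling horns of smaller dimension, so that it is a cover of `X₀`. -/
theorem isRep_horn_of_kan (hS : IsCoverClass S) (hX : kan S (toUnit X))
    (h₀ : IsRep (homPresheaf Δ[0] X)) (n : ℕ) (k : Fin (n + 2)) :
    IsRep (homPresheaf (Λ[n + 1, k] : SSet.Subcomplex.{w} _) X) := by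
  obtain ⟨j, hj⟩ := LiftCover.exists_vertex_horn hS n k fun m k _ => hX m k
  exact hj.relCover_pre.isRep h₀

/-- For a Kan complex, representability in dimension `0` implies representability in all dimensions.
-/
theorem isKanRep_of_kan (hS : IsCoverClass S) (hX : kan S (toUnit X))
    (h₀ : IsRep (homPresheaf Δ[0] X)) : IsKanRep S X := by
  refine ⟨fun n => ?_, hX⟩
  obtain ⟨j, hj⟩ := LiftCover.exists_vertex_simplex hS n hX
  exact hj.relCover_pre.isRep h₀

theorem IsKanRep.isRep_squares_horn (hS : IsCoverClass S) (hX : IsKanRep S X)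
    (hY : kan S (toUnit Y)) (f : X ⟶ Y) (n : ℕ) (k : Fin (n + 2)) :
    IsRep (squares (Λ[n + 1, k] : SSet.Subcomplex.{w} _).ι f) :=
  ((hY n k).relCover_pre.squares_fst _).isRep
    (isRep_horn_of_kan hS hX.kan_toUnit (hX.levelRep 0) n k)

/-- Presheaves that are constant in the simplicial direction are Kan complexes, since horns are
connected. -/
theorem kan_of_bijective (hS : IsCoverClass S)
    (hX : ∀ (n : ℕ) (j : (Δ[0] : SSet.{w}) ⟶ Δ[n]) (U : Eᵒᵖ),
      Function.Bijective ((homPresheafMap j X).app U)) : kan S (toUnit X) := by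
  -- lifts are unique, that is, they are representable by isomorphisms
  have hI : IsCoverClass (MorphismProperty.isomorphisms E) :=
    { iso_mem := fun f hf => hf
      comp_mem := fun f g (hf : IsIso f) (hg : IsIso g) => inferInstanceAs (IsIso (f ≫ g))
      cancel := fun f g (hf : IsIso f) (hg : IsIso (f ≫ g)) => IsIso.of_isIso_comp_left f g
      exists_isPullback := fun {X Y Z} f g (hf : IsIso f) =>
        ⟨Y, g ≫ inv f, 𝟙 Y, IsPullback.of_vert_isIso ⟨by simp⟩, inferInstanceAs (IsIso (𝟙 Y))⟩ }
  have hbij {P Q : Eᵒᵖ ⥤ Type w} {φ : P ⟶ Q}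
      (h : RelCover (MorphismProperty.isomorphisms E) φ) (U : Eᵒᵖ) :
      Function.Bijective (φ.app U) := by
    constructor
    · intro p p' hp
      obtain ⟨V, g, r, hg : IsIso g, hr⟩ := h (U := U.unop) (φ.app U p)
      obtain ⟨k, ⟨hk, rfl⟩, -⟩ := hr.existsUnique (𝟙 _) p (by simp)
      obtain ⟨l, ⟨hl, rfl⟩, -⟩ := hr.existsUnique (𝟙 _) p' (by simpa using hp.symm)
      rw [(cancel_mono g).1 (hk.trans hl.symm)]
    · intro q
      obtain ⟨V, g, r, hg : IsIso g, hr⟩ := h (U := U.unop) q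
      refine ⟨P.map (inv g).op r, ?_⟩
      rw [NatTrans.naturality_apply]
      erw [hr.app_eq]
      simp
  have key (n : ℕ) : ∀ k : Fin (n + 2), LiftCover (MorphismProperty.isomorphisms E)
      (Λ[n + 1, k] : SSet.Subcomplex.{w} _).ι (toUnit X) := by
    induction n using Nat.strong_induction_on with
    | _ n ih =>
    intro k
    obtain ⟨j, hj⟩ : ∃ j : (Δ[0] : SSet.{w}) ⟶ (Λ[n + 1, k] : SSet),
        LiftCover (MorphismProperty.isomorphisms E) j (toUnit X) :=
      LiftCover.exists_vertex_horn hI n k fun m k' hm => ih m (by omega) k'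
    have hj' := hj.relCover_pre
    have hb (U : Eᵒᵖ) : Function.Bijective ((homPresheafMap
        (Λ[n + 1, k] : SSet.Subcomplex.{w} _).ι X).app U) :=
      (Function.Bijective.of_comp_iff' (hbij hj' U) _).1 (by
        have := hX (n + 1) (j ≫ (Λ[n + 1, k] : SSet.Subcomplex.{w} _).ι) U
        convert this using 1
        ext l
        exact (Category.assoc j (Λ[n + 1, k] : SSet.Subcomplex.{w} _).ι l).symm)
    refine RelCover.of_bijective hI fun U => ⟨fun l l' h => (hb U).1 congr(($h).1.1), fun q => ?_⟩
    obtain ⟨l, hl⟩ := (hb U).2 q.1.1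
    exact ⟨l, squares_ext hl (toUnit_unique (C := SSet.{w}) _ _)⟩
  intro n k
  refine RelCover.of_bijective hS (hbij (key n k))

end Representability

/-! ### Simplicial objects as simplicial presheaves -/

section Points

variable {E : Type u} [Category.{v} E] {S : MorphismProperty E}

/-- The presheaf of `n`-simplices of the functor of points is represented by `X _⦋n⦌`. -/
theorem isUniversal_tautological (X : SimplicialObject E) (n : ℕ) :
    IsUniversal (P := homPresheaf Δ[n] (points.obj X)) (tautological X n) := by
  intro T x
  have h (k : T ⟶ X _⦋n⦌) :
      SSet.yonedaEquiv ((homPresheaf Δ[n] (points.obj X)).map k.op (tautological X n)) = k := by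
    refine (SSet.yonedaEquiv_comp _ _).trans ?_
    exact (congrArg (((points.obj X).map k.op).app (op ⦋n⦌))
      (SSet.yonedaEquiv.apply_symm_apply _)).trans (Category.comp_id k)
  refine ⟨SSet.yonedaEquiv x, SSet.yonedaEquiv.injective (h _), fun k hk => ?_⟩
  rw [← hk]
  exact (h k).symm

theorem levelRep_points (X : SimplicialObject E) : LevelRep (points.obj X) :=
  fun n => ⟨_, _, isUniversal_tautological X n⟩

/-- A matching condition consists of the representability of the matching presheaf and the lifting
condition for the functors of points. -/
theorem matchingCondition_iff (hS : IsCoverClass S) {A : SSet.{v}} {n : ℕ} (i : A ⟶ Δ[n])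
    {X Y : SimplicialObject E} (f : X ⟶ Y) : MatchingCondition S i f ↔
      IsRep (squares i (points.map f)) ∧ LiftCover S i (points.map f) := by
  constructor
  · rintro ⟨M, r, hr⟩
    have hu : IsUniversal (P := squares i (points.map f)) (r.homEquiv (𝟙 M)) := by
      intro T p
      have h (k : T ⟶ M) : r.homEquiv k = (squares i (points.map f)).map k.op
          (r.homEquiv (𝟙 M)) := by
        conv_lhs => rw [← Category.comp_id k]
        exact r.homEquiv_comp k (𝟙 M)
      refine ⟨r.homEquiv.symm p, ?_, fun k hk => ?_⟩
      · exact (h _).symm.trans (r.homEquiv.apply_symm_apply p)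
      · rw [← hk]
        exact (r.homEquiv.symm_apply_apply k).symm.trans (congrArg _ (h k))
    refine ⟨⟨M, _, hu⟩, RelCover.of_mem hS (isUniversal_tautological X n) hu _ ?_ hr⟩
    refine Eq.trans ?_ (r.homEquiv_comp _ (𝟙 M))
    rw [Category.comp_id]
    exact (r.homEquiv.apply_symm_apply _).symm
  · rintro ⟨⟨M, p, hp⟩, h⟩
    let r : (matchingPresheaf i f).RepresentableBy M :=
      { homEquiv := fun {T} => Equiv.ofBijective (fun k => (squares i (points.map f)).map k.op p)
          ⟨fun k l hkl => (hp _).unique hkl rfl, fun q => (hp q).exists⟩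
        homEquiv_comp := fun k l => by
          change (squares i (points.map f)).map (k ≫ l).op p =
            (squares i (points.map f)).map k.op ((squares i (points.map f)).map l.op p)
          simp }
    refine ⟨M, r, h.mem hS (isUniversal_tautological X n) hp _ ?_⟩
    exact (r.homEquiv.apply_symm_apply (canonicalElement i f)).symm

/-- The functor of points is fully faithful. -/
def pointsFullyFaithful : (points (C := E)).FullyFaithful where
  preimage {X Y} α :=
    { app := fun n => (α.app (op (X.obj n))).app n (𝟙 (X.obj n))
      naturality := fun n m g => by
        have h1 := congr(($(α.naturality (X.map g).op)).app m (𝟙 (X.obj m)))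
        have h2 := NatTrans.naturality_apply (α.app (op (X.obj n))) g (𝟙 (X.obj n))
        refine Eq.trans ?_ h2
        refine h1.symm.trans (congrArg ((α.app (op (X.obj n))).app m) ?_)
        exact (Category.comp_id _).trans (Category.id_comp _).symm }
  map_preimage {X Y} α := by
    ext U n x
    exact (congr(($(α.naturality (Quiver.Hom.op x)).app n (𝟙 (X.obj n))))).symm.trans
      (congrArg ((α.app U).app n) (Category.comp_id x))
  preimage_map f := by
    ext n
    exact Category.id_comp _

instance : (points (C := E)).Full := pointsFullyFaithful.full

instance : (points (C := E)).Faithful := pointsFullyFaithful.faithful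

/-- Levelwise representable simplicial presheaves are represented by simplicial objects. -/
theorem LevelRep.exists_iso {P : Eᵒᵖ ⥤ SSet.{v}} (hP : LevelRep P) :
    ∃ X : SimplicialObject E, Nonempty (points.obj X ≅ P) := by
  have h (n : SimplexCategoryᵒᵖ) : ∃ (M : E) (p : (P.obj (op M)).obj n), ∀ ⦃T : E⦄
      (p' : (P.obj (op T)).obj n), ∃! k : T ⟶ M, (P.map k.op).app n p = p' := by
    obtain ⟨M, p, hp⟩ := hP n.unop.len
    have hy {T : E} (k : T ⟶ M) : (P.map k.op).app n (SSet.yonedaEquiv p) =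
        SSet.yonedaEquiv ((homPresheaf _ P).map k.op p) :=
      (SSet.yonedaEquiv_comp _ _).symm
    refine ⟨M, SSet.yonedaEquiv p, fun T p' => ?_⟩
    obtain ⟨k, hk, hu⟩ := hp (SSet.yonedaEquiv.symm p')
    refine ⟨k, (hy k).trans ?_, fun l hl => hu l ?_⟩
    · exact (congrArg _ hk).trans (SSet.yonedaEquiv.apply_symm_apply _)
    · exact (SSet.yonedaEquiv.eq_symm_apply).2 ((hy l).symm.trans hl)
  choose M p hp using h
  let X : SimplicialObject E :=
    { obj := M
      map := fun {n m} g => (hp m ((P.obj _).map g (p n))).choose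
      map_id := fun n => (hp n _).unique (hp n ((P.obj _).map (𝟙 n) (p n))).choose_spec.1 (by simp)
      map_comp := fun {n m l} g h => by
        have hg := (hp m ((P.obj _).map g (p n))).choose_spec.1
        have hh := (hp l ((P.obj _).map h (p m))).choose_spec.1
        refine (hp l _).unique (hp l ((P.obj _).map (g ≫ h) (p n))).choose_spec.1 ?_
        dsimp only at hg hh ⊢
        rw [op_comp, Functor.map_comp, NatTrans.comp_app, types_comp_apply, hh,
          NatTrans.naturality_apply, hg]
        simp }
  have hX {n m : SimplexCategoryᵒᵖ} (g : n ⟶ m) :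
    (P.map (X.map g).op).app m (p m) = (P.obj _).map g (p n) :=
      (hp m ((P.obj _).map g (p n))).choose_spec.1
  refine ⟨X, ⟨NatIso.ofComponents (fun U => NatIso.ofComponents (fun n =>
    (Equiv.ofBijective (fun k : U.unop ⟶ M n => (P.map k.op).app n (p n)) ?_).toIso) ?_) ?_⟩⟩
  · exact ⟨fun k l hkl => (hp n _).unique hkl rfl, fun q => (hp n q).exists⟩
  · intro n m g
    ext (k : U.unop ⟶ X.obj n)
    change (P.map (k ≫ X.map g).op).app m (p m) = (P.obj U).map g ((P.map k.op).app n (p n))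
    have h := Functor.map_comp_apply (P ⋙ (evaluation _ _).obj m) (X.map g).op k.op (p m)
    exact h.trans ((congrArg _ (hX g)).trans (NatTrans.naturality_apply _ _ _))
  · intro U V g
    ext n (k : U.unop ⟶ X.obj n)
    exact Functor.map_comp_apply (P ⋙ (evaluation _ _).obj n) k.op g (p n)

end Points

/-! ### `∞`-groupoids as simplicial presheaves -/

section Groupoids

variable {E : Type u} [Category.{v} E] {S : MorphismProperty E}

/-- The matching objects of a hypercover exist automatically, by induction on the dimension. -/
theorem hypercovers_iff (hS : IsCoverClass S) {X Y : SimplicialObject E} (f : X ⟶ Y) :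
    hypercovers S f ↔ hyper S (points.map f) := by
  constructor
  · intro h n
    exact ((matchingCondition_iff hS _ f).1 (h n)).2
  · intro h n
    exact (matchingCondition_iff hS _ f).2 ⟨isRep_squares_boundary hS (fun m _ => h m)
      (levelRep_points Y n), h n⟩

theorem kan_of_kanFibrations (hS : IsCoverClass S) {X Y : SimplicialObject E} {f : X ⟶ Y}
    (h : kanFibrations S f) : kan S (points.map f) :=
  fun n k => ((matchingCondition_iff hS _ f).1 (h n k)).2

/-- The matching objects of a Kan fibration between `∞`-groupoids exist automatically. -/
theorem kanFibrations_iff (hS : IsCoverClass S) {X Y : SimplicialObject E} (f : X ⟶ Y)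
    (hX : kan S (toUnit (points.obj X))) (hY : kan S (toUnit (points.obj Y))) :
    kanFibrations S f ↔ kan S (points.map f) :=
  ⟨kan_of_kanFibrations hS, fun h n k => (matchingCondition_iff hS _ f).2
    ⟨IsKanRep.isRep_squares_horn hS ⟨levelRep_points X, hX⟩ hY _ n k, h n k⟩⟩

variable [HasTerminal E]

instance isIso_toUnit_points : IsIso (toUnit (points.obj (⊤_ (SimplicialObject E)))) := by
  refine (NatTrans.isIso_iff_isIso_app _).2 fun U => (NatTrans.isIso_iff_isIso_app _).2 fun n =>
    (isIso_iff_bijective _).2 ⟨fun x y _ => ?_, fun x => ?_⟩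
  · exact (IsTerminal.isTerminalObj ((evaluation _ _).obj n) _ terminalIsTerminal).hom_ext x y
  · exact ⟨(IsTerminal.isTerminalObj ((evaluation _ _).obj n) _ terminalIsTerminal).from U.unop,
      rfl⟩

theorem isInftyGroupoid_iff (hS : IsCoverClass S) (X : SimplicialObject E) :
    isInftyGroupoid S X ↔ kan S (toUnit (points.obj X)) := by
  have := kan_isMultiplicative (E := E) (S := S) hS
  constructor
  · intro h
    rw [← toUnit_unique (points.map (terminal.from X) ≫ toUnit _) (toUnit (points.obj X))]
    exact MorphismProperty.comp_mem _ _ _ (kan_of_kanFibrations hS h)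
      fun n k => LiftCover.of_isIso_right hS _ _
  · intro h
    refine (kanFibrations_iff hS _ h fun n k => LiftCover.of_isIso_right hS _ _).2 ?_
    have e : points.map (terminal.from X) = toUnit (points.obj X) ≫ inv (toUnit _) := by
      rw [IsIso.eq_comp_inv]
      exact toUnit_unique _ _
    rw [e]
    exact MorphismProperty.comp_mem _ _ _ h fun n k => LiftCover.of_isIso_right hS _ _

end Groupoids

end HigherGpd

namespace HigherGpd

/-! ### Limits of `∞`-groupoids -/

section FullyFaithful

variable {A : Type*} [Category* A] {B : Type*} [Category* B] (F : A ⥤ B) [F.Full] [F.Faithful]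

/-- A limit that is computed in the larger category and lies in the essential image exists in the
full subcategory. -/
theorem hasLimit_and_preservesLimit_of_essImage {J : Type*} [Category* J] (K : J ⥤ A)
    [HasLimit (K ⋙ F)] (h : F.essImage (limit (K ⋙ F))) : HasLimit K ∧ PreservesLimit K F := by
  obtain ⟨X, ⟨e⟩⟩ := h
  let _ : CreatesLimit K F := createsLimitOfFullyFaithfulOfIso X e
  exact ⟨hasLimit_of_created K F, inferInstance⟩

theorem hasPullback_and_preservesLimit_of_essImage {X Y Z : A} (f : X ⟶ Z) (g : Y ⟶ Z)
    [HasPullback (F.map f) (F.map g)] (h : F.essImage (pullback (F.map f) (F.map g))) :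
    HasPullback f g ∧ PreservesLimit (cospan f g) F := by
  have : HasLimit (cospan f g ⋙ F) := hasLimit_of_iso (cospanCompIso F f g).symm
  exact hasLimit_and_preservesLimit_of_essImage F _
    (F.essImage.prop_of_iso (HasLimit.isoOfNatIso (cospanCompIso F f g)).symm h)

end FullyFaithful

section Groupoids

variable {E : Type u} [Category.{v} E] {S : MorphismProperty E}

theorem LevelRep.mem_essImage {P : Eᵒᵖ ⥤ SSet.{v}} (hP : LevelRep P) :
    (points (C := E)).essImage P := by
  obtain ⟨X, ⟨e⟩⟩ := hP.exists_iso
  exact ⟨X, ⟨e⟩⟩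

theorem isPullback_map_points {P X Y Z : SimplicialObject E} {a : P ⟶ X} {b : P ⟶ Y} {f : X ⟶ Z}
    {g : Y ⟶ Z} (sq : IsPullback a b f g)
    (h : LevelRep (pullback (points.map f) (points.map g))) :
    IsPullback (points.map a) (points.map b) (points.map f) (points.map g) := by
  have := (hasPullback_and_preservesLimit_of_essImage points f g h.mem_essImage).2
  exact sq.map points

/-- The path space of an `∞`-groupoid, as a simplicial presheaf, is an `∞`-groupoid. -/
theorem IsKanRep.path (hS : IsCoverClass S) {X : Eᵒᵖ ⥤ SSet.{v}} (hX : IsKanRep S X) :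
    IsKanRep S (pathPresheaf.obj X) :=
  hX.of_kan hS (hyper_le_kan hS _ (hX.hyper_eval hS 0))
    ((hX.hyper_eval hS 0).levelRep hS hX.levelRep)

/-- A comparison of the points of `P` with the path presheaf of `X` determines the structure
morphisms of a path space. -/
theorem isPathSpace_iff {X P : SimplicialObject E}
    (e : points.obj P ≅ pathPresheaf.obj (points.obj X)) (s : X ⟶ P) (d₀ d₁ : P ⟶ X) :
    IsPathSpace e s d₀ d₁ ↔
      points.map s ≫ e.hom = pathConst (points.obj X) ∧
      points.map d₀ = e.hom ≫ pathEnd 0 (points.obj X) ∧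
      points.map d₁ = e.hom ≫ pathEnd 1 (points.obj X) :=
  ⟨fun h => ⟨NatTrans.ext (funext h.s_eq), NatTrans.ext (funext h.d₀_eq),
    NatTrans.ext (funext h.d₁_eq)⟩, fun ⟨h₁, h₂, h₃⟩ => ⟨fun U => congr(($h₁).app U),
      fun U => congr(($h₂).app U), fun U => congr(($h₃).app U)⟩⟩

/-- The weak equivalences can be tested on any model of `X ×_Y Y^I`. -/
theorem weak_iff_of_isPullback (hS : IsCoverClass S) {X Y Q : Eᵒᵖ ⥤ SSet.{w}} {f : X ⟶ Y}
    {a : Q ⟶ X} {b : Q ⟶ pathPresheaf.obj Y} (sq : IsPullback a b f (pathEnd 0 Y)) :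
    weak S f ↔ hyper S (b ≫ pathEnd 1 Y) := by
  have h1 : b ≫ pathEnd 1 Y = sq.isoPullback.hom ≫ mapPathEnd f := by
    rw [← Category.assoc, sq.isoPullback_hom_snd]
  have h2 : mapPathEnd f = sq.isoPullback.inv ≫ b ≫ pathEnd 1 Y := by
    rw [h1, Iso.inv_hom_id_assoc]
  constructor
  · intro h n
    rw [h1]
    exact (LiftCover.of_isIso_right hS _ _).comp_right hS (h n)
  · intro h n
    rw [h2]
    exact (LiftCover.of_isIso_right hS _ _).comp_right hS (h n)

variable [HasTerminal E]

/-- The functor of points of `∞`-groupoids. -/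
def gpdPoints (S : MorphismProperty E) : Gpd S ⥤ Eᵒᵖ ⥤ SSet.{v} :=
  (isInftyGroupoid S).ι ⋙ points

instance : (gpdPoints S).Full := inferInstanceAs ((isInftyGroupoid S).ι ⋙ points).Full

instance : (gpdPoints S).Faithful := inferInstanceAs ((isInftyGroupoid S).ι ⋙ points).Faithful

theorem isKanRep_points (hS : IsCoverClass S) (X : Gpd S) :
    IsKanRep S ((gpdPoints S).obj X) :=
  ⟨levelRep_points _, (isInftyGroupoid_iff hS _).1 X.property⟩

theorem IsKanRep.mem_essImage (hS : IsCoverClass S) {P : Eᵒᵖ ⥤ SSet.{v}} (hP : IsKanRep S P) :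
    (gpdPoints S).essImage P := by
  obtain ⟨X, ⟨e⟩⟩ := hP.levelRep.exists_iso
  exact ⟨⟨X, (isInftyGroupoid_iff hS _).2 (hP.of_iso hS e.symm).kan_toUnit⟩, ⟨e⟩⟩

theorem gpdKanFibrations_iff (hS : IsCoverClass S) {X Y : Gpd S} (f : X ⟶ Y) :
    gpdKanFibrations S f ↔ kan S ((gpdPoints S).map f) :=
  kanFibrations_iff hS _ (isKanRep_points hS X).kan_toUnit (isKanRep_points hS Y).kan_toUnit

theorem gpdHypercovers_iff (hS : IsCoverClass S) {X Y : Gpd S} (f : X ⟶ Y) :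
    gpdHypercovers S f ↔ hyper S ((gpdPoints S).map f) :=
  hypercovers_iff hS _

/-- The path space and the pullback that enter the definition of a weak equivalence are those of the
functors of points, because the latter are representable. -/
theorem gpdWeakEquivalences_iff (hS : IsCoverClass S) {X Y : Gpd S} (f : X ⟶ Y) :
    gpdWeakEquivalences S f ↔ weak S ((gpdPoints S).map f) := by
  have hX := isKanRep_points hS X
  have hY := isKanRep_points hS Y
  change IsKanRep S (points.obj X.obj) at hX
  change IsKanRep S (points.obj Y.obj) at hY
  change _ ↔ weak S (points.map f.hom)
  constructor
  · rintro ⟨P, (e : points.obj P ≅ pathPresheaf.obj (points.obj Y.obj)), s, d₀, d₁, Q, a, b, hP,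
      sq, h⟩
    obtain ⟨-, h₀, h₁⟩ := (isPathSpace_iff e _ _ _).1 hP
    have sq₀ : IsPullback e.hom (points.map d₀) (pathEnd 0 (points.obj Y.obj)) (𝟙 _) :=
      IsPullback.of_horiz_isIso ⟨by rw [h₀, Category.comp_id]⟩
    have := ((IsPullback.of_hasPullback (points.map f.hom) (points.map d₀)).flip.paste_horiz
      sq₀).flip
    rw [Category.comp_id] at this
    have sq' := (isPullback_map_points sq ((hX.mapPath hS hY).levelRep.of_iso
      (this.isoPullback.symm))).flip
    have sq'' := (sq'.paste_horiz sq₀).flip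
    rw [Category.comp_id] at sq''
    rw [hypercovers_iff hS, Functor.map_comp, h₁, ← Category.assoc] at h
    exact (weak_iff_of_isPullback hS sq'').2 h
  · intro h
    obtain ⟨P, ⟨e⟩⟩ := (hY.path hS).levelRep.exists_iso
    obtain ⟨Q, ⟨q⟩⟩ := (hX.mapPath hS hY (f := points.map f.hom)).levelRep.exists_iso
    have hP : IsPathSpace e (points.preimage (pathConst _ ≫ e.inv))
        (points.preimage (e.hom ≫ pathEnd 0 (points.obj Y.obj)))
        (points.preimage (e.hom ≫ pathEnd 1 (points.obj Y.obj))) := by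
      refine (isPathSpace_iff _ _ _ _).2 ⟨?_, ?_, ?_⟩
      · rw [Functor.map_preimage, Category.assoc, Iso.inv_hom_id, Category.comp_id]
      · rw [Functor.map_preimage]
      · rw [Functor.map_preimage]
    refine ⟨P, e, _, _, _, Q, points.preimage (q.hom ≫ mapPathFst _),
      points.preimage (q.hom ≫ mapPathSnd _ ≫ e.inv), hP, ?_, ?_⟩
    · refine IsPullback.of_map points (points.map_injective ?_) ?_
      · simp only [Functor.map_comp, Functor.map_preimage, Category.assoc, Iso.inv_hom_id_assoc]
        exact congr(q.hom ≫ $(pullback.condition))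
      · rw [Functor.map_preimage, Functor.map_preimage, Functor.map_preimage]
        refine IsPullback.of_iso (IsPullback.of_hasPullback (points.map f.hom) (pathEnd 0 _))
          q.symm (Iso.refl _) e.symm (Iso.refl _) ?_ ?_ ?_ ?_ <;> simp
    · rw [hypercovers_iff hS, Functor.map_comp, Functor.map_preimage, Functor.map_preimage]
      intro n
      have := (LiftCover.of_isIso_right hS (∂Δ[n] : SSet.Subcomplex.{v} _).ι q.hom).comp_right hS
        (h n)
      simpa using this

end Groupoids

section Constant

variable {E : Type u} [Category.{v} E] {S : MorphismProperty E}

/-- The points of a constant simplicial object corepresent the presheaves of `0`-simplices. -/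
noncomputable def constHomEquiv (U : E) (Z : Eᵒᵖ ⥤ SSet.{v}) :
    (points.obj ((SimplicialObject.const E).obj U) ⟶ Z) ≃ (Z.obj (op U)).obj (op ⦋0⦌) where
  toFun α := (α.app (op U)).app (op ⦋0⦌) (𝟙 U)
  invFun z :=
    { app := fun V =>
        { app := fun n => ↾fun g : V.unop ⟶ U =>
            (Z.obj V).map (SimplexCategory.isTerminalZero.from n.unop).op
              ((Z.map g.op).app (op ⦋0⦌) z)
          naturality := fun n m h => by
            ext (g : V.unop ⟶ U)
            change (Z.obj V).map _ ((Z.map (g ≫ 𝟙 U).op).app (op ⦋0⦌) z) = _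
            rw [Category.comp_id]
            refine Eq.trans ?_ (Functor.map_comp_apply (Z.obj V) _ h _)
            congr 2 }
      naturality := fun V W h => by
        ext n (g : V.unop ⟶ U)
        refine Eq.trans ?_ (NatTrans.naturality_apply (Z.map h) _ _).symm
        exact congrArg _ (Functor.map_comp_apply (Z ⋙ (evaluation _ _).obj (op ⦋0⦌)) g.op h z) }
  left_inv α := by
    ext V n (g : V.unop ⟶ U)
    have h1 := congr(($(α.naturality g.op)).app (op ⦋0⦌) (𝟙 U))
    have h2 := congr($((α.app V).naturality (SimplexCategory.isTerminalZero.from n.unop).op)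
      (g ≫ 𝟙 U : V.unop ⟶ U))
    refine (congrArg _ h1.symm).trans (h2.symm.trans (congrArg ((α.app V).app n) ?_))
    exact (Category.comp_id _).trans (Category.comp_id g)
  right_inv z := by
    change (Z.obj (op U)).map _ ((Z.map (𝟙 (op U))).app (op ⦋0⦌) z) = z
    have : (SimplexCategory.isTerminalZero.from ⦋0⦌).op = 𝟙 _ :=
      Quiver.Hom.unop_inj (SimplexCategory.isTerminalZero.hom_ext _ _)
    erw [this]
    simp

theorem constHomEquiv_comp (U : E) {Z Z' : Eᵒᵖ ⥤ SSet.{v}}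
    (α : points.obj ((SimplicialObject.const E).obj U) ⟶ Z) (β : Z ⟶ Z') :
    constHomEquiv U Z' (α ≫ β) = (β.app (op U)).app (op ⦋0⦌) (constHomEquiv U Z α) :=
  rfl

/-- Constant simplicial objects are `∞`-groupoids. -/
theorem kan_toUnit_const (hS : IsCoverClass S) (U : E) :
    kan S (toUnit (points.obj ((SimplicialObject.const E).obj U))) := by
  refine kan_of_bijective hS fun n j V => ?_
  obtain ⟨g, rfl⟩ := SSet.stdSimplex.map_surjective j
  have h (x : Δ[n] ⟶ (points.obj ((SimplicialObject.const E).obj U)).obj V) :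
      SSet.yonedaEquiv (SSet.stdSimplex.map g ≫ x) = SSet.yonedaEquiv x :=
    (SSet.yonedaEquiv_naturality g x).symm.trans (Category.comp_id _)
  refine ⟨fun x y hxy => SSet.yonedaEquiv.injective ?_,
    fun (y : Δ[0] ⟶ (points.obj ((SimplicialObject.const E).obj U)).obj V) =>
      ⟨(SSet.yonedaEquiv (n := ⦋n⦌)).symm (SSet.yonedaEquiv y : V.unop ⟶ U),
        SSet.yonedaEquiv.injective ?_⟩⟩
  · exact (h x).symm.trans ((congrArg SSet.yonedaEquiv hxy).trans (h y))
  · exact (h _).trans (SSet.yonedaEquiv.apply_symm_apply _)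

theorem isRep_zero {X : Eᵒᵖ ⥤ SSet.{w}}
    (h : IsRep (X ⋙ (evaluation _ _).obj (op ⦋0⦌))) : IsRep (homPresheaf Δ[0] X) :=
  h.of_iso (NatIso.ofComponents (fun U => (SSet.yonedaEquiv (n := ⦋0⦌)).symm.toIso)
    fun {U V} g => by
    ext x
    refine SSet.yonedaEquiv.injective ?_
    exact (SSet.yonedaEquiv.apply_symm_apply _).trans ((SSet.yonedaEquiv_comp _ _).trans
      (congrArg ((X.map g).app (op ⦋0⦌)) (SSet.yonedaEquiv.apply_symm_apply x))).symm)

variable [HasTerminal E]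

/-- The functor of points preserves all pullbacks of Kan fibrations that exist in the category of
`∞`-groupoids. Maps from the constant `∞`-groupoids, which are available for all objects, detect the
`0`-simplices; so the fibre product `Q` of the functors of points is representable in dimension `0`.
As a Kan complex it is then representable in all dimensions. -/
theorem isPullback_map_gpdPoints (hS : IsCoverClass S) {P X Y Z : Gpd S} {a : P ⟶ X} {b : P ⟶ Y}
    {f : X ⟶ Z} {g : Y ⟶ Z} (sq : IsPullback a b f g) (hf : gpdKanFibrations S f) :
    IsPullback ((gpdPoints S).map a) ((gpdPoints S).map b) ((gpdPoints S).map f)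
      ((gpdPoints S).map g) := by
  let Q := pullback ((gpdPoints S).map f) ((gpdPoints S).map g)
  let c (U : E) : Gpd S := ⟨(SimplicialObject.const E).obj U,
    (isInftyGroupoid_iff hS _).2 (kan_toUnit_const hS U)⟩
  let π : (gpdPoints S).obj P ⟶ Q :=
    pullback.lift ((gpdPoints S).map a) ((gpdPoints S).map b)
      (by simp only [← Functor.map_comp, sq.w])
  have hπ₁ : π ≫ pullback.fst _ _ = (gpdPoints S).map a := pullback.lift_fst _ _ _
  have hπ₂ : π ≫ pullback.snd _ _ = (gpdPoints S).map b := pullback.lift_snd _ _ _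
  have hπ (U : E) : Function.Bijective
      (fun α : (gpdPoints S).obj (c U) ⟶ (gpdPoints S).obj P => α ≫ π) := by
    constructor
    · intro α β (h : α ≫ π = β ≫ π)
      obtain ⟨α, rfl⟩ := (gpdPoints S).map_surjective α
      obtain ⟨β, rfl⟩ := (gpdPoints S).map_surjective β
      congr 1
      apply sq.hom_ext
      · apply (gpdPoints S).map_injective
        rw [Functor.map_comp, Functor.map_comp, ← hπ₁, reassoc_of% h]
      · apply (gpdPoints S).map_injective
        rw [Functor.map_comp, Functor.map_comp, ← hπ₂, reassoc_of% h]
    · intro α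
      obtain ⟨x, hx⟩ := (gpdPoints S).map_surjective (α ≫ pullback.fst _ _)
      obtain ⟨y, hy⟩ := (gpdPoints S).map_surjective (α ≫ pullback.snd _ _)
      refine ⟨(gpdPoints S).map (sq.lift x y ((gpdPoints S).map_injective ?_)), ?_⟩
      · rw [Functor.map_comp, Functor.map_comp, hx, hy, Category.assoc, Category.assoc,
          pullback.condition]
      · apply pullback.hom_ext
        · rw [Category.assoc, hπ₁, ← Functor.map_comp, sq.lift_fst, hx]
        · rw [Category.assoc, hπ₂, ← Functor.map_comp, sq.lift_snd, hy]
  have hπ' (U : E) : Function.Bijective ((π.app (op U)).app (op ⦋0⦌)) := by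
    have := (constHomEquiv U Q).bijective.comp ((hπ U).comp
      (constHomEquiv U (points.obj P.obj)).symm.bijective)
    refine (congrArg Function.Bijective (funext fun z => ?_)).mpr this
    refine Eq.trans ?_ (constHomEquiv_comp U ((constHomEquiv U (points.obj P.obj)).symm z) π).symm
    exact (congrArg ((π.app (op U)).app (op ⦋0⦌))
      ((constHomEquiv U (points.obj P.obj)).apply_symm_apply z)).symm
  have hQ : IsKanRep S Q := by
    refine isKanRep_of_kan hS ?_ (isRep_zero ⟨P.obj _⦋0⦌,
      (π.app _).app _ (𝟙 (P.obj _⦋0⦌) : P.obj _⦋0⦌ ⟶ P.obj _⦋0⦌), fun T q => ?_⟩)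
    · have := kan_isMultiplicative hS
      rw [← toUnit_unique (pullback.snd _ _ ≫ toUnit ((gpdPoints S).obj Y)) (toUnit Q)]
      exact MorphismProperty.comp_mem _ _ _ (kan_isStableUnderBaseChange.of_isPullback
        (IsPullback.of_hasPullback _ _) ((gpdKanFibrations_iff hS f).1 hf))
        (isKanRep_points hS Y).kan_toUnit
    · have h (k : T ⟶ P.obj _⦋0⦌) : (Q.map k.op).app (op ⦋0⦌) ((π.app _).app _
          (𝟙 (P.obj _⦋0⦌) : P.obj _⦋0⦌ ⟶ P.obj _⦋0⦌)) = (π.app (op T)).app _ k :=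
        (congr(($(π.naturality k.op)).app (op ⦋0⦌) (𝟙 (P.obj _⦋0⦌)))).symm.trans
          (congrArg _ (Category.comp_id k))
      obtain ⟨k, hk⟩ := (hπ' T).2 q
      exact ⟨k, (h k).trans hk, fun l hl => (hπ' T).1 (((h l).symm.trans hl).trans hk.symm)⟩
  have := (hasPullback_and_preservesLimit_of_essImage (gpdPoints S) f g (hQ.mem_essImage hS)).2
  exact sq.map (gpdPoints S)

end Constant

end HigherGpd

namespace HigherGpd

/-! ### The category of fibrant objects -/

section CoverClass

variable {C : Type u} [Category.{v} C]

/-- Isomorphisms are base changes of the identity of the terminal object. -/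
theorem mem_of_isIso_of_id_terminal [HasTerminal C] {S : MorphismProperty C}
    [S.IsStableUnderBaseChange] (h : S (𝟙 (⊤_ C))) {X Y : C} (f : X ⟶ Y) (hf : IsIso f) : S f :=
  MorphismProperty.of_isPullback (P := S) (g := 𝟙 (⊤_ C)) (f' := terminal.from X)
    (f := terminal.from Y) (IsPullback.of_vert_isIso ⟨Subsingleton.elim _ _⟩) h

theorem isCoverClass_of_isCategoryWithCovers [HasTerminal C] (S : MorphismProperty C)
    [h : IsCategoryWithCovers S] : IsCoverClass S where
  iso_mem f hf :=
    have := h.baseChange_mem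
    mem_of_isIso_of_id_terminal (by
      rw [Subsingleton.elim (𝟙 (⊤_ C)) (terminal.from _)]
      exact h.terminal_mem _) f hf
  comp_mem f g hf hg :=
    have := h.comp_mem
    S.comp_mem f g hf hg
  cancel := h.cancel
  exists_isPullback f g hf :=
    have := h.hasPullback f g hf
    have := h.baseChange_mem
    ⟨_, _, _, IsPullback.of_hasPullback f g,
      MorphismProperty.of_isPullback (IsPullback.of_hasPullback f g) hf⟩

theorem isCoverClass_of_isDescentCategory [HasFiniteLimits C] (S : MorphismProperty C)
    [h : IsDescentCategory S] : IsCoverClass S where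
  iso_mem f hf :=
    have := h.baseChange_mem
    mem_of_isIso_of_id_terminal h.terminal_mem f hf
  comp_mem f g hf hg :=
    have := h.comp_mem
    S.comp_mem f g hf hg
  cancel := h.cancel
  exists_isPullback f g hf :=
    have := h.baseChange_mem
    ⟨_, _, _, IsPullback.of_hasPullback f g,
      MorphismProperty.of_isPullback (IsPullback.of_hasPullback f g) hf⟩

end CoverClass

section Products

variable {C : Type u} [Category.{v} C] [HasTerminal C] (S : MorphismProperty C)
  [IsCategoryWithCovers S]

/-- Products of `∞`-groupoids exist: it suffices to represent `X₀ × Y₀`, which is a pullback of the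
cover from `X₀` to the terminal object. -/
theorem IsKanRep.tensor {X Y : Cᵒᵖ ⥤ SSet.{v}} (hX : IsKanRep S X) (hY : IsKanRep S Y) :
    IsKanRep S (X ⊗ Y) := by
  have hS := isCoverClass_of_isCategoryWithCovers S
  refine isKanRep_of_kan hS ?_ ?_
  · have sq : IsPullback (fst X Y) (snd X Y) (toUnit X) (toUnit Y) :=
      ⟨⟨toUnit_unique _ _⟩, ⟨PullbackCone.IsLimit.mk _ (fun s => lift s.fst s.snd) (by simp)
        (by simp) fun s m h₁ h₂ => by apply CartesianMonoidalCategory.hom_ext <;> simp [h₁, h₂]⟩⟩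
    have := kan_isMultiplicative hS
    rw [← toUnit_unique (snd X Y ≫ toUnit Y) (toUnit (X ⊗ Y))]
    exact MorphismProperty.comp_mem _ _ _
      (kan_isStableUnderBaseChange.of_isPullback sq hX.kan_toUnit) hY.kan_toUnit
  · -- `X₀ × Y₀ ⟶ Y₀` is a base change of the cover from `X₀` to the terminal object
    obtain ⟨M, p, hp⟩ := hX.levelRep 0
    have hu : IsUniversal (P := homPresheaf Δ[0] (𝟙_ (Cᵒᵖ ⥤ SSet.{v}))) (M := ⊤_ C)
        (toUnit (C := SSet.{v}) Δ[0]) := fun T q =>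
      ⟨terminal.from T, toUnit_unique (C := SSet.{v}) _ _, fun _ _ => Subsingleton.elim _ _⟩
    have h₀ : RelCover S (homPresheafPost Δ[0] (toUnit X)) :=
      RelCover.of_mem hS hp hu (terminal.from M) (toUnit_unique (C := SSet.{v}) _ _)
        (IsCategoryWithCovers.terminal_mem M)
    refine RelCover.isRep (S := S) (φ := homPresheafPost Δ[0] (snd X Y)) ?_ (hY.levelRep 0)
    refine RelCover.of_cartesian h₀ (homPresheafPost Δ[0] (fst X Y))
      (homPresheafPost Δ[0] (toUnit Y)) ?_ ?_
    · ext U x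
      exact toUnit_unique (C := SSet.{v}) _ _
    · intro U q p _
      refine ⟨lift (C := SSet.{v}) (X := X.obj U) (Y := Y.obj U) p q,
        ⟨lift_snd (C := SSet.{v}) _ _, lift_fst (C := SSet.{v}) _ _⟩, ?_⟩
      rintro l ⟨rfl, rfl⟩
      apply CartesianMonoidalCategory.hom_ext (C := SSet.{v})
      · exact (lift_fst (C := SSet.{v}) _ _).symm
      · exact (lift_snd (C := SSet.{v}) _ _).symm

/-- The terminal `∞`-groupoid. -/
noncomputable def gpdTerminal : Gpd S :=
  ⟨⊤_ (SimplicialObject C), (isInftyGroupoid_iff (isCoverClass_of_isCategoryWithCovers S) _).2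
    fun _ _ => LiftCover.of_isIso_right (isCoverClass_of_isCategoryWithCovers S) _ _⟩

/-- The universal property of the terminal `∞`-groupoid. -/
noncomputable def gpdTerminalIsTerminal : IsTerminal (gpdTerminal S) :=
  IsTerminal.ofUniqueHom (fun X => ⟨terminal.from X.obj⟩)
    fun _ _ => ObjectProperty.hom_ext _ (terminal.hom_ext _ _)

theorem hasLimit_and_preservesLimit_pair (X Y : Gpd S) :
    HasLimit (pair X Y) ∧ PreservesLimit (pair X Y) (gpdPoints S) := by
  have hS := isCoverClass_of_isCategoryWithCovers S
  refine hasLimit_and_preservesLimit_of_essImage _ _ (IsKanRep.mem_essImage hS ?_)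
  refine ((isKanRep_points hS X).tensor S (isKanRep_points hS Y)).of_iso hS ?_
  exact (IsLimit.conePointUniqueUpToIso (limit.isLimit (pair _ _))
    (tensorProductIsBinaryProduct _ _)).symm ≪≫ HasLimit.isoOfNatIso (pairComp X Y _).symm

theorem hasFiniteProducts_gpd : HasFiniteProducts (Gpd S) := by
  have : HasTerminal (Gpd S) := (gpdTerminalIsTerminal S).hasTerminal
  have : HasBinaryProducts (Gpd S) := by
    have (X Y : Gpd S) : HasLimit (pair X Y) := (hasLimit_and_preservesLimit_pair S X Y).1
    exact hasBinaryProducts_of_hasLimit_pair _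
  exact hasFiniteProducts_of_has_binary_and_terminal

end Products

section PathFunctor

variable {C : Type u} [Category.{v} C] [HasTerminal C] {S : MorphismProperty C}

theorem exists_lift_of_essImage {A B J : Type*} [Category* A] [Category* B] [Category* J]
    (F : A ⥤ B) [F.Full] [F.Faithful] (G : J ⥤ B) (h : ∀ j, F.essImage (G.obj j)) :
    ∃ L : J ⥤ A, Nonempty (L ⋙ F ≅ G) :=
  ⟨F.essImage.lift G h ⋙ F.toEssImage.inv,
    ⟨Functor.isoWhiskerLeft (F.essImage.lift G h)
      (Functor.isoWhiskerRight F.toEssImage.asEquivalence.counitIso F.essImage.ι)⟩⟩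

theorem exists_pathFunctor (hS : IsCoverClass S) :
    ∃ L : Gpd S ⥤ Gpd S, Nonempty (L ⋙ gpdPoints S ≅ gpdPoints S ⋙ pathPresheaf) :=
  exists_lift_of_essImage (gpdPoints S) (gpdPoints S ⋙ pathPresheaf)
    fun X => ((isKanRep_points hS X).path hS).mem_essImage hS

end PathFunctor

section FibrantObjects

variable {C : Type u} [Category.{v} C] [HasTerminal C] (S : MorphismProperty C)

theorem gpdWeakEquivalences_isMultiplicative (hS : IsCoverClass S) :
    (gpdWeakEquivalences S).IsMultiplicative where
  id_mem X := by
    rw [gpdWeakEquivalences_iff hS, CategoryTheory.Functor.map_id]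
    exact ((hyper_isMultiplicative hS).id_mem _).weak hS (isKanRep_points hS X)
      (isKanRep_points hS X)
  comp_mem {X Y Z} f g hf hg := by
    rw [gpdWeakEquivalences_iff hS] at hf hg ⊢
    rw [Functor.map_comp]
    exact (weak.comp_iff hS hf (isKanRep_points hS X) (isKanRep_points hS Y)
      (isKanRep_points hS Z)).2 hg

theorem gpdWeakEquivalences_twoOutOfThree (hS : IsCoverClass S) :
    (gpdWeakEquivalences S).HasTwoOutOfThreeProperty where
  comp_mem := (gpdWeakEquivalences_isMultiplicative S hS).comp_mem
  of_postcomp {X Y Z} f g hg hfg := by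
    rw [gpdWeakEquivalences_iff hS] at hfg hg ⊢
    rw [Functor.map_comp] at hfg
    exact weak.of_comp hS hg hfg (isKanRep_points hS X) (isKanRep_points hS Y)
      (isKanRep_points hS Z)
  of_precomp {X Y Z} f g hf hfg := by
    rw [gpdWeakEquivalences_iff hS] at hf hfg ⊢
    rw [Functor.map_comp] at hfg
    exact (weak.comp_iff hS hf (isKanRep_points hS X) (isKanRep_points hS Y)
      (isKanRep_points hS Z)).1 hfg

/-- The acyclic fibrations are the hypercovers. -/
theorem gpdWeakEquivalences_inf_gpdKanFibrations (hS : IsCoverClass S) :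
    gpdWeakEquivalences S ⊓ gpdKanFibrations S = gpdHypercovers S := by
  ext X Y f
  have hX := isKanRep_points hS X
  have hY := isKanRep_points hS Y
  change gpdWeakEquivalences S f ∧ gpdKanFibrations S f ↔ _
  rw [gpdWeakEquivalences_iff hS, gpdKanFibrations_iff hS, gpdHypercovers_iff hS]
  exact ⟨fun h => (h.2.weak_iff hS hX hY).1 h.1, fun h => ⟨h.weak hS hX hY, hyper_le_kan hS _ h⟩⟩

theorem gpdKanFibrations_isMultiplicative (hS : IsCoverClass S) :
    (gpdKanFibrations S).IsMultiplicative where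
  id_mem X := by
    rw [gpdKanFibrations_iff hS, CategoryTheory.Functor.map_id]
    exact (kan_isMultiplicative hS).id_mem _
  comp_mem f g hf hg := by
    rw [gpdKanFibrations_iff hS] at hf hg ⊢
    rw [Functor.map_comp]
    exact (kan_isMultiplicative hS).comp_mem _ _ hf hg

theorem gpdHypercovers_of_isIso (hS : IsCoverClass S) {X Y : Gpd S} (f : X ⟶ Y) [IsIso f] :
    gpdHypercovers S f :=
  (gpdHypercovers_iff hS f).2 fun _ => LiftCover.of_isIso_right hS _ _

theorem gpdKanFibrations_isStableUnderBaseChange (hS : IsCoverClass S) :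
    (gpdKanFibrations S).IsStableUnderBaseChange where
  of_isPullback sq hg := by
    have sq' := isPullback_map_gpdPoints hS sq hg
    rw [gpdKanFibrations_iff hS] at hg ⊢
    exact kan_isStableUnderBaseChange.of_isPullback sq' hg

theorem gpdHypercovers_le_gpdKanFibrations (hS : IsCoverClass S) :
    gpdHypercovers S ≤ gpdKanFibrations S := by
  rw [← gpdWeakEquivalences_inf_gpdKanFibrations S hS]
  exact inf_le_right

theorem gpdHypercovers_isStableUnderBaseChange (hS : IsCoverClass S) :
    (gpdHypercovers S).IsStableUnderBaseChange where
  of_isPullback sq hg := by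
    have sq' := isPullback_map_gpdPoints hS sq (gpdHypercovers_le_gpdKanFibrations S hS _ hg)
    rw [gpdHypercovers_iff hS] at hg ⊢
    exact hyper_isStableUnderBaseChange.of_isPullback sq' hg

/-- The base change of a hypercover is levelwise representable, hence an `∞`-groupoid. -/
theorem hasPullback_of_gpdHypercovers (hS : IsCoverClass S) {X Y Z : Gpd S} (f : X ⟶ Z)
    (g : Y ⟶ Z) (hf : gpdHypercovers S f) : HasPullback f g := by
  rw [gpdHypercovers_iff hS] at hf
  have h := hyper_isStableUnderBaseChange.of_isPullback
    (IsPullback.of_hasPullback ((gpdPoints S).map f) ((gpdPoints S).map g)) hf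
  have hY := isKanRep_points hS Y
  exact (hasPullback_and_preservesLimit_of_essImage (gpdPoints S) f g
    ((hY.of_kan hS (hyper_le_kan hS _ h) (h.levelRep hS hY.levelRep)).mem_essImage hS)).1

theorem gpdKanFibrations_terminal [IsCategoryWithCovers S] [HasTerminal (Gpd S)] (X : Gpd S) :
    gpdKanFibrations S (terminal.from X) := by
  have hS := isCoverClass_of_isCategoryWithCovers S
  have h : gpdKanFibrations S ((gpdTerminalIsTerminal S).from X) := X.property
  rw [← terminal.hom_ext ((gpdTerminalIsTerminal S).from X ≫
    ((gpdTerminalIsTerminal S).uniqueUpToIso terminalIsTerminal).hom) (terminal.from X)]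
  exact (gpdKanFibrations_isMultiplicative S hS).comp_mem _ _ h
    (gpdHypercovers_le_gpdKanFibrations S hS _ (gpdHypercovers_of_isIso S hS _))

theorem isPathObject_of_isPathSpace [IsCategoryWithCovers S] [HasFiniteProducts (Gpd S)]
    {X P : Gpd S} (e : (gpdPoints S).obj P ≅ pathPresheaf.obj ((gpdPoints S).obj X)) {s : X ⟶ P}
    {d₀ d₁ : P ⟶ X} (h : IsPathSpace (X := X.obj) (P := P.obj) e s.hom d₀.hom d₁.hom) :
    IsPathObject (gpdWeakEquivalences S) (gpdKanFibrations S) s d₀ d₁ := by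
  have hS := isCoverClass_of_isCategoryWithCovers S
  have hX := isKanRep_points hS X
  have hP := isKanRep_points hS P
  obtain ⟨h₁, h₂, h₃⟩ := (isPathSpace_iff e _ _ _).1 h
  change (gpdPoints S).map s ≫ e.hom = pathConst ((gpdPoints S).obj X) at h₁
  change (gpdPoints S).map d₀ = e.hom ≫ pathEnd 0 ((gpdPoints S).obj X) at h₂
  change (gpdPoints S).map d₁ = e.hom ≫ pathEnd 1 ((gpdPoints S).obj X) at h₃
  have e₀ : s ≫ d₀ = 𝟙 X := (gpdPoints S).map_injective (by
    rw [Functor.map_comp, h₂, reassoc_of% h₁, pathConst_pathEnd, CategoryTheory.Functor.map_id])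
  have e₁ : s ≫ d₁ = 𝟙 X := (gpdPoints S).map_injective (by
    rw [Functor.map_comp, h₃, reassoc_of% h₁, pathConst_pathEnd, CategoryTheory.Functor.map_id])
  refine ⟨?_, ?_, ?_⟩
  -- `s` is a section of the hypercover `d₀`
  · refine (gpdWeakEquivalences_twoOutOfThree S hS).of_postcomp s d₀ ?_ ?_
    · rw [gpdWeakEquivalences_iff hS, h₂]
      refine hyper.weak hS ?_ hP hX
      exact (hyper_isMultiplicative hS).comp_mem _ _
        (fun n => LiftCover.of_isIso_right hS _ _) (hX.hyper_eval hS 0)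
    · rw [e₀]
      exact (gpdWeakEquivalences_isMultiplicative S hS).id_mem X
  -- `(d₀, d₁)` is the evaluation at both ends, up to the comparison of the products
  · have := (hasLimit_and_preservesLimit_pair S X X).2
    let θ := IsLimit.conePointUniqueUpToIso
      (mapIsLimitOfPreservesOfIsLimit (gpdPoints S) prod.fst prod.snd (prodIsProd X X))
      (tensorProductIsBinaryProduct ((gpdPoints S).obj X) ((gpdPoints S).obj X))
    have θ₁ : θ.hom ≫ fst _ _ = (gpdPoints S).map prod.fst :=
      IsLimit.conePointUniqueUpToIso_hom_comp _ _ (Discrete.mk WalkingPair.left)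
    have θ₂ : θ.hom ≫ snd _ _ = (gpdPoints S).map prod.snd :=
      IsLimit.conePointUniqueUpToIso_hom_comp _ _ (Discrete.mk WalkingPair.right)
    have key : (gpdPoints S).map (prod.lift d₀ d₁) =
        (e.hom ≫ lift (pathEnd 0 _) (pathEnd 1 _)) ≫ θ.inv := by
      rw [Iso.eq_comp_inv]
      apply CartesianMonoidalCategory.hom_ext
      · rw [Category.assoc, θ₁, ← Functor.map_comp, prod.lift_fst, h₂, Category.assoc, lift_fst]
      · rw [Category.assoc, θ₂, ← Functor.map_comp, prod.lift_snd, h₃, Category.assoc, lift_snd]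
    have := kan_isMultiplicative hS
    rw [gpdKanFibrations_iff hS, key]
    exact MorphismProperty.comp_mem _ _ _ (MorphismProperty.comp_mem _ _ _
      (fun n k => LiftCover.of_isIso_right hS _ _) (hX.kan_lift_eval hS))
      (fun n k => LiftCover.of_isIso_right hS _ _)
  · apply prod.hom_ext
    · rw [Category.assoc, prod.lift_fst, e₀, diag, prod.lift_fst]
    · rw [Category.assoc, prod.lift_snd, e₁, diag, prod.lift_snd]

theorem exists_functorialPathObject [IsCategoryWithCovers S] [HasFiniteProducts (Gpd S)] :
    ∃ (T : FunctorialPathObject (gpdWeakEquivalences S) (gpdKanFibrations S))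
      (e : T.path ⋙ (isInftyGroupoid S).ι ⋙ points ≅
        (isInftyGroupoid S).ι ⋙ points ⋙ (Functor.whiskeringRight _ _ _).obj pathSSet),
      ∀ X : Gpd S, IsPathSpace (X := X.obj) (P := (T.path.obj X).obj) (e.app X)
        (T.s.app X).hom (T.d₀.app X).hom (T.d₁.app X).hom := by
  have hS := isCoverClass_of_isCategoryWithCovers S
  obtain ⟨L, ⟨e⟩⟩ := exists_pathFunctor (S := S) hS
  have hnat {X Y : Gpd S} (f : X ⟶ Y) : (gpdPoints S).map (L.map f) ≫ e.hom.app Y =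
    e.hom.app X ≫ pathPresheaf.map ((gpdPoints S).map f) := e.hom.naturality f
  have hinv (X : Gpd S) : e.inv.app X ≫ e.hom.app X = 𝟙 (pathPresheaf.obj _) :=
    e.inv_hom_id_app X
  let s : 𝟭 (Gpd S) ⟶ L :=
    { app := fun X => (gpdPoints S).preimage (pathConst _ ≫ e.inv.app X)
      naturality := fun X Y f => (gpdPoints S).map_injective (by
        rw [Functor.map_comp, Functor.map_comp, Functor.map_preimage, Functor.map_preimage,
          ← cancel_mono (e.hom.app Y), Category.assoc, Category.assoc, Category.assoc,
          Category.assoc, hnat, hinv, reassoc_of% hinv]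
        exact (congr(_ ≫ $(Category.comp_id _))).trans (pathConst_map _).symm) }
  let d (ε : Fin 2) : L ⟶ 𝟭 (Gpd S) :=
    { app := fun X => (gpdPoints S).preimage (e.hom.app X ≫ pathEnd ε _)
      naturality := fun X Y f => (gpdPoints S).map_injective (by
        rw [Functor.map_comp, Functor.map_comp, Functor.map_preimage, Functor.map_preimage,
          reassoc_of% hnat, Category.assoc]
        exact congr(e.hom.app X ≫ $(map_pathEnd ε ((gpdPoints S).map f)))) }
  have h (X : Gpd S) : IsPathSpace (X := X.obj) (P := (L.obj X).obj) (e.app X)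
      (s.app X).hom ((d 0).app X).hom ((d 1).app X).hom := by
    refine (isPathSpace_iff (e.app X) _ _ _).2 ⟨?_, ?_, ?_⟩
    · change (gpdPoints S).map ((gpdPoints S).preimage _) ≫ e.hom.app X = _
      rw [Functor.map_preimage, Category.assoc, hinv]
      exact Category.comp_id _
    · exact (gpdPoints S).map_preimage _
    · exact (gpdPoints S).map_preimage _
  exact ⟨⟨L, s, d 0, d 1, fun X => isPathObject_of_isPathSpace S (e.app X) (h X)⟩, e, h⟩

theorem isICFO_gpd [IsCategoryWithCovers S] [HasFiniteProducts (Gpd S)] :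
    IsICFO (gpdWeakEquivalences S) (gpdKanFibrations S) := by
  have hS := isCoverClass_of_isCategoryWithCovers S
  have hW := gpdWeakEquivalences_inf_gpdKanFibrations S hS
  refine
    { weq_subcategory := gpdWeakEquivalences_isMultiplicative S hS
      fib_subcategory := gpdKanFibrations_isMultiplicative S hS
      iso_mem := fun f _ => ?_
      two_out_of_three := gpdWeakEquivalences_twoOutOfThree S hS
      fib_baseChange := gpdKanFibrations_isStableUnderBaseChange S hS
      acyclic_hasPullback := fun f g hf hf' => hasPullback_of_gpdHypercovers S hS f g ?_
      acyclic_baseChange := ?_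
      exists_pathObject := ?_
      fibrant := gpdKanFibrations_terminal S }
  · change (gpdWeakEquivalences S ⊓ gpdKanFibrations S) f
    rw [hW]
    exact gpdHypercovers_of_isIso S hS f
  · rw [← hW]
    exact ⟨hf, hf'⟩
  · rw [hW]
    exact gpdHypercovers_isStableUnderBaseChange S hS
  · intro X
    obtain ⟨T, -⟩ := exists_functorialPathObject S
    exact ⟨_, _, _, _, T.isPathObject X⟩

end FibrantObjects

end HigherGpd

namespace HigherGpd

/-! ### Change of universe -/

section SizeEquiv

variable {J : Type*} [Category* J]

/-- An isomorphism between two functors whose values lie in different universes of types. -/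
structure SizeEquiv (P : J ⥤ Type w) (P' : J ⥤ Type w') where
  /-- the components -/
  equiv (j : J) : P.obj j ≃ P'.obj j
  naturality {j k : J} (g : j ⟶ k) (x : P.obj j) : equiv k (P.map g x) = P'.map g (equiv j x)

/-- The morphisms `φ` and `φ'` correspond to each other under the given identifications. -/
def Corr {P Q : J ⥤ Type w} {P' Q' : J ⥤ Type w'} (α : SizeEquiv P P') (β : SizeEquiv Q Q')
    (φ : P ⟶ Q) (φ' : P' ⟶ Q') : Prop :=
  ∀ (j : J) (x : P.obj j), β.equiv j (φ.app j x) = φ'.app j (α.equiv j x)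

variable {P Q R : J ⥤ Type w} {P' Q' R' : J ⥤ Type w'}

theorem SizeEquiv.symm_naturality (α : SizeEquiv P P') {j k : J} (g : j ⟶ k) (x : P'.obj j) :
    (α.equiv k).symm (P'.map g x) = P.map g ((α.equiv j).symm x) := by
  rw [Equiv.symm_apply_eq, α.naturality, Equiv.apply_symm_apply]

/-- The inverse identification. -/
def SizeEquiv.symm (α : SizeEquiv P P') : SizeEquiv P' P where
  equiv j := (α.equiv j).symm
  naturality := α.symm_naturality

theorem Corr.symm {α : SizeEquiv P P'} {β : SizeEquiv Q Q'} {φ : P ⟶ Q} {φ' : P' ⟶ Q'}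
    (h : Corr α β φ φ') : Corr α.symm β.symm φ' φ := by
  intro j x
  change (β.equiv j).symm _ = φ.app j ((α.equiv j).symm x)
  rw [Equiv.symm_apply_eq, h, Equiv.apply_symm_apply]

/-- Corresponding morphisms. -/
def homEquiv (α : SizeEquiv P P') (β : SizeEquiv Q Q') : (P ⟶ Q) ≃ (P' ⟶ Q') where
  toFun φ :=
    { app := fun j => ↾fun x => β.equiv j (φ.app j ((α.equiv j).symm x))
      naturality := fun j k g => by
        ext x
        change β.equiv k (φ.app k ((α.equiv k).symm (P'.map g x))) =
          Q'.map g (β.equiv j (φ.app j ((α.equiv j).symm x)))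
        rw [α.symm_naturality, NatTrans.naturality_apply, β.naturality] }
  invFun φ' :=
    { app := fun j => ↾fun x => (β.equiv j).symm (φ'.app j (α.equiv j x))
      naturality := fun j k g => by
        ext x
        change (β.equiv k).symm (φ'.app k (α.equiv k (P.map g x))) =
          Q.map g ((β.equiv j).symm (φ'.app j (α.equiv j x)))
        rw [α.naturality, NatTrans.naturality_apply, β.symm_naturality] }
  left_inv φ := by
    ext j x
    exact ((β.equiv j).symm_apply_apply _).trans
      (congrArg (φ.app j) ((α.equiv j).symm_apply_apply x))
  right_inv φ' := by
    ext j x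
    exact ((β.equiv j).apply_symm_apply _).trans
      (congrArg (φ'.app j) ((α.equiv j).apply_symm_apply x))

theorem corr_homEquiv (α : SizeEquiv P P') (β : SizeEquiv Q Q') (φ : P ⟶ Q) :
    Corr α β φ (homEquiv α β φ) :=
  fun j x => (congrArg (fun y => β.equiv j (φ.app j y)) ((α.equiv j).symm_apply_apply x)).symm

theorem Corr.eq {α : SizeEquiv P P'} {β : SizeEquiv Q Q'} {φ : P ⟶ Q} {φ' : P' ⟶ Q'}
    (h : Corr α β φ φ') : homEquiv α β φ = φ' := by
  ext j x
  exact (h j _).trans (congrArg (φ'.app j) ((α.equiv j).apply_symm_apply x))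

theorem Corr.comp {α : SizeEquiv P P'} {β : SizeEquiv Q Q'} {γ : SizeEquiv R R'} {φ : P ⟶ Q}
    {φ' : P' ⟶ Q'} {ψ : Q ⟶ R} {ψ' : Q' ⟶ R'} (h : Corr α β φ φ') (h' : Corr β γ ψ ψ') :
    Corr α γ (φ ≫ ψ) (φ' ≫ ψ') :=
  fun j x => (h' j _).trans (congrArg (ψ'.app j) (h j x))

variable {E : Type u} [Category.{v} E] {S : MorphismProperty E}

/-- Relative covers do not depend on the universe in which presheaves take their values. -/
theorem RelCover.of_corr {P Q : Eᵒᵖ ⥤ Type w} {P' Q' : Eᵒᵖ ⥤ Type w'} {α : SizeEquiv P P'}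
    {β : SizeEquiv Q Q'} {φ : P ⟶ Q} {φ' : P' ⟶ Q'} (h : Corr α β φ φ') (hφ : RelCover S φ) :
    RelCover S φ' := by
  intro U q
  obtain ⟨V, g, p, hg, hp⟩ := hφ ((β.equiv _).symm q)
  refine ⟨V, g, α.equiv _ p, hg, ?_, fun {T} k p' hp' => ?_⟩
  · rw [← h, hp.app_eq, β.naturality, Equiv.apply_symm_apply]
  · obtain ⟨l, ⟨hl, hl'⟩, hu⟩ := hp.existsUnique k ((α.equiv _).symm p') (by
      refine (h.symm _ p').symm.trans ?_
      rw [hp']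
      exact β.symm_naturality _ _)
    refine ⟨l, ⟨hl, by rw [← α.naturality, hl', Equiv.apply_symm_apply]⟩, fun m hm => hu m
      ⟨hm.1, ?_⟩⟩
    rw [Equiv.eq_symm_apply, α.naturality, hm.2]

/-- An isomorphism between two simplicial presheaves whose values lie in different universes. -/
structure SizeIso (X : Eᵒᵖ ⥤ SSet.{w}) (X' : Eᵒᵖ ⥤ SSet.{w'}) where
  /-- the components -/
  equiv (U : Eᵒᵖ) : SizeEquiv (X.obj U) (X'.obj U)
  naturality {U V : Eᵒᵖ} (g : U ⟶ V) : Corr (equiv U) (equiv V) (X.map g) (X'.map g)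

/-- The morphisms `f` and `f'` of simplicial presheaves correspond to each other under the given
identifications. -/
def CorrHom {X Y : Eᵒᵖ ⥤ SSet.{w}} {X' Y' : Eᵒᵖ ⥤ SSet.{w'}} (a : SizeIso X X')
    (b : SizeIso Y Y') (f : X ⟶ Y) (f' : X' ⟶ Y') : Prop :=
  ∀ U, Corr (a.equiv U) (b.equiv U) (f.app U) (f'.app U)

/-- The inverse identification. -/
def SizeIso.symm {X : Eᵒᵖ ⥤ SSet.{w}} {X' : Eᵒᵖ ⥤ SSet.{w'}} (a : SizeIso X X') :
    SizeIso X' X where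
  equiv U := (a.equiv U).symm
  naturality g := (a.naturality g).symm

theorem CorrHom.symm {X Y : Eᵒᵖ ⥤ SSet.{w}} {X' Y' : Eᵒᵖ ⥤ SSet.{w'}} {a : SizeIso X X'}
    {b : SizeIso Y Y'} {f : X ⟶ Y} {f' : X' ⟶ Y'} (h : CorrHom a b f f') :
    CorrHom a.symm b.symm f' f :=
  fun U => (h U).symm

theorem CorrHom.comp {X Y Z : Eᵒᵖ ⥤ SSet.{w}} {X' Y' Z' : Eᵒᵖ ⥤ SSet.{w'}} {a : SizeIso X X'}
    {b : SizeIso Y Y'} {c : SizeIso Z Z'} {f : X ⟶ Y} {f' : X' ⟶ Y'} {g : Y ⟶ Z} {g' : Y' ⟶ Z'}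
    (h : CorrHom a b f f') (h' : CorrHom b c g g') : CorrHom a c (f ≫ g) (f' ≫ g') :=
  fun U => (h U).comp (h' U)

/-- Lifting conditions do not depend on the universe in which simplicial presheaves take their
values. -/
theorem LiftCover.of_corr {X Y : Eᵒᵖ ⥤ SSet.{w}} {X' Y' : Eᵒᵖ ⥤ SSet.{w'}} {a : SizeIso X X'}
    {b : SizeIso Y Y'} {f : X ⟶ Y} {f' : X' ⟶ Y'} (h : CorrHom a b f f') {A B : SSet.{w}}
    {A' B' : SSet.{w'}} (α : SizeEquiv A A') (β : SizeEquiv B B') {i : A ⟶ B} {i' : A' ⟶ B'}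
    (hi : Corr α β i i') (hf : LiftCover S i f) : LiftCover S i' f' := by
  let σ : SizeEquiv (squares i f) (squares i' f') :=
    { equiv := fun U => Equiv.subtypeEquiv
        (Equiv.prodCongr (homEquiv α (a.equiv U)) (homEquiv β (b.equiv U))) fun p => by
          change _ ↔ homEquiv α (a.equiv U) p.1 ≫ f'.app U = i' ≫ homEquiv β (b.equiv U) p.2
          rw [← ((corr_homEquiv α (a.equiv U) p.1).comp (h U)).eq,
            ← (hi.comp (corr_homEquiv β (b.equiv U) p.2)).eq, (homEquiv _ _).apply_eq_iff_eq]
      naturality := fun {U V} g p => squares_ext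
        ((corr_homEquiv α (a.equiv U) p.1.1).comp (a.naturality g)).eq
        ((corr_homEquiv β (b.equiv U) p.1.2).comp (b.naturality g)).eq }
  refine RelCover.of_corr (α := (⟨fun U => homEquiv β (a.equiv U), fun {U V} g l =>
    ((corr_homEquiv β (a.equiv U) l).comp (a.naturality g)).eq⟩ :
      SizeEquiv (homPresheaf B X) (homPresheaf B' X'))) (β := σ) ?_ hf
  intro U l
  exact squares_ext (hi.comp (corr_homEquiv β (a.equiv U) l)).eq
    ((corr_homEquiv β (a.equiv U) l).comp (h U)).eq

/-- The standard simplices in different universes. -/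
def simplexSizeEquiv (n : SimplexCategory) :
    SizeEquiv (SSet.stdSimplex.{w}.obj n) (SSet.stdSimplex.{w'}.obj n) where
  equiv _ := SSet.stdSimplex.objEquiv.trans SSet.stdSimplex.objEquiv.symm
  naturality _ _ := rfl

/-- The horns in different universes. -/
def hornSizeEquiv (n : ℕ) (k : Fin (n + 1)) :
    SizeEquiv (Λ[n, k] : SSet.{w}) (Λ[n, k] : SSet.{w'}) where
  equiv j := Equiv.subtypeEquiv ((simplexSizeEquiv _).equiv j) fun _ => Iff.rfl
  naturality _ _ := rfl

/-- The boundaries in different universes. -/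
def boundarySizeEquiv (n : ℕ) : SizeEquiv (∂Δ[n] : SSet.{w}) (∂Δ[n] : SSet.{w'}) where
  equiv j := Equiv.subtypeEquiv ((simplexSizeEquiv _).equiv j) fun _ => Iff.rfl
  naturality _ _ := rfl

theorem hyper.of_corr {X Y : Eᵒᵖ ⥤ SSet.{w}} {X' Y' : Eᵒᵖ ⥤ SSet.{w'}} {a : SizeIso X X'}
    {b : SizeIso Y Y'} {f : X ⟶ Y} {f' : X' ⟶ Y'} (h : CorrHom a b f f') (hf : hyper S f) :
    hyper S f' :=
  fun n => (hf n).of_corr h (boundarySizeEquiv n) (simplexSizeEquiv _) fun _ _ => rfl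

theorem kan.of_corr {X Y : Eᵒᵖ ⥤ SSet.{w}} {X' Y' : Eᵒᵖ ⥤ SSet.{w'}} {a : SizeIso X X'}
    {b : SizeIso Y Y'} {f : X ⟶ Y} {f' : X' ⟶ Y'} (h : CorrHom a b f f') (hf : kan S f) :
    kan S f' :=
  fun n k => (hf n k).of_corr h (hornSizeEquiv _ k) (simplexSizeEquiv _) fun _ _ => rfl

theorem kan.toUnit_of_sizeIso {X : Eᵒᵖ ⥤ SSet.{w}} {X' : Eᵒᵖ ⥤ SSet.{w'}} (a : SizeIso X X')
    (hX : kan S (toUnit X)) : kan S (toUnit X') :=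
  kan.of_corr (a := a) (b := ⟨fun _ => ⟨fun _ => (Equiv.refl PUnit).trans Equiv.punitEquivPUnit,
    fun _ _ => rfl⟩, fun _ _ _ => rfl⟩) (fun _ _ _ => rfl) hX

/-- The prisms in different universes. -/
def prismSizeEquiv (n : SimplexCategory) :
    SizeEquiv (SSet.stdSimplex.{w}.obj n ⊗ Δ[1]) (SSet.stdSimplex.{w'}.obj n ⊗ Δ[1]) where
  equiv j := Equiv.prodCongr ((simplexSizeEquiv n).equiv j) ((simplexSizeEquiv ⦋1⦌).equiv j)
  naturality _ _ := rfl

/-- The path spaces of identified simplicial sets. -/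
noncomputable def SizeEquiv.path {K : SSet.{w}} {K' : SSet.{w'}} (κ : SizeEquiv K K') :
    SizeEquiv (pathSSet.obj K) (pathSSet.obj K') where
  equiv j := homEquiv (prismSizeEquiv j.unop) κ
  naturality {j k} g x := (Corr.comp (α := prismSizeEquiv k.unop)
    (φ' := SSet.stdSimplex.map g.unop ▷ Δ[1]) (fun _ _ => rfl)
    (corr_homEquiv (prismSizeEquiv j.unop) κ x)).eq

/-- The path presheaves of identified simplicial presheaves. -/
noncomputable def SizeIso.path {X : Eᵒᵖ ⥤ SSet.{w}} {X' : Eᵒᵖ ⥤ SSet.{w'}} (a : SizeIso X X') :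
    SizeIso (pathPresheaf.obj X) (pathPresheaf.obj X') where
  equiv U := (a.equiv U).path
  naturality {U _} g _ x := ((corr_homEquiv (prismSizeEquiv _) (a.equiv U) x).comp
    (a.naturality g)).eq

theorem corrHom_pathEnd {X : Eᵒᵖ ⥤ SSet.{w}} {X' : Eᵒᵖ ⥤ SSet.{w'}} (a : SizeIso X X')
    (ε : Fin 2) : CorrHom a.path a (pathEnd ε X) (pathEnd ε X') := by
  intro U j x
  exact corr_homEquiv (simplexSizeEquiv j.unop) (a.equiv U) (cylinderEnd ε _ ≫ x)
    j (SSet.stdSimplex.objEquiv.symm (𝟙 _))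

/-- Pullbacks of simplicial presheaves are computed elementwise. -/
theorem existsUnique_of_isPullback {P X Y Z : Eᵒᵖ ⥤ SSet.{w}} {p : P ⟶ X} {q : P ⟶ Y} {f : X ⟶ Z}
    {g : Y ⟶ Z} (sq : IsPullback p q f g) (U : Eᵒᵖ) (j : SimplexCategoryᵒᵖ)
    (x : (X.obj U).obj j) (y : (Y.obj U).obj j) (h : (f.app U).app j x = (g.app U).app j y) :
    ∃! z : (P.obj U).obj j, (p.app U).app j z = x ∧ (q.app U).app j z = y := by
  have sq' := (sq.map ((evaluation _ _).obj U)).map ((evaluation _ _).obj j)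
  obtain ⟨z, hz₁, hz₂⟩ := Types.exists_of_isPullback sq' x y h
  exact ⟨z, ⟨hz₁, hz₂⟩, fun z' hz' => Types.ext_of_isPullback sq' (hz'.1.trans hz₁.symm)
    (hz'.2.trans hz₂.symm)⟩

/-- Fibre products of corresponding morphisms correspond. -/
theorem exists_sizeIso_of_isPullback {P X Y Z : Eᵒᵖ ⥤ SSet.{w}} {p : P ⟶ X} {q : P ⟶ Y}
    {f : X ⟶ Z} {g : Y ⟶ Z} (sq : IsPullback p q f g) {P' X' Y' Z' : Eᵒᵖ ⥤ SSet.{w'}}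
    {p' : P' ⟶ X'} {q' : P' ⟶ Y'} {f' : X' ⟶ Z'} {g' : Y' ⟶ Z'} (sq' : IsPullback p' q' f' g')
    {a : SizeIso X X'} {b : SizeIso Y Y'} {c : SizeIso Z Z'} (hf : CorrHom a c f f')
    (hg : CorrHom b c g g') : ∃ d : SizeIso P P', CorrHom d a p p' ∧ CorrHom d b q q' := by
  have key (U : Eᵒᵖ) (j : SimplexCategoryᵒᵖ) (z : (P.obj U).obj j) := existsUnique_of_isPullback sq'
    U j ((a.equiv U).equiv j ((p.app U).app j z)) ((b.equiv U).equiv j ((q.app U).app j z))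
    ((hf U j _).symm.trans ((congrArg ((c.equiv U).equiv j)
      (congr(($(sq.w).app U).app j z))).trans (hg U j _)))
  choose t ht ht' using key
  have hnat₁ {U : Eᵒᵖ} {j k : SimplexCategoryᵒᵖ} (g : j ⟶ k) (z : (P.obj U).obj j) :
      t U k ((P.obj U).map g z) = (P'.obj U).map g (t U j z) := by
    refine (ht' U k _ _ ⟨?_, ?_⟩).symm
    · rw [NatTrans.naturality_apply, NatTrans.naturality_apply, (a.equiv U).naturality,
        (ht U j z).1]
    · rw [NatTrans.naturality_apply, NatTrans.naturality_apply, (b.equiv U).naturality,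
        (ht U j z).2]
  have hnat₂ {U V : Eᵒᵖ} (g : U ⟶ V) (j : SimplexCategoryᵒᵖ) (z : (P.obj U).obj j) :
      t V j ((P.map g).app j z) = (P'.map g).app j (t U j z) := by
    refine (ht' V j _ _ ⟨?_, ?_⟩).symm
    · refine (congr(($(p'.naturality g)).app j (t U j z))).trans ?_
      refine (congrArg ((X'.map g).app j) (ht U j z).1).trans ?_
      refine (a.naturality g j _).symm.trans (congrArg _ ?_)
      exact (congr(($(p.naturality g)).app j z)).symm
    · refine (congr(($(q'.naturality g)).app j (t U j z))).trans ?_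
      refine (congrArg ((Y'.map g).app j) (ht U j z).2).trans ?_
      refine (b.naturality g j _).symm.trans (congrArg _ ?_)
      exact (congr(($(q.naturality g)).app j z)).symm
  have hbij (U : Eᵒᵖ) (j : SimplexCategoryᵒᵖ) : Function.Bijective (t U j) := by
    constructor
    · intro z z' h
      have h₁ := (ht U j z).1.symm.trans ((congrArg ((p'.app U).app j) h).trans (ht U j z').1)
      have h₂ := (ht U j z).2.symm.trans ((congrArg ((q'.app U).app j) h).trans (ht U j z').2)
      exact (existsUnique_of_isPullback sq U j _ _ (congr(($(sq.w).app U).app j z'))).unique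
        ⟨((a.equiv U).equiv j).injective h₁, ((b.equiv U).equiv j).injective h₂⟩ ⟨rfl, rfl⟩
    · intro z'
      have hw : ((f'.app U).app j ((p'.app U).app j z')) = (g'.app U).app j ((q'.app U).app j z') :=
        congr(($(sq'.w).app U).app j z')
      obtain ⟨z, ⟨hz₁, hz₂⟩, -⟩ := existsUnique_of_isPullback sq U j
        (((a.equiv U).equiv j).symm ((p'.app U).app j z'))
        (((b.equiv U).equiv j).symm ((q'.app U).app j z'))
        ((hf.symm U j _).symm.trans ((congrArg _ hw).trans (hg.symm U j _)))
      exact ⟨z, (ht' U j z z' ⟨by rw [hz₁, Equiv.apply_symm_apply],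
        by rw [hz₂, Equiv.apply_symm_apply]⟩).symm⟩
  exact ⟨⟨fun U => ⟨fun j => Equiv.ofBijective _ (hbij U j), hnat₁⟩, fun g j z => hnat₂ g j z⟩,
    fun U j z => (ht U j z).1.symm, fun U j z => (ht U j z).2.symm⟩

theorem weak.of_corr {X Y : Eᵒᵖ ⥤ SSet.{w}} {X' Y' : Eᵒᵖ ⥤ SSet.{w'}}
    {a : SizeIso X X'} {b : SizeIso Y Y'} {f : X ⟶ Y} {f' : X' ⟶ Y'} (h : CorrHom a b f f')
    (hf : weak S f) : weak S f' := by
  obtain ⟨d, -, hd⟩ := exists_sizeIso_of_isPullback (IsPullback.of_hasPullback f (pathEnd 0 Y))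
    (IsPullback.of_hasPullback f' (pathEnd 0 Y')) h (corrHom_pathEnd b 0)
  exact hyper.of_corr (hd.comp (corrHom_pathEnd b 1)) hf

end SizeEquiv

end HigherGpd

namespace HigherGpd

/-! ### The collage of a functor -/

section Collage

variable {C : Type u} [Category.{v} C] {D : Type u'} [Category.{v'} D]

/-- The objects of the collage of `F : C ⥤ D`: the disjoint union of the objects of `C` and `D`. -/
inductive Collage (F : C ⥤ D) : Type (max u u') where
  | ofLeft (X : C)
  | ofRight (Y : D)

variable (F : C ⥤ D)

namespace Collage

/-- The morphisms of the collage are those of `C`, those of `D`, and the morphisms from `Y` to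
`F.obj X` as morphisms from `ofRight Y` to `ofLeft X`. -/
def Hom (X Y : Collage F) : Type (max v v') := match X, Y with
  | ofLeft X, ofLeft Y => ULift.{v'} (X ⟶ Y)
  | ofLeft _, ofRight _ => PEmpty
  | ofRight X, ofLeft Y => ULift.{v} (X ⟶ F.obj Y)
  | ofRight X, ofRight Y => ULift.{v} (X ⟶ Y)

instance : Category.{max v v'} (Collage F) where
  Hom := Hom F
  id X := match X with
    | ofLeft X => ⟨𝟙 X⟩
    | ofRight X => ⟨𝟙 X⟩
  comp {X Y Z} f g := match X, Y, Z, f, g with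
    | ofLeft _, ofLeft _, ofLeft _, f, g => ⟨f.down ≫ g.down⟩
    | ofRight _, ofLeft _, ofLeft _, f, g => ⟨f.down ≫ F.map g.down⟩
    | ofRight _, ofRight _, ofLeft _, f, g => ⟨f.down ≫ g.down⟩
    | ofRight _, ofRight _, ofRight _, f, g => ⟨f.down ≫ g.down⟩
  id_comp {X Y} f := match X, Y, f with
    | ofLeft _, ofLeft _, _ => congrArg ULift.up (Category.id_comp _)
    | ofRight _, ofLeft _, _ => congrArg ULift.up (Category.id_comp _)
    | ofRight _, ofRight _, _ => congrArg ULift.up (Category.id_comp _)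
  comp_id {X Y} f := match X, Y, f with
    | ofLeft _, ofLeft _, _ => congrArg ULift.up (Category.comp_id _)
    | ofRight _, ofLeft _, f => congrArg ULift.up
        ((congrArg (f.down ≫ ·) (F.map_id _)).trans (Category.comp_id _))
    | ofRight _, ofRight _, _ => congrArg ULift.up (Category.comp_id _)
  assoc {X Y Z W} f g h := match X, Y, Z, W, f, g, h with
    | ofLeft _, ofLeft _, ofLeft _, ofLeft _, _, _, _ => congrArg ULift.up (Category.assoc _ _ _)
    | ofRight _, ofLeft _, ofLeft _, ofLeft _, f, _, _ =>
        congrArg ULift.up ((Category.assoc _ _ _).trans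
          (congrArg (f.down ≫ ·) (F.map_comp _ _).symm))
    | ofRight _, ofRight _, ofLeft _, ofLeft _, _, _, _ => congrArg ULift.up (Category.assoc _ _ _)
    | ofRight _, ofRight _, ofRight _, ofLeft _, _, _, _ => congrArg ULift.up (Category.assoc _ _ _)
    | ofRight _, ofRight _, ofRight _, ofRight _, _, _, _ =>
        congrArg ULift.up (Category.assoc _ _ _)

/-- The inclusion of `C` into the collage. -/
def left : C ⥤ Collage F where
  obj := ofLeft
  map f := ULift.up f
  map_id _ := rfl
  map_comp _ _ := rfl

/-- The inclusion of `D` into the collage. -/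
def right : D ⥤ Collage F where
  obj := ofRight
  map f := ULift.up f
  map_id _ := rfl
  map_comp _ _ := rfl

/-- The tautological morphism from `F.obj X` to `X`. -/
def glue (X : C) : (right F).obj (F.obj X) ⟶ (left F).obj X := ULift.up (𝟙 (F.obj X))

variable {F}

theorem false_of_left_right {X : C} {Y : D} (f : (left F).obj X ⟶ (right F).obj Y) : False :=
  PEmpty.elim f

theorem left_map_surjective {X Y : C} (f : (left F).obj X ⟶ (left F).obj Y) :
    ∃ g : X ⟶ Y, f = (left F).map g := ⟨ULift.down f, rfl⟩

theorem right_map_surjective {X Y : D} (f : (right F).obj X ⟶ (right F).obj Y) :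
    ∃ g : X ⟶ Y, f = (right F).map g := ⟨ULift.down f, rfl⟩

theorem left_map_injective {X Y : C} {f g : X ⟶ Y} (h : (left F).map f = (left F).map g) : f = g :=
  congrArg ULift.down h

theorem right_map_injective {X Y : D} {f g : X ⟶ Y} (h : (right F).map f = (right F).map g) :
    f = g :=
  congrArg ULift.down h

theorem exists_eq_comp_glue {X : D} {Y : C} (f : (right F).obj X ⟶ (left F).obj Y) :
    ∃ g : X ⟶ F.obj Y, f = (right F).map g ≫ glue F Y :=
  ⟨ULift.down f, congrArg ULift.up (Category.comp_id _).symm⟩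

theorem comp_glue_injective {X : D} {Y : C} {f g : X ⟶ F.obj Y}
    (h : (right F).map f ≫ glue F Y = (right F).map g ≫ glue F Y) : f = g :=
  (Category.comp_id f).symm.trans ((congrArg ULift.down h).trans (Category.comp_id g))

theorem glue_naturality {X Y : C} (f : X ⟶ Y) :
    glue F X ≫ (left F).map f = (right F).map (F.map f) ≫ glue F Y :=
  congrArg ULift.up ((Category.id_comp _).trans (Category.comp_id _).symm)

theorem exists_eq (X : Collage F) : (∃ Y, X = (left F).obj Y) ∨ ∃ Y, X = (right F).obj Y :=
  match X with
    | ofLeft Y => .inl ⟨Y, rfl⟩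
    | ofRight Y => .inr ⟨Y, rfl⟩

variable (F) in
/-- The covers of the collage are the covers of `C` and the covers of `D`. -/
def covers (SC : MorphismProperty C) (SD : MorphismProperty D) : MorphismProperty (Collage F) :=
  SC.strictMap (left F) ⊔ SD.strictMap (right F)

end Collage

theorem isPullback_of_existsUnique {E : Type*} [Category* E] {P X Y Z : E} {a : P ⟶ X} {b : P ⟶ Y}
    {f : X ⟶ Z} {g : Y ⟶ Z} (w : a ≫ f = b ≫ g) (h : ∀ {T : E} (x : T ⟶ X) (y : T ⟶ Y),
      x ≫ f = y ≫ g → ∃! t : T ⟶ P, t ≫ a = x ∧ t ≫ b = y) : IsPullback a b f g :=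
  ⟨⟨w⟩, ⟨PullbackCone.IsLimit.mk w (fun s => (h s.fst s.snd s.condition).choose)
    (fun s => (h s.fst s.snd s.condition).choose_spec.1.1)
    (fun s => (h s.fst s.snd s.condition).choose_spec.1.2)
    (fun s m hm hm' => (h s.fst s.snd s.condition).choose_spec.2 m ⟨hm, hm'⟩)⟩⟩

namespace Collage

variable {F} {SC : MorphismProperty C} {SD : MorphismProperty D}

theorem covers_left {X Y : C} {f : X ⟶ Y} (hf : SC f) : covers F SC SD ((left F).map f) :=
  .inl ⟨hf⟩

theorem covers_right {X Y : D} {f : X ⟶ Y} (hf : SD f) : covers F SC SD ((right F).map f) :=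
  .inr ⟨hf⟩

theorem covers_left_iff {X Y : C} (f : X ⟶ Y) : covers F SC SD ((left F).map f) ↔ SC f := by
  refine ⟨fun h => ?_, covers_left⟩
  generalize hg : (left F).map f = g at h
  obtain ⟨⟨hf⟩⟩ | ⟨⟨hf⟩⟩ := h
  · exact left_map_injective hg ▸ hf

theorem covers_right_iff {X Y : D} (f : X ⟶ Y) : covers F SC SD ((right F).map f) ↔ SD f := by
  refine ⟨fun h => ?_, covers_right⟩
  generalize hg : (right F).map f = g at h
  obtain ⟨⟨hf⟩⟩ | ⟨⟨hf⟩⟩ := h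
  · exact right_map_injective hg ▸ hf

theorem not_covers_right_left {X : D} {Y : C} (f : (right F).obj X ⟶ (left F).obj Y) :
    ¬ covers F SC SD f := by
  rintro (⟨⟨⟩⟩ | ⟨⟨⟩⟩)

/-- Pullbacks of covers in `C` are pullbacks in the collage, because `F` preserves them. -/
theorem isPullback_left (hF : IsGeometric SC SD F) {P X Y Z : C} {a : P ⟶ X} {b : P ⟶ Y}
    {f : X ⟶ Z} {g : Y ⟶ Z} (sq : IsPullback a b f g) (hf : SC f) :
    IsPullback ((left F).map a) ((left F).map b) ((left F).map f) ((left F).map g) := by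
  refine isPullback_of_existsUnique (by rw [← Functor.map_comp, sq.w, Functor.map_comp]) ?_
  intro T x y h
  obtain ⟨T, rfl⟩ | ⟨T, rfl⟩ := T.exists_eq
  · obtain ⟨x, rfl⟩ := left_map_surjective x
    obtain ⟨y, rfl⟩ := left_map_surjective y
    rw [← Functor.map_comp, ← Functor.map_comp] at h
    refine ⟨(left F).map (sq.lift x y (left_map_injective h)), ⟨?_, ?_⟩, fun t ht => ?_⟩
    · rw [← Functor.map_comp, sq.lift_fst]
    · rw [← Functor.map_comp, sq.lift_snd]
    · obtain ⟨t, rfl⟩ := left_map_surjective t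
      rw [← Functor.map_comp, ← Functor.map_comp] at ht
      refine congrArg _ (sq.hom_ext ?_ ?_)
      · rw [left_map_injective ht.1, sq.lift_fst]
      · rw [left_map_injective ht.2, sq.lift_snd]
  · have sq' := hF.map_isPullback sq hf
    obtain ⟨x, rfl⟩ := exists_eq_comp_glue x
    obtain ⟨y, rfl⟩ := exists_eq_comp_glue y
    rw [Category.assoc, Category.assoc, glue_naturality, glue_naturality, ← Category.assoc,
      ← Category.assoc, ← Functor.map_comp, ← Functor.map_comp] at h
    refine ⟨(right F).map (sq'.lift x y (comp_glue_injective h)) ≫ glue F P, ⟨?_, ?_⟩,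
      fun t ht => ?_⟩
    · rw [Category.assoc, glue_naturality, ← Category.assoc, ← Functor.map_comp, sq'.lift_fst]
    · rw [Category.assoc, glue_naturality, ← Category.assoc, ← Functor.map_comp, sq'.lift_snd]
    · obtain ⟨t, rfl⟩ := exists_eq_comp_glue t
      rw [Category.assoc, Category.assoc, glue_naturality, glue_naturality, ← Category.assoc,
        ← Category.assoc, ← Functor.map_comp, ← Functor.map_comp] at ht
      refine congrArg (fun t => (right F).map t ≫ glue F P) (sq'.hom_ext ?_ ?_)
      · rw [comp_glue_injective ht.1, sq'.lift_fst]
      · rw [comp_glue_injective ht.2, sq'.lift_snd]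

/-- The inclusion of `D` into the collage preserves pullbacks, since no morphism leads from `C` to
`D`. -/
theorem isPullback_right {P X Y Z : D} {a : P ⟶ X} {b : P ⟶ Y} {f : X ⟶ Z} {g : Y ⟶ Z}
    (sq : IsPullback a b f g) :
    IsPullback ((right F).map a) ((right F).map b) ((right F).map f) ((right F).map g) := by
  refine isPullback_of_existsUnique (by rw [← Functor.map_comp, sq.w, Functor.map_comp]) ?_
  intro T x y h
  obtain ⟨T, rfl⟩ | ⟨T, rfl⟩ := T.exists_eq
  · exact (false_of_left_right x).elim
  · obtain ⟨x, rfl⟩ := right_map_surjective x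
    obtain ⟨y, rfl⟩ := right_map_surjective y
    rw [← Functor.map_comp, ← Functor.map_comp] at h
    refine ⟨(right F).map (sq.lift x y (right_map_injective h)), ⟨?_, ?_⟩, fun t ht => ?_⟩
    · rw [← Functor.map_comp, sq.lift_fst]
    · rw [← Functor.map_comp, sq.lift_snd]
    · obtain ⟨t, rfl⟩ := right_map_surjective t
      rw [← Functor.map_comp, ← Functor.map_comp] at ht
      refine congrArg _ (sq.hom_ext ?_ ?_)
      · rw [right_map_injective ht.1, sq.lift_fst]
      · rw [right_map_injective ht.2, sq.lift_snd]

/-- The base change of a morphism of `C` along a morphism from an object of `D` is computed in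
`D`. -/
theorem isPullback_glue {P Y : D} {X Z : C} {f : X ⟶ Z} {a : P ⟶ F.obj X} {b : P ⟶ Y}
    {g : Y ⟶ F.obj Z} (sq : IsPullback a b (F.map f) g) :
    IsPullback ((right F).map a ≫ glue F X) ((right F).map b) ((left F).map f)
      ((right F).map g ≫ glue F Z) := by
  refine isPullback_of_existsUnique ?_ ?_
  · rw [Category.assoc, glue_naturality, ← Category.assoc, ← Category.assoc, ← Functor.map_comp,
      ← Functor.map_comp, sq.w]
  intro T x y h
  obtain ⟨T, rfl⟩ | ⟨T, rfl⟩ := T.exists_eq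
  · exact (false_of_left_right y).elim
  · obtain ⟨x, rfl⟩ := exists_eq_comp_glue x
    obtain ⟨y, rfl⟩ := right_map_surjective y
    rw [Category.assoc, glue_naturality, ← Category.assoc, ← Category.assoc, ← Functor.map_comp,
      ← Functor.map_comp] at h
    refine ⟨(right F).map (sq.lift x y (comp_glue_injective h)), ⟨?_, ?_⟩, fun t ht => ?_⟩
    · rw [← Category.assoc, ← Functor.map_comp, sq.lift_fst]
    · rw [← Functor.map_comp, sq.lift_snd]
    · obtain ⟨t, rfl⟩ := right_map_surjective t
      rw [← Category.assoc, ← Functor.map_comp, ← Functor.map_comp] at ht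
      refine congrArg _ (sq.hom_ext ?_ ?_)
      · rw [comp_glue_injective ht.1, sq.lift_fst]
      · rw [right_map_injective ht.2, sq.lift_snd]

/-- The covers of the collage of a geometric functor form a class of covers. -/
theorem isCoverClass (hC : IsCoverClass SC) (hD : IsCoverClass SD) (hF : IsGeometric SC SD F) :
    IsCoverClass (covers F SC SD) where
  iso_mem := by
    intro X Y f hf
    obtain ⟨X, rfl⟩ | ⟨X, rfl⟩ := X.exists_eq <;> obtain ⟨Y, rfl⟩ | ⟨Y, rfl⟩ := Y.exists_eq
    · obtain ⟨g, rfl⟩ := left_map_surjective f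
      obtain ⟨k, hk⟩ := left_map_surjective (inv ((left F).map g))
      have h₁ := IsIso.hom_inv_id ((left F).map g)
      have h₂ := IsIso.inv_hom_id ((left F).map g)
      rw [hk] at h₁ h₂
      exact covers_left (hC.iso_mem _ ⟨k, left_map_injective h₁, left_map_injective h₂⟩)
    · exact (false_of_left_right f).elim
    · exact (false_of_left_right (inv f)).elim
    · obtain ⟨g, rfl⟩ := right_map_surjective f
      obtain ⟨k, hk⟩ := right_map_surjective (inv ((right F).map g))
      have h₁ := IsIso.hom_inv_id ((right F).map g)
      have h₂ := IsIso.inv_hom_id ((right F).map g)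
      rw [hk] at h₁ h₂
      exact covers_right (hD.iso_mem _ ⟨k, right_map_injective h₁, right_map_injective h₂⟩)
  comp_mem := by
    rintro X Y Z f g (@⟨X, Y, f, hf⟩ | @⟨X, Y, f, hf⟩) hg <;>
      obtain ⟨Z, rfl⟩ | ⟨Z, rfl⟩ := Z.exists_eq
    · obtain ⟨g, rfl⟩ := left_map_surjective g
      rw [← Functor.map_comp]
      exact covers_left (hC.comp_mem _ _ hf ((covers_left_iff _).1 hg))
    · exact (false_of_left_right g).elim
    · exact (not_covers_right_left _ hg).elim
    · obtain ⟨g, rfl⟩ := right_map_surjective g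
      rw [← Functor.map_comp]
      exact covers_right (hD.comp_mem _ _ hf ((covers_right_iff _).1 hg))
  cancel := by
    rintro X Y Z f g (@⟨X, Y, f, hf⟩ | @⟨X, Y, f, hf⟩) hg <;>
      obtain ⟨Z, rfl⟩ | ⟨Z, rfl⟩ := Z.exists_eq
    · obtain ⟨g, rfl⟩ := left_map_surjective g
      rw [← Functor.map_comp] at hg
      exact covers_left (hC.cancel _ _ hf ((covers_left_iff _).1 hg))
    · exact (false_of_left_right g).elim
    · exact (not_covers_right_left _ hg).elim
    · obtain ⟨g, rfl⟩ := right_map_surjective g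
      rw [← Functor.map_comp] at hg
      exact covers_right (hD.cancel _ _ hf ((covers_right_iff _).1 hg))
  exists_isPullback := by
    intro X Y Z f g h
    obtain ⟨Y, rfl⟩ | ⟨Y, rfl⟩ := Y.exists_eq <;> obtain ⟨⟨hf⟩⟩ | ⟨⟨hf⟩⟩ := h
    · obtain ⟨g, rfl⟩ := left_map_surjective g
      obtain ⟨P, a, b, sq, hb⟩ := hC.exists_isPullback _ g hf
      exact ⟨_, _, _, isPullback_left hF sq hf, covers_left hb⟩
    · exact (false_of_left_right g).elim
    · obtain ⟨g, rfl⟩ := exists_eq_comp_glue g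
      obtain ⟨P, a, b, sq, hb⟩ := hD.exists_isPullback _ g (hF.map_cover _ hf)
      exact ⟨_, _, _, isPullback_glue sq, covers_right hb⟩
    · obtain ⟨g, rfl⟩ := right_map_surjective g
      obtain ⟨P, a, b, sq, hb⟩ := hD.exists_isPullback _ g hf
      exact ⟨_, _, _, isPullback_right sq, covers_right hb⟩

end Collage

end Collage

end HigherGpd

namespace HigherGpd

/-! ### Restriction of simplicial presheaves along the two inclusions into the collage -/

section Restriction

variable {C : Type u} [Category.{v} C] {D : Type u'} [Category.{v'} D] {F : C ⥤ D}

open Collage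

/-- A presheaf on the collage that is represented by an object of `C`. -/
def IsLeftRep (P : (Collage F)ᵒᵖ ⥤ Type w) : Prop :=
  ∃ (M : C) (p : P.obj (op ((left F).obj M))), IsUniversal p

/-- A representable presheaf with an element over some object of `C` is represented by an object of
`C`, since no morphism leads from `C` to `D`. -/
theorem IsRep.isLeftRep {P : (Collage F)ᵒᵖ ⥤ Type w} (hP : IsRep P) {N : C}
    (q : P.obj (op ((left F).obj N))) : IsLeftRep P := by
  obtain ⟨M, p, hp⟩ := hP
  obtain ⟨M, rfl⟩ | ⟨M, rfl⟩ := M.exists_eq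
  · exact ⟨M, p, hp⟩
  · exact (false_of_left_right (hp q).choose).elim

theorem IsLeftRep.isRep {P : (Collage F)ᵒᵖ ⥤ Type w} (hP : IsLeftRep P) : IsRep P :=
  let ⟨_, p, hp⟩ := hP
  ⟨_, p, hp⟩

/-- The restriction to `C` of a presheaf that is represented by `M` is represented by `M`. -/
theorem isUniversal_left {P : (Collage F)ᵒᵖ ⥤ Type w} {M : C} {p : P.obj (op ((left F).obj M))}
    (hp : IsUniversal p) : IsUniversal (P := (left F).op ⋙ P) (M := M) p := by
  intro T p'
  obtain ⟨k, hk, hu⟩ := hp (T := (left F).obj T) p'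
  obtain ⟨k, rfl⟩ := left_map_surjective k
  exact ⟨k, hk, fun l hl => left_map_injective (hu _ hl)⟩

/-- The restriction to `D` of a presheaf that is represented by `M` is represented by `F.obj M`. -/
theorem isUniversal_right {P : (Collage F)ᵒᵖ ⥤ Type w} {M : C} {p : P.obj (op ((left F).obj M))}
    (hp : IsUniversal p) :
    IsUniversal (P := (right F).op ⋙ P) (M := F.obj M) (P.map (glue F M).op p) := by
  intro T p'
  obtain ⟨k, hk, hu⟩ := hp (T := (right F).obj T) p'
  obtain ⟨k, rfl⟩ := exists_eq_comp_glue k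
  have key (l : T ⟶ F.obj M) : ((right F).op ⋙ P).map l.op (P.map (glue F M).op p) =
      P.map ((right F).map l ≫ glue F M).op p := by
    rw [op_comp, Functor.map_comp_apply]
    rfl
  exact ⟨k, (key k).trans hk, fun l hl => comp_glue_injective (hu _ ((key l).symm.trans hl))⟩

variable {SC : MorphismProperty C} {SD : MorphismProperty D}

/-- For presheaves that are represented by objects of `C`, relative covers can be tested on `C`. -/
theorem IsLeftRep.relCover_left_iff (hC : IsCoverClass SC) (hD : IsCoverClass SD)
    (hF : IsGeometric SC SD F) {P Q : (Collage F)ᵒᵖ ⥤ Type w} (hP : IsLeftRep P)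
    (hQ : IsLeftRep Q) (φ : P ⟶ Q) :
    RelCover (covers F SC SD) φ ↔ RelCover SC (Functor.whiskerLeft (left F).op φ) := by
  obtain ⟨M, p, hp⟩ := hP
  obtain ⟨N, q, hq⟩ := hQ
  obtain ⟨k, hk, -⟩ := hq (φ.app _ p)
  obtain ⟨k, rfl⟩ := left_map_surjective k
  exact ⟨fun h => RelCover.of_mem hC (isUniversal_left hp) (isUniversal_left hq) k hk.symm
      ((covers_left_iff k).1 (h.mem (isCoverClass hC hD hF) hp hq _ hk.symm)),
    fun h => RelCover.of_mem (isCoverClass hC hD hF) hp hq _ hk.symm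
      (covers_left (h.mem hC (isUniversal_left hp) (isUniversal_left hq) k hk.symm))⟩

/-- For presheaves that are represented by objects of `C`, relative covers can be tested on `D`,
because `F` preserves and reflects covers. -/
theorem IsLeftRep.relCover_right_iff (hC : IsCoverClass SC) (hD : IsCoverClass SD)
    (hF : IsGeometric SC SD F) (hF' : ReflectsCovers SC SD F) {P Q : (Collage F)ᵒᵖ ⥤ Type w}
    (hP : IsLeftRep P) (hQ : IsLeftRep Q) (φ : P ⟶ Q) :
    RelCover (covers F SC SD) φ ↔ RelCover SD (Functor.whiskerLeft (right F).op φ) := by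
  obtain ⟨M, p, hp⟩ := hP
  obtain ⟨N, q, hq⟩ := hQ
  obtain ⟨k, hk, -⟩ := hq (φ.app _ p)
  obtain ⟨k, rfl⟩ := left_map_surjective k
  have hk' : φ.app _ (P.map (glue F M).op p) =
      Q.map ((right F).map (F.map k)).op (Q.map (glue F N).op q) := by
    rw [NatTrans.naturality_apply, ← hk, ← Functor.map_comp_apply, ← Functor.map_comp_apply,
      ← op_comp, ← op_comp, glue_naturality]
  exact ⟨fun h => RelCover.of_mem hD (isUniversal_right hp) (isUniversal_right hq) (F.map k) hk'
      (hF.map_cover _ ((covers_left_iff k).1 (h.mem (isCoverClass hC hD hF) hp hq _ hk.symm))),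
    fun h => RelCover.of_mem (isCoverClass hC hD hF) hp hq _ hk.symm (covers_left
      (hF' _ (h.mem hD (isUniversal_right hp) (isUniversal_right hq) (F.map k) hk')))⟩

variable {X Y : (Collage F)ᵒᵖ ⥤ SSet.{w}}

/-- A simplicial presheaf on the collage that is levelwise represented by objects of `C`. -/
def LeftLevelRep (X : (Collage F)ᵒᵖ ⥤ SSet.{w}) : Prop :=
  ∀ n : ℕ, IsLeftRep (homPresheaf Δ[n] X)

/-- The matching objects of a hypercover between simplicial objects of `C` are in `C`. -/
theorem isLeftRep_squares_boundary (hS : IsCoverClass (covers F SC SD)) (hX : LeftLevelRep X)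
    (hY : LeftLevelRep Y) {f : X ⟶ Y} {n : ℕ}
    (hf : ∀ m < n, LiftCover (covers F SC SD) (∂Δ[m] : SSet.Subcomplex.{w} _).ι f) :
    IsLeftRep (squares (∂Δ[n] : SSet.Subcomplex.{w} _).ι f) :=
  let ⟨_, x, _⟩ := hX n
  (isRep_squares_boundary hS hf (hY n).isRep).isLeftRep ((toSquares _ f).app _ x)

/-- By induction on the dimension the matching objects are in `C`, so that hypercovers can be tested
on `C`. -/
theorem hyper_left_iff (hC : IsCoverClass SC) (hD : IsCoverClass SD)
    (hF : IsGeometric SC SD F) (hX : LeftLevelRep X) (hY : LeftLevelRep Y) (f : X ⟶ Y) :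
    hyper (covers F SC SD) f ↔ hyper SC (Functor.whiskerLeft (left F).op f) := by
  have key (n : ℕ) (hf : ∀ m < n, LiftCover (covers F SC SD) (∂Δ[m] : SSet.Subcomplex.{w} _).ι f) :=
    (hX n).relCover_left_iff hC hD hF (isLeftRep_squares_boundary (isCoverClass hC hD hF) hX hY hf)
      (toSquares _ f)
  refine ⟨fun h n => (key n fun m _ => h m).1 (h n), fun h n => ?_⟩
  induction n using Nat.strong_induction_on with
  | _ n ih => exact (key n ih).2 (h n)

/-- By induction on the dimension the matching objects are in `C`, so that hypercovers can be tested
on `D`. -/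
theorem hyper_right_iff (hC : IsCoverClass SC) (hD : IsCoverClass SD)
    (hF : IsGeometric SC SD F) (hF' : ReflectsCovers SC SD F) (hX : LeftLevelRep X)
    (hY : LeftLevelRep Y) (f : X ⟶ Y) :
    hyper (covers F SC SD) f ↔ hyper SD (Functor.whiskerLeft (right F).op f) := by
  have key (n : ℕ) (hf : ∀ m < n, LiftCover (covers F SC SD) (∂Δ[m] : SSet.Subcomplex.{w} _).ι f) :=
    (hX n).relCover_right_iff hC hD hF hF'
      (isLeftRep_squares_boundary (isCoverClass hC hD hF) hX hY hf) (toSquares _ f)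
  refine ⟨fun h n => (key n fun m _ => h m).1 (h n), fun h n => ?_⟩
  induction n using Nat.strong_induction_on with
  | _ n ih => exact (key n ih).2 (h n)

/-- The horn objects of a simplicial object of `C` are in `C`, if the Kan condition holds in lower
dimensions. -/
theorem isLeftRep_squares_horn (hS : IsCoverClass (covers F SC SD)) (hX : LeftLevelRep X) {n : ℕ}
    (k : Fin (n + 2)) (hX' : ∀ m < n, ∀ k : Fin (m + 2), LiftCover (covers F SC SD)
      (Λ[m + 1, k] : SSet.Subcomplex.{w} _).ι (toUnit X)) :
    IsLeftRep (squares (Λ[n + 1, k] : SSet.Subcomplex.{w} _).ι (toUnit X)) := by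
  obtain ⟨j, hj⟩ := LiftCover.exists_vertex_horn hS n k fun m k hm => hX' m hm k
  have h : RelCover (covers F SC SD) (homPresheafMap (Λ[n + 1, k] : SSet.Subcomplex.{w} _).ι
      (𝟙_ ((Collage F)ᵒᵖ ⥤ SSet.{w}))) :=
    RelCover.of_bijective hS fun U => ⟨fun _ _ _ => toUnit_unique (C := SSet.{w}) _ _,
      fun _ => ⟨toUnit (C := SSet.{w}) _, toUnit_unique (C := SSet.{w}) _ _⟩⟩
  obtain ⟨_, x, _⟩ := hX (n + 1)
  exact ((h.squares_fst _).isRep (hj.relCover_pre.isRep (hX 0).isRep)).isLeftRep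
    ((toSquares _ _).app _ x)

/-- A simplicial object of `C` that satisfies the Kan condition on `C` satisfies it on the collage.
-/
theorem kan_toUnit_of_left (hC : IsCoverClass SC) (hD : IsCoverClass SD)
    (hF : IsGeometric SC SD F) (hX : LeftLevelRep X) (h : kan SC (toUnit ((left F).op ⋙ X))) :
    kan (covers F SC SD) (toUnit X) := by
  intro n
  induction n using Nat.strong_induction_on with
  | _ n ih =>
    exact fun k => ((hX (n + 1)).relCover_left_iff hC hD hF
      (isLeftRep_squares_horn (isCoverClass hC hD hF) hX k ih) (toSquares _ _)).2 (h n k)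

/-- A simplicial object of `C` that satisfies the Kan condition on the collage satisfies it on `D`.
-/
theorem kan_toUnit_right (hC : IsCoverClass SC) (hD : IsCoverClass SD)
    (hF : IsGeometric SC SD F) (hF' : ReflectsCovers SC SD F) (hX : LeftLevelRep X)
    (h : kan (covers F SC SD) (toUnit X)) : kan SD (toUnit ((right F).op ⋙ X)) :=
  fun n k => ((hX (n + 1)).relCover_right_iff hC hD hF hF'
    (isLeftRep_squares_horn (isCoverClass hC hD hF) hX k fun m _ => h m) (toSquares _ _)).1 (h n k)

/-- The object `X ×_Y Y^I` is levelwise represented by objects of `C`: it is representable, and it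
has elements over objects of `C`, namely the constant paths. -/
theorem leftLevelRep_mapPath (hS : IsCoverClass (covers F SC SD)) (hX : LeftLevelRep X)
    (f : X ⟶ Y) (hX' : IsKanRep (covers F SC SD) X) (hY' : IsKanRep (covers F SC SD) Y) :
    LeftLevelRep (mapPath f) := by
  intro n
  obtain ⟨_, x, _⟩ := hX n
  have s : X ⟶ mapPath f := pullback.lift (𝟙 X) (f ≫ pathConst Y) (by
    rw [Category.assoc, pathConst_pathEnd, Category.id_comp, Category.comp_id])
  exact ((hX'.mapPath hS hY').levelRep n).isLeftRep ((homPresheafPost Δ[n] s).app _ x)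

/-- The weak equivalences between the restrictions of `X` and `Y` to `C` agree with those between
their restrictions to `D`. -/
theorem weak_left_iff_weak_right (hC : IsCoverClass SC) (hD : IsCoverClass SD)
    (hF : IsGeometric SC SD F) (hF' : ReflectsCovers SC SD F) (hX : LeftLevelRep X)
    (hY : LeftLevelRep Y) (hX' : kan (covers F SC SD) (toUnit X))
    (hY' : kan (covers F SC SD) (toUnit Y)) (f : X ⟶ Y) :
    weak SC (Functor.whiskerLeft (left F).op f) ↔ weak SD (Functor.whiskerLeft (right F).op f) := by
  have hP := leftLevelRep_mapPath (isCoverClass hC hD hF) hX f ⟨fun n => (hX n).isRep, hX'⟩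
    ⟨fun n => (hY n).isRep, hY'⟩
  have sq := IsPullback.of_hasPullback f (pathEnd 0 Y)
  exact ((weak_iff_of_isPullback hC (sq.map ((Functor.whiskeringLeft _ _ _).obj (left F).op))).trans
    (hyper_left_iff hC hD hF hP hY (mapPathEnd f)).symm).trans
    ((hyper_right_iff hC hD hF hF' hP hY (mapPathEnd f)).trans (weak_iff_of_isPullback hD
      (sq.map ((Functor.whiskeringLeft _ _ _).obj (right F).op))).symm)

end Restriction

/-! ### Geometric functors and `∞`-groupoids -/

section Geometric

variable {C : Type u} [Category.{v} C] {D : Type u'} [Category.{v'} D] {F : C ⥤ D}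

open Collage

variable (F) in
/-- The functor of points of a simplicial object of `C`, extended to the collage. -/
def collagePoints : SimplicialObject C ⥤ (Collage F)ᵒᵖ ⥤ SSet.{max v v'} :=
  (SimplicialObject.whiskering C (Collage F)).obj (left F) ⋙ points

theorem leftLevelRep_collagePoints (X : SimplicialObject C) :
    LeftLevelRep ((collagePoints F).obj X) :=
  fun n => ⟨X _⦋n⦌, _, isUniversal_tautological (X ⋙ left F) n⟩

/-- The restriction of the extended functor of points to `C`. -/
def collagePointsLeft (X : SimplicialObject C) :
    SizeIso ((left F).op ⋙ (collagePoints F).obj X) (points.obj X) where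
  equiv _ := ⟨fun _ => Equiv.ulift, fun _ _ => rfl⟩
  naturality _ _ _ := rfl

/-- The restriction of the extended functor of points to `D`. -/
def collagePointsRight (X : SimplicialObject C) :
    SizeIso ((right F).op ⋙ (collagePoints F).obj X)
      (points.obj (((SimplicialObject.whiskering C D).obj F).obj X)) where
  equiv _ := ⟨fun _ => Equiv.ulift, fun _ _ => rfl⟩
  naturality _ _ _ := rfl

variable {SC : MorphismProperty C} {SD : MorphismProperty D}

theorem kan_collagePoints (hC : IsCoverClass SC) (hD : IsCoverClass SD)
    (hF : IsGeometric SC SD F) {X : SimplicialObject C} (hX : kan SC (toUnit (points.obj X))) :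
    kan (covers F SC SD) (toUnit ((collagePoints F).obj X)) :=
  kan_toUnit_of_left hC hD hF (leftLevelRep_collagePoints X)
    (hX.toUnit_of_sizeIso (collagePointsLeft X).symm)

/-- The functor `F` sends `∞`-groupoids to `∞`-groupoids. -/
theorem kan_toUnit_map (hC : IsCoverClass SC) (hD : IsCoverClass SD)
    (hF : IsGeometric SC SD F) (hF' : ReflectsCovers SC SD F) {X : SimplicialObject C}
    (hX : kan SC (toUnit (points.obj X))) :
    kan SD (toUnit (points.obj (((SimplicialObject.whiskering C D).obj F).obj X))) :=
  (kan_toUnit_right hC hD hF hF' (leftLevelRep_collagePoints X)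
    (kan_collagePoints hC hD hF hX)).toUnit_of_sizeIso (collagePointsRight X)

/-- A morphism of `∞`-groupoids is a weak equivalence over `C` if and only if its image under `F` is
one over `D`. -/
theorem weak_map_iff (hC : IsCoverClass SC) (hD : IsCoverClass SD)
    (hF : IsGeometric SC SD F) (hF' : ReflectsCovers SC SD F) {X Y : SimplicialObject C}
    (hX : kan SC (toUnit (points.obj X))) (hY : kan SC (toUnit (points.obj Y))) (f : X ⟶ Y) :
    weak SC (points.map f) ↔
      weak SD (points.map (((SimplicialObject.whiskering C D).obj F).map f)) := by
  have h₁ : CorrHom (collagePointsLeft X) (collagePointsLeft Y)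
      (Functor.whiskerLeft (left F).op ((collagePoints F).map f)) (points.map f) :=
    fun _ _ _ => rfl
  have h₂ : CorrHom (collagePointsRight X) (collagePointsRight Y)
      (Functor.whiskerLeft (right F).op ((collagePoints F).map f))
      (points.map (((SimplicialObject.whiskering C D).obj F).map f)) :=
    fun _ _ _ => rfl
  have key := weak_left_iff_weak_right hC hD hF hF' (leftLevelRep_collagePoints X)
    (leftLevelRep_collagePoints Y) (kan_collagePoints hC hD hF hX)
    (kan_collagePoints hC hD hF hY) ((collagePoints F).map f)
  exact ⟨fun h => weak.of_corr h₂ (key.1 (weak.of_corr h₁.symm h)),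
    fun h => weak.of_corr h₁ (key.2 (weak.of_corr h₂.symm h))⟩

end Geometric

end HigherGpd

theorem mainTheorem7
    {C : Type u} [Category.{v} C] [HasTerminal C]
    {D : Type u'} [Category.{v'} D] [HasFiniteLimits D]
    (SC : MorphismProperty C) [IsCategoryWithCovers SC]
    (SD : MorphismProperty D) [IsDescentCategory SD]
    (F : C ⥤ D) (hF : IsGeometric SC SD F) (hF' : ReflectsCovers SC SD F) :
    -- `F_•` sends `∞`-groupoids to `∞`-groupoids, and `Gpd SC` has finite products
    ∃ (hGpd : ∀ X : Gpd SC,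
        isInftyGroupoid SD (((SimplicialObject.whiskering C D).obj F).obj X.obj))
      (_ : HasFiniteProducts (Gpd SC)),
      IsICFO ((gpdWeakEquivalences SD).inverseImage (gpdMap F hGpd)) (gpdKanFibrations SC) ∧
      -- the path spaces `X^I` are functorial path objects
      (∃ (T : FunctorialPathObject
            ((gpdWeakEquivalences SD).inverseImage (gpdMap F hGpd)) (gpdKanFibrations SC))
        (e : T.path ⋙ (isInftyGroupoid SC).ι ⋙ points ≅
          (isInftyGroupoid SC).ι ⋙ points ⋙ (Functor.whiskeringRight _ _ _).obj pathSSet),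
        ∀ X : Gpd SC, IsPathSpace (X := X.obj) (P := (T.path.obj X).obj) (e.app X)
          (T.s.app X).hom (T.d₀.app X).hom (T.d₁.app X).hom) ∧
      -- the acyclic fibrations are exactly the hypercovers
      (gpdWeakEquivalences SD).inverseImage (gpdMap F hGpd) ⊓ gpdKanFibrations SC =
        gpdHypercovers SC := by
  have hC := isCoverClass_of_isCategoryWithCovers SC
  have hD := isCoverClass_of_isDescentCategory SD
  have hGpd (X : Gpd SC) :
      isInftyGroupoid SD (((SimplicialObject.whiskering C D).obj F).obj X.obj) :=
    (isInftyGroupoid_iff hD _).2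
      (kan_toUnit_map hC hD hF hF' ((isInftyGroupoid_iff hC _).1 X.property))
  have hfp := hasFiniteProducts_gpd SC
  have hW : (gpdWeakEquivalences SD).inverseImage (gpdMap F hGpd) = gpdWeakEquivalences SC := by
    ext X Y f
    exact (gpdWeakEquivalences_iff hD _).trans ((weak_map_iff hC hD hF hF'
      ((isInftyGroupoid_iff hC _).1 X.property) ((isInftyGroupoid_iff hC _).1 Y.property)
      f.hom).symm.trans (gpdWeakEquivalences_iff hC f).symm)
  refine ⟨hGpd, hfp, ?_⟩
  rw [hW]
  exact ⟨isICFO_gpd SC, exists_functorialPathObject SC,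
    gpdWeakEquivalences_inf_gpdKanFibrations SC hC⟩
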